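/- **Setting.** Let $\theta\in\mathbb R$ and let $C(\mathbb T^2_\theta)$ be the $C^*$-algebra generated by two unitaries $U,V$ with $VU=e^{2\pi i\theta}UV$, realized in the regular representation on $\ell^2(\mathbb Z^2)$. Let $\varphi_0$ be its canonical trace ($\varphi_0(1)=1$, $\varphi_0(U^mV^n)=0$ for $(m,n)\ne(0,0)$), let $C^\infty(\mathbb T^2_\theta)$ be the algebra of smooth vectors of the translation action of the two-torus, and let $\nabla_1,\nabla_2$ be the infinitesimal generators of that action, normalized so that $i\nabla_1(U)=U$, $i\nabla_1(V)=0$, $i\nabla_2(U)=0$, $i\nabla_2(V)=V$. Let $g$ be a flat metric, i.e. a constant real symmetric positive definite $2\times2$ matrix, with inverse $(g^{lm})$ (the standard flat metric is $g=1$). For $h=h^*$ in $C^\infty(\mathbb T^2_\theta)$ put $k=e^h$ and $k^j=e^{jh}$ ($j\in\mathbb R$), let $\mathbf y(\rho)=k^{-1}\rho k$ be the modular operator, with powers $\mathbf y^{z}(\rho)=e^{-zh}\rho e^{zh}$, and let $\mathbf y_1,\mathbf y_2$ denote $\mathbf y$ acting on the first, respectively second, factor of a product. *Functional calculus.* If $K(e^{x_1},e^{x_2})=\int_{\mathbb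 R^2}\beta(\xi)e^{-i(x_1\xi_1+x_2\xi_2)}\,d\xi$ for all $|x_1|,|x_2|\le 2\|h\|$, with $\beta$ integrable, then $$K(\mathbf y_1,\mathbf y_2)(\rho_1\rho_2)=\int_{\mathbb R^2}\beta(\xi)\,\mathbf y^{-i\xi_1}(\rho_1)\,\mathbf y^{-i\xi_2}(\rho_2)\,d\xi ,$$ and similarly $K(\mathbf y)(\rho)=\int_{\mathbb R}\beta(\xi)\,\mathbf y^{-i\xi}(\rho)\,d\xi$ for functions of one variable. *Operations on functions.* For $f$ on $(0,\infty)$ write $[x,y]f=\frac{f(x)-f(y)}{x-y}$ for $x\neq y$, and $[x,x]f=f'(x)$. For a smooth $T:(0,\infty)\to\mathbb C$ and $j\in\mathbb R$ put $$D(T)(y_1,y_2)=y_1\,[y_1y_2,y_1]T=\frac{T(y_1y_2)-T(y_1)}{y_2-1},\qquad \mathcal I(T;j)(y)=y^jT(y^{-1}),$$ $$\mathrm I^{(1)}(T;j)(y)=-T(y),\qquad \mathrm I^{(2)}(T;j)(y)=-\mathcal I(T;j)(y),$$ $$\mathrm{II}^{(1)}(T;j)(y_1,y_2)=\big([1,y_1^{-1}y_2^{-1}]\,\mathrm{id}^j\big)(y_1y_2)^{j-1}T(y_1)=\frac{(y_1y_2)^j-1}{y_1y_2-1}\,T(y_1),$$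 $$\mathrm{II}^{(2)}(T;j)(y_1,y_2)=y_2^{-1}y_1^{j-1}D(T)(y_2,y_1^{-1}y_2^{-1})-(y_1y_2)^{j-1}D(T)(y_1,y_1^{-1}y_2^{-1}),$$ $$\mathrm{II}^{(3)}(T;j)(y_1,y_2)=-y_1^{-1}D(T)(y_1,y_2)+D(T)(y_2,y_1)-\big([1,y_1]\,\mathrm{id}^j\big)T(y_2),$$ $$\mathrm{II}^{(4)}(T;j)=\mathrm{II}^{(3)}(\mathcal I(T;j);j).$$ **Theorem.** Let $j\in\mathbb R$, let $T:(0,\infty)\to\mathbb C$ be smooth, let $h,a\in C^\infty(\mathbb T^2_\theta)$ be self-adjoint, and put $k=e^h$, $k_\varepsilon=e^{h+\varepsilon a}$ and $\delta_a=\frac{d}{d\varepsilon}\big|_{\varepsilon=0}$. Then all the functional-calculus expressions below are well defined (a function $\beta$ as above exists, and the result does not depend on its choice; for $T(\mathbf y)$, this holds at every $k_\varepsilon$), the function $\varepsilon\mapsto\varphi_0\big(\sum_{l,m}g^{lm}\,k_\varepsilon^j\,T(\mathbf y)(\nabla_lk_\varepsilon)\,\nabla_mk_\varepsilon\big)$,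 where $\mathbf y$ is the modular operator of $k_\varepsilon$, is differentiable at $\varepsilon=0$, and $$\delta_a\,\varphi_0\Big(\sum_{l,m}g^{lm}k^jT(\mathbf y)(\nabla_lk)\,\nabla_mk\Big)=\varphi_0\Big(\delta_a(k)\,k^j\sum_{l,m}g^{lm}\big(\mathrm I^{(1)}+\mathrm I^{(2)}\big)(T;j)(\mathbf y)(\nabla_l\nabla_mk)\Big)$$ $$\qquad+\ \varphi_0\Big(\delta_a(k)\,k^{j-1}\sum_{l,m}g^{lm}\Big(\sum_{\beta=1}^4\mathrm{II}^{(\beta)}\Big)(T;j)(\mathbf y_1,\mathbf y_2)(\nabla_lk\cdot\nabla_mk)\Big).$$ -/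

import Mathlib

open Set MeasureTheory
open scoped ContDiff

noncomputable section

namespace NCTorus

/-! ### The noncommutative two-torus in its regular representation on `ℓ²(ℤ²)` -/

/-- The Hilbert space `ℓ²(ℤ²)`. -/
abbrev Hil : Type := lp (fun _ : ℤ × ℤ => ℂ) 2

/-- The bounded operators on `ℓ²(ℤ²)`. -/
abbrev Op : Type := Hil →L[ℂ] Hil

/-- The isometry `(W f)(n) = c(n) f(σ n)` of `ℓ²(ℤ²)`, for a permutation `σ` of `ℤ²` and
weights `c(n)` of modulus one. -/
def weightedPerm (σ : Equiv.Perm (ℤ × ℤ)) (c : ℤ × ℤ → Circle) : Hil →ₗᵢ[ℂ] Hil where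
  toFun f := ⟨fun n => (c n : ℂ) * f (σ n), by
    have hf := (memℓp_gen_iff (p := 2) (by norm_num)).1 (lp.memℓp f)
    refine (memℓp_gen_iff (p := 2) (by norm_num)).2 ?_
    have hn : ∀ n, ‖(c n : ℂ) * f (σ n)‖ = ‖f (σ n)‖ := fun n => by
      rw [norm_mul, Circle.norm_coe, one_mul]
    simp only [hn]
    exact σ.summable_iff.2 hf⟩
  map_add' f g := by
    ext n
    exact mul_add _ _ _
  map_smul' z f := by
    ext n
    exact mul_left_comm _ _ _
  norm_map' f := by
    have h2 : 0 < (2 : ENNReal).toReal := by norm_num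
    rw [lp.norm_eq_tsum_rpow h2, lp.norm_eq_tsum_rpow h2]
    refine congrArg (fun r : ℝ => r ^ (1 / (2 : ENNReal).toReal)) ?_
    refine Eq.trans (tsum_congr fun n => ?_) (σ.tsum_eq fun n => ‖f n‖ ^ (2 : ENNReal).toReal)
    change ‖(c n : ℂ) * f (σ n)‖ ^ _ = _
    rw [norm_mul, Circle.norm_coe, one_mul]

/-- The unitary `U`: `(U f)(m, n) = f(m - 1, n)`. -/
def genU : Op :=
  (weightedPerm (Equiv.prodCongr (Equiv.subRight 1) (Equiv.refl ℤ)) 1).toContinuousLinearMap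

/-- The unitary `V`: `(V f)(m, n) = e^{2πiθm} f(m, n - 1)`, so that `V U = e^{2πiθ} U V`. -/
def genV (θ : ℝ) : Op :=
  (weightedPerm (Equiv.prodCongr (Equiv.refl ℤ) (Equiv.subRight 1))
    (fun p => Circle.exp (2 * Real.pi * θ * p.1))).toContinuousLinearMap

/-- The `C*`-algebra `C(𝕋²_θ)`: the norm closure of the `*`-algebra generated by `U` and `V`. -/
def contTorus (θ : ℝ) : StarSubalgebra ℂ Op :=
  (StarAlgebra.adjoin ℂ {genU, genV θ}).topologicalClosure

/-- The diagonal unitary `(u_t f)(m, n) = e^{-i(t₀ m + t₁ n)} f(m, n)`. -/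
def modulation (t : Fin 2 → ℝ) : Op :=
  (weightedPerm (Equiv.refl (ℤ × ℤ))
    (fun p => Circle.exp (-(t 0 * p.1 + t 1 * p.2)))).toContinuousLinearMap

/-- The translation action of the two-torus, `α_t(a) = u_t a u_t⁻¹`:
`α_t(U) = e^{-it₀} U` and `α_t(V) = e^{-it₁} V`. -/
def translate (t : Fin 2 → ℝ) (a : Op) : Op :=
  modulation t * a * modulation (-t)

/-- `a ∈ C^∞(𝕋²_θ)`: the element `a` of `C(𝕋²_θ)` is a smooth vector of the translation action. -/
def IsSmooth (θ : ℝ) (a : Op) : Prop :=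
  a ∈ contTorus θ ∧ ContDiff ℝ ∞ (fun t : Fin 2 → ℝ => translate t a)

/-- The `l`-th component `∇_l` of the flat connection, the infinitesimal generator of the
translations; `i∇_l` is the `l`-th basic derivation: `i∇₀(U) = U`, `i∇₀(V) = 0`, `i∇₁(U) = 0`,
`i∇₁(V) = V`. -/
def nabla (l : Fin 2) (a : Op) : Op :=
  deriv (fun s : ℝ => translate (Pi.single l s) a) 0

/-- The canonical trace `φ₀(a) = ⟨e₀, a e₀⟩`: `φ₀(1) = 1` and `φ₀(U^m V^n) = 0` for
`(m, n) ≠ (0, 0)`. -/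
def trace (a : Op) : ℂ :=
  inner ℂ (lp.single 2 (0 : ℤ × ℤ) (1 : ℂ) : Hil) (a (lp.single 2 (0 : ℤ × ℤ) (1 : ℂ)))

/-! ### The Weyl factor and the functional calculus of the modular operator -/

/-- The real power `k^j = e^{jh}` of the Weyl factor `k = e^h`. -/
def weylPow (h : Op) (j : ℝ) : Op := NormedSpace.exp ((j : ℂ) • h)

/-- The Weyl factor `k = e^h`. -/
def weyl (h : Op) : Op := NormedSpace.exp h

/-- The complex power `𝐲^z(ρ) = k^{-z} ρ k^z` of the modular operator `𝐲(ρ) = k⁻¹ ρ k`,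
where `k = e^h`. -/
def modPow (h : Op) (z : ℂ) (ρ : Op) : Op :=
  NormedSpace.exp (-(z • h)) * ρ * NormedSpace.exp (z • h)

/-- `b` is a value of `K(𝐲)(ρ)`: there is an integrable `β` with `K(e^x) = ∫ β(ξ) e^{-ixξ} dξ` on the
interval `|x| ≤ 2‖h‖`, which contains the spectrum of the modular derivation `log 𝐲 = [·, h]`, and
`b = ∫ β(ξ) 𝐲^{-iξ}(ρ) dξ`. -/
def IsModCalc₁ (h : Op) (K : ℝ → ℂ) (ρ b : Op) : Prop :=
  ∃ β : ℝ → ℂ, Integrable β ∧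
    (∀ x : ℝ, |x| ≤ 2 * ‖h‖ →
      K (Real.exp x) = ∫ ξ : ℝ, β ξ * Complex.exp (-(Complex.I * (x * ξ)))) ∧
    b = ∫ ξ : ℝ, β ξ • modPow h (-(Complex.I * ξ)) ρ

/-- `b` is a value of `K(𝐲₁, 𝐲₂)(ρ₁ ρ₂)`: there is an integrable `β` with
`K(e^{x₁}, e^{x₂}) = ∫ β(ξ₁, ξ₂) e^{-i(x₁ξ₁ + x₂ξ₂)} dξ` whenever `|x₁|, |x₂| ≤ 2‖h‖`, and
`b = ∫ β(ξ₁, ξ₂) 𝐲^{-iξ₁}(ρ₁) 𝐲^{-iξ₂}(ρ₂) dξ`. -/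
def IsModCalc₂ (h : Op) (K : ℝ → ℝ → ℂ) (ρ₁ ρ₂ b : Op) : Prop :=
  ∃ β : ℝ × ℝ → ℂ, Integrable β ∧
    (∀ x₁ x₂ : ℝ, |x₁| ≤ 2 * ‖h‖ → |x₂| ≤ 2 * ‖h‖ →
      K (Real.exp x₁) (Real.exp x₂) =
        ∫ ξ : ℝ × ℝ, β ξ * Complex.exp (-(Complex.I * (x₁ * ξ.1 + x₂ * ξ.2)))) ∧
    b = ∫ ξ : ℝ × ℝ, β ξ • (modPow h (-(Complex.I * ξ.1)) ρ₁ * modPow h (-(Complex.I * ξ.2)) ρ₂)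

/-- The element `K(𝐲)(ρ)`. -/
def modCalc₁ (h : Op) (K : ℝ → ℂ) (ρ : Op) : Op :=
  Classical.epsilon (IsModCalc₁ h K ρ)

/-- The element `K(𝐲₁, 𝐲₂)(ρ₁ ρ₂)`. -/
def modCalc₂ (h : Op) (K : ℝ → ℝ → ℂ) (ρ₁ ρ₂ : Op) : Op :=
  Classical.epsilon (IsModCalc₂ h K ρ₁ ρ₂)

/-! ### The operations on spectral functions

`dslope f x y` is the divided difference `[x, y]f = (f(x) - f(y)) / (x - y)`, with the value `f'(x)`
for `x = y`. -/

/-- The divided difference `[x, y] id^j` of the power function `z ↦ z^j`. -/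
def powDiff (j x y : ℝ) : ℂ := ((dslope (fun z : ℝ => z ^ j) x y : ℝ) : ℂ)

/-- `D(T)(y₁, y₂) = y₁ [y₁y₂, y₁]T = (T(y₁y₂) - T(y₁)) / (y₂ - 1)`. -/
def opD (T : ℝ → ℂ) (y₁ y₂ : ℝ) : ℂ := (y₁ : ℂ) * dslope T (y₁ * y₂) y₁

/-- `𝓘(T; j)(y) = y^j T(y⁻¹)`. -/
def opInv (T : ℝ → ℂ) (j y : ℝ) : ℂ := ((y ^ j : ℝ) : ℂ) * T y⁻¹

/-- `I⁽¹⁾(T; j)(y) = -T(y)`. -/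
def opI1 (T : ℝ → ℂ) (_j y : ℝ) : ℂ := -T y

/-- `I⁽²⁾(T; j)(y) = -𝓘(T; j)(y)`. -/
def opI2 (T : ℝ → ℂ) (j y : ℝ) : ℂ := -opInv T j y

/-- `II⁽¹⁾(T; j)(y₁, y₂) = [1, y₁⁻¹y₂⁻¹]id^j (y₁y₂)^{j-1} T(y₁)`. -/
def opII1 (T : ℝ → ℂ) (j y₁ y₂ : ℝ) : ℂ :=
  powDiff j 1 (y₁⁻¹ * y₂⁻¹) * (((y₁ * y₂) ^ (j - 1) : ℝ) : ℂ) * T y₁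

/-- `II⁽²⁾(T; j)(y₁, y₂) =
y₂⁻¹ y₁^{j-1} D(T)(y₂, y₁⁻¹y₂⁻¹) - (y₁y₂)^{j-1} D(T)(y₁, y₁⁻¹y₂⁻¹)`. -/
def opII2 (T : ℝ → ℂ) (j y₁ y₂ : ℝ) : ℂ :=
  ((y₂⁻¹ * y₁ ^ (j - 1) : ℝ) : ℂ) * opD T y₂ (y₁⁻¹ * y₂⁻¹)
    - (((y₁ * y₂) ^ (j - 1) : ℝ) : ℂ) * opD T y₁ (y₁⁻¹ * y₂⁻¹)

/-- `II⁽³⁾(T; j)(y₁, y₂) = -y₁⁻¹ D(T)(y₁, y₂) + D(T)(y₂, y₁) - [1, y₁]id^j T(y₂)`. -/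
def opII3 (T : ℝ → ℂ) (j y₁ y₂ : ℝ) : ℂ :=
  -((y₁⁻¹ : ℝ) : ℂ) * opD T y₁ y₂ + opD T y₂ y₁ - powDiff j 1 y₁ * T y₂

/-- `II⁽⁴⁾(T; j) = II⁽³⁾(𝓘(T; j); j)`. -/
def opII4 (T : ℝ → ℂ) (j y₁ y₂ : ℝ) : ℂ := opII3 (opInv T j) j y₁ y₂

/-- `I⁽¹⁾(T; j) + I⁽²⁾(T; j)`. -/
def opI (T : ℝ → ℂ) (j y : ℝ) : ℂ := opI1 T j y + opI2 T j y

/-- `∑_β II⁽β⁾(T; j)`, `β = 1, 2, 3, 4`. -/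
def opII (T : ℝ → ℂ) (j y₁ y₂ : ℝ) : ℂ :=
  opII1 T j y₁ y₂ + opII2 T j y₁ y₂ + opII3 T j y₁ y₂ + opII4 T j y₁ y₂

/-! ### The local functional and its variation -/

/-- `φ₀(k^j T(𝐲)(∇k)·∇k)` for `k = e^h`, where the dot is the contraction with the inverse `g⁻¹` of
the flat metric `g`. -/
def localFunctional (g : Matrix (Fin 2) (Fin 2) ℝ) (j : ℝ) (T : ℝ → ℂ) (h : Op) : ℂ :=
  trace (∑ l, ∑ m, ((g⁻¹ l m : ℝ) : ℂ) •
    (weylPow h j * modCalc₁ h T (nabla l (weyl h)) * nabla m (weyl h)))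

/-- The variation `δ_a(k) = d/dε|_{ε=0} e^{h+εa}` of the Weyl factor. -/
def varWeyl (h a : Op) : Op := deriv (fun ε : ℝ => weyl (h + (ε : ℂ) • a)) 0

end NCTorus

end

/-!
Put `p = j + iξ` and `q = -iξ`, so that `k^j 𝐲^{-iξ}(ρ) = k^p ρ k^q`. If
`T(e^x) = ∫ β(ξ) e^{-ixξ} dξ` with `β` a Schwartz function, the functional is `∫ β(ξ) φ₀(∑ g^{lm} k^p ∇_l k k^q ∇_m k) dξ`, and one
`β` serves for all `ε` near `0`. It is differentiated under the integral sign
(`hasDerivAt_integral_cexp_mul_cexp_mul`). The variation of `∇k` is `∇` of the variation of `k`, by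
the symmetry of the second derivative of the exponential (`hasDerivAt_fderiv_exp_nabla`), and an
integration by parts, which uses that `φ₀` is a trace annihilating the range of the derivations
`∇_l`, moves that `∇` to the other factors (`trace_prodDeriv`). Since
`δ_a(k^p) = ∫₀¹ p k^{(1-s)p} a k^{sp} ds` and the trace allows this Duhamel transform to be moved to
the other factor (`trace_mul_duh`), the variation becomes the trace of `δ_a(k)`, respectively of
`a`, times an operator integral, and it remains to prove two identities between operators, which
involve no trace: `integral_cexp_mul_mul_cexp` for the terms with second derivatives and
`integral_varOp` for the others.

These identities would be immediate if `h` had finitely many eigenvalues: compressing both sides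
to eigenspaces turns them into scalar identities. For the terms without second derivatives the
scalar identity is `integral_varSymbol`, which for distinct eigenvalues is the algebraic identity
`opII_homogeneous` between the spectral function `∑ II` and six values of `(a, b) ↦ a^j T(b/a)`, and
extends to coincident eigenvalues by continuity. The general case follows because a self-adjoint
operator on a separable Hilbert space is the strong limit of self-adjoint operators with finitely
many eigenvalues and no larger norm (`exists_strongLim_resolution`), and both sides are strongly
continuous on bounded sets of self-adjoint operators. The same approximation shows that the
functional calculus does not depend on the choice of `β`. That some `β` exists follows from the
smoothness of the spectral functions in logarithmic coordinates, which for the divided differences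
is Hadamard's lemma (`contDiff_dslope`).

The trace property of `φ₀` holds because the generators act on the vector `e₀` like right
translations, which commute with the algebra (`trace_mul_comm`). The analysis is carried out for
bounded operators on an arbitrary Hilbert space, with the torus entering only through the structure
`TracialAction`.
-/

namespace WeylVariation

/-! ### The exponential of bounded operators -/

section BanachAlgebra

variable {A : Type*} [NormedRing A] [NormedAlgebra ℂ A] [CompleteSpace A]

theorem hasSum_exp_complex (w : ℂ) :
    HasSum (fun n : ℕ => (n.factorial : ℂ)⁻¹ * w ^ n) (Complex.exp w) := by
  have := NormedSpace.exp_series_hasSum_exp' (𝕂 := ℂ) w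
  simpa only [smul_eq_mul, ← Complex.exp_eq_exp_ℂ] using this

theorem exp_mul_eigen {h P : A} {x : ℂ} (hP : h * P = x • P) :
    NormedSpace.exp h * P = Complex.exp x • P := by
  have hn : ∀ n : ℕ, h ^ n * P = x ^ n • P := by
    intro n
    induction n with
    | zero => simp
    | succ n ih => rw [pow_succ, mul_assoc, hP, mul_smul_comm, ih, smul_smul, pow_succ, mul_comm]
  have h1 := (NormedSpace.exp_series_hasSum_exp' (𝕂 := ℂ) h).mul_right P
  simp only [smul_mul_assoc, hn, smul_smul] at h1
  exact h1.unique ((hasSum_exp_complex x).smul_const P)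

theorem eigen_mul_exp {h P : A} {x : ℂ} (hP : P * h = x • P) :
    P * NormedSpace.exp h = Complex.exp x • P := by
  have hn : ∀ n : ℕ, P * h ^ n = x ^ n • P := by
    intro n
    induction n with
    | zero => simp
    | succ n ih => rw [pow_succ', ← mul_assoc, hP, smul_mul_assoc, ih, smul_smul, pow_succ']
  have h1 := (NormedSpace.exp_series_hasSum_exp' (𝕂 := ℂ) h).mul_left P
  simp only [mul_smul_comm, hn, smul_smul] at h1
  exact h1.unique ((hasSum_exp_complex x).smul_const P)

theorem norm_exp_le [NormOneClass A] (h : A) : ‖NormedSpace.exp h‖ ≤ Real.exp ‖h‖ := by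
  have h1 := NormedSpace.exp_series_hasSum_exp' (𝕂 := ℂ) h
  have h2 := NormedSpace.exp_series_hasSum_exp' (𝕂 := ℝ) ‖h‖
  rw [← Real.exp_eq_exp_ℝ] at h2
  refine h1.norm_le_of_bounded h2 fun n => ?_
  rw [norm_smul, norm_inv, Complex.norm_natCast, smul_eq_mul]
  exact mul_le_mul_of_nonneg_left (norm_pow_le h n) (by positivity)

end BanachAlgebra

section Exponential

open Filter Topology

variable {E : Type*} [NormedAddCommGroup E] [InnerProductSpace ℂ E] [CompleteSpace E]

local notation "𝓑" => E →L[ℂ] E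

/-- The holomorphic one-parameter group `e^{zh}` generated by a bounded operator `h`. -/
noncomputable def cexp (z : ℂ) (h : 𝓑) : 𝓑 := NormedSpace.exp (z • h)

theorem contDiff_exp : ContDiff ℝ ∞ (NormedSpace.exp : 𝓑 → 𝓑) :=
  contDiff_iff_contDiffAt.2 fun x => (NormedSpace.exp_analytic (𝕂 := ℝ) x).contDiffAt

@[fun_prop]
theorem continuous_cexp {X : Type*} [TopologicalSpace X] {f : X → ℂ} {g : X → 𝓑}
    (hf : Continuous f) (hg : Continuous g) : Continuous fun x => cexp (f x) (g x) :=
  contDiff_exp.continuous.comp (hf.smul hg)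

theorem cexp_add (z w : ℂ) (h : 𝓑) : cexp (z + w) h = cexp z h * cexp w h := by
  let _ : NormedAlgebra ℚ 𝓑 := NormedAlgebra.restrictScalars ℚ ℝ 𝓑
  rw [cexp, add_smul, NormedSpace.exp_add_of_commute
    (((Commute.refl h).smul_left z).smul_right w)]
  rfl

@[simp]
theorem cexp_zero (h : 𝓑) : cexp 0 h = 1 := by
  let _ : NormedAlgebra ℚ 𝓑 := NormedAlgebra.restrictScalars ℚ ℝ 𝓑
  rw [cexp, zero_smul, NormedSpace.exp_zero]

theorem cexp_smul (z w : ℂ) (h : 𝓑) : cexp z (w • h) = cexp (z * w) h := by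
  rw [cexp, cexp, smul_smul]

theorem hasDerivAt_cexp {f : ℝ → ℂ} {f' : ℂ} {s : ℝ} (hf : HasDerivAt f f' s) (h : 𝓑) :
    HasDerivAt (fun s => cexp (f s) h) (f' • (cexp (f s) h * h)) s :=
  HasDerivAt.scomp s (hasDerivAt_exp_smul_const (𝕂 := ℂ) h (f s)) hf

theorem hasDerivAt_cexp' {f : ℝ → ℂ} {f' : ℂ} {s : ℝ} (hf : HasDerivAt f f' s) (h : 𝓑) :
    HasDerivAt (fun s => cexp (f s) h) (f' • (h * cexp (f s) h)) s :=
  HasDerivAt.scomp s (hasDerivAt_exp_smul_const' (𝕂 := ℂ) h (f s)) hf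

theorem norm_cexp_le {h : 𝓑} (hh : IsSelfAdjoint h) (z : ℂ) :
    ‖cexp z h‖ ≤ Real.exp (|z.re| * ‖h‖) := by
  let _ : NormedAlgebra ℚ 𝓑 := NormedAlgebra.restrictScalars ℚ ℝ 𝓑
  rcases subsingleton_or_nontrivial E with hE | hE
  · rw [Subsingleton.elim (cexp z h) 0, norm_zero]
    exact (Real.exp_pos _).le
  have hz : cexp z h = cexp (z.re : ℂ) h * cexp (Complex.I * z.im) h := by
    rw [← cexp_add, mul_comm Complex.I, Complex.re_add_im]
  have h1 : ‖cexp (Complex.I * z.im) h‖ = 1 := by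
    have hm : IsSelfAdjoint (((z.im : ℝ) : ℂ) • h) :=
      IsSelfAdjoint.smul (by simp [IsSelfAdjoint]) hh
    have := (selfAdjoint.expUnitary (⟨_, hm⟩ : selfAdjoint 𝓑)).2
    rw [selfAdjoint.expUnitary_coe, smul_smul] at this
    exact CStarRing.norm_of_mem_unitary this
  have h2 : ‖cexp (z.re : ℂ) h‖ ≤ Real.exp (|z.re| * ‖h‖) := by
    refine (norm_exp_le _).trans (Real.exp_le_exp.2 ?_)
    rw [norm_smul, Complex.norm_real, Real.norm_eq_abs]
  rw [hz]
  refine (norm_mul_le _ _).trans ?_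
  rw [h1, mul_one]
  exact h2

theorem hasSum_cexp (z : ℂ) (h : 𝓑) :
    HasSum (fun n : ℕ => ((n.factorial : ℂ)⁻¹ * z ^ n) • h ^ n) (cexp z h) := by
  have := NormedSpace.exp_series_hasSum_exp' (𝕂 := ℂ) (z • h)
  simp only [smul_pow, smul_smul] at this
  exact this

theorem cexp_mul_eigen {h P : 𝓑} {x : ℂ} (hP : h * P = x • P) (z : ℂ) :
    cexp z h * P = Complex.exp (z * x) • P := by
  have := exp_mul_eigen (h := z • h) (P := P) (x := z * x)
    (by rw [smul_mul_assoc, hP, smul_smul])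
  exact this

theorem eigen_mul_cexp {h P : 𝓑} {x : ℂ} (hP : P * h = x • P) (z : ℂ) :
    P * cexp z h = Complex.exp (z * x) • P := by
  have := eigen_mul_exp (h := z • h) (P := P) (x := z * x)
    (by rw [mul_smul_comm, hP, smul_smul])
  exact this

end Exponential

/-! ### Duhamel's formula -/

section Duhamel

open Filter Topology

variable {E : Type*} [NormedAddCommGroup E] [InnerProductSpace ℂ E] [CompleteSpace E]

local notation "𝓑" => E →L[ℂ] E

/-- The Duhamel transform `∫₀¹ p e^{(1-s)ph} X e^{sph} ds`, which is the derivative of `H ↦ e^{pH}`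
at `h` in the direction `X`. -/
noncomputable def duh (h : 𝓑) (p : ℂ) (X : 𝓑) : 𝓑 :=
  ∫ s in (0 : ℝ)..1, p • (cexp ((1 - s) * p) h * X * cexp (s * p) h)

@[fun_prop]
theorem continuous_duh {X : Type*} [TopologicalSpace X] {f : X → 𝓑} {p : X → ℂ} {g : X → 𝓑}
    (hf : Continuous f) (hp : Continuous p) (hg : Continuous g) :
    Continuous fun x => duh (f x) (p x) (g x) := by
  refine intervalIntegral.continuous_parametric_intervalIntegral_of_continuous'
    (f := fun x s => p x • (cexp ((1 - (s : ℝ)) * p x) (f x) * g x * cexp (s * p x) (f x))) ?_ 0 1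
  simp only [Function.uncurry_def]
  fun_prop

theorem duh_eq_duh_one (h : 𝓑) (p : ℂ) (X : 𝓑) : duh h p X = duh (p • h) 1 (p • X) := by
  simp only [duh, cexp_smul, one_smul, mul_one, mul_smul_comm, smul_mul_assoc]

theorem norm_duh_le {h : 𝓑} (hh : IsSelfAdjoint h) (p : ℂ) (X : 𝓑) :
    ‖duh h p X‖ ≤ ‖p‖ * (Real.exp (|p.re| * ‖h‖) ^ 2 * ‖X‖) := by
  have hb : ∀ s ∈ uIoc (0 : ℝ) 1,
      ‖p • (cexp ((1 - s) * p) h * X * cexp (s * p) h)‖ ≤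
        ‖p‖ * (Real.exp (|p.re| * ‖h‖) ^ 2 * ‖X‖) := by
    intro s hs
    rw [uIoc_of_le zero_le_one] at hs
    have key : ∀ r : ℝ, |r| ≤ 1 → ‖cexp (r * p) h‖ ≤ Real.exp (|p.re| * ‖h‖) := by
      intro r hr
      refine (norm_cexp_le hh _).trans (Real.exp_le_exp.2 ?_)
      rw [Complex.re_ofReal_mul, abs_mul]
      have := mul_le_mul_of_nonneg_right hr (abs_nonneg p.re)
      rw [one_mul] at this
      exact mul_le_mul_of_nonneg_right this (norm_nonneg _)
    have k1 := key (1 - s) (by rw [abs_le]; constructor <;> linarith [hs.1, hs.2])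
    have k2 := key s (by rw [abs_le]; constructor <;> linarith [hs.1, hs.2])
    rw [Complex.ofReal_sub, Complex.ofReal_one] at k1
    rw [norm_smul]
    refine mul_le_mul_of_nonneg_left ?_ (norm_nonneg _)
    calc _ ≤ ‖cexp ((1 - s) * p) h‖ * ‖X‖ * ‖cexp (s * p) h‖ :=
          (norm_mul_le _ _).trans (mul_le_mul_of_nonneg_right (norm_mul_le _ _) (norm_nonneg _))
      _ ≤ Real.exp (|p.re| * ‖h‖) * ‖X‖ * Real.exp (|p.re| * ‖h‖) := by gcongr
      _ = _ := by ring
  have := intervalIntegral.norm_integral_le_of_norm_le_const hb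
  rwa [sub_zero, abs_one, mul_one] at this

/-- Duhamel's formula for a difference of exponentials. -/
theorem exp_sub_exp (H Y : 𝓑) :
    cexp 1 (H + Y) - cexp 1 H = ∫ s in (0 : ℝ)..1, cexp (1 - s) H * Y * cexp s (H + Y) := by
  have hd : ∀ s ∈ uIcc (0 : ℝ) 1,
      HasDerivAt (fun s : ℝ => cexp (1 - s) H * cexp s (H + Y))
        (cexp (1 - s) H * Y * cexp s (H + Y)) s := by
    intro s _
    have h1 : HasDerivAt (fun s : ℝ => (1 : ℂ) - s) (-1) s := by
      exact (Complex.ofRealCLM.hasDerivAt (x := s)).const_sub 1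
    have h2 : HasDerivAt (fun s : ℝ => (s : ℂ)) 1 s := by
      exact Complex.ofRealCLM.hasDerivAt (x := s)
    refine ((hasDerivAt_cexp h1 H).mul (hasDerivAt_cexp' h2 (H + Y))).congr_deriv ?_
    rw [neg_smul, one_smul, one_smul]
    noncomm_ring
  rw [intervalIntegral.integral_eq_sub_of_hasDerivAt hd
    (Continuous.intervalIntegrable (by fun_prop) _ _)]
  simp

theorem hasDerivAt_exp_line (H X : 𝓑) :
    HasDerivAt (fun t : ℝ => NormedSpace.exp (H + t • X)) (duh H 1 X) 0 := by
  have hG : Continuous fun t : ℝ =>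
      ∫ s in (0 : ℝ)..1, cexp (1 - s) H * X * cexp s (H + t • X) := by
    refine intervalIntegral.continuous_parametric_intervalIntegral_of_continuous'
      (f := fun (t s : ℝ) => cexp (1 - s) H * X * cexp s (H + t • X)) ?_ 0 1
    simp only [Function.uncurry_def]
    fun_prop
  have hlim := hG.tendsto 0
  have h0 : (∫ s in (0 : ℝ)..1, cexp (1 - s) H * X * cexp s (H + (0 : ℝ) • X)) = duh H 1 X := by
    simp [duh]
  rw [h0] at hlim
  rw [hasDerivAt_iff_tendsto_slope]
  refine (hlim.mono_left nhdsWithin_le_nhds).congr' ?_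
  filter_upwards [self_mem_nhdsWithin] with t ht
  have ht' : t ≠ 0 := ht
  have := exp_sub_exp H (t • X)
  simp only [cexp, one_smul] at this
  rw [slope_def_module, zero_smul, add_zero, sub_zero, this, ← intervalIntegral.integral_smul]
  refine intervalIntegral.integral_congr fun s _ => ?_
  simp only [cexp, mul_smul_comm, smul_mul_assoc, smul_smul, inv_mul_cancel₀ ht', one_smul]

theorem fderiv_exp (H X : 𝓑) : fderiv ℝ (NormedSpace.exp : 𝓑 → 𝓑) H X = duh H 1 X := by
  have hf : HasFDerivAt (NormedSpace.exp : 𝓑 → 𝓑) (fderiv ℝ NormedSpace.exp H)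
      (H + (0 : ℝ) • X) := by
    rw [zero_smul, add_zero]
    exact (contDiff_exp.differentiable (by simp) H).hasFDerivAt
  have hl : HasDerivAt (fun t : ℝ => H + t • X) X 0 := by
    simpa using ((hasDerivAt_id (0 : ℝ)).smul_const X).const_add H
  exact (hf.comp_hasDerivAt (0 : ℝ) hl).unique (hasDerivAt_exp_line H X)

theorem hasDerivAt_cexp_curve {γ : ℝ → 𝓑} {γ' : 𝓑} {s : ℝ} (hγ : HasDerivAt γ γ' s) (p : ℂ) :
    HasDerivAt (fun s => cexp p (γ s)) (duh (γ s) p γ') s := by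
  rw [duh_eq_duh_one, ← fderiv_exp]
  exact ((contDiff_exp.differentiable (by simp) (p • γ s)).hasFDerivAt).comp_hasDerivAt s
    (hγ.const_smul p)

end Duhamel

/-! ### Bounded strong convergence -/

section StrongLimits

open Filter Topology

variable {E : Type*} [NormedAddCommGroup E] [InnerProductSpace ℂ E] [CompleteSpace E]
  {α : Type*} {l : Filter α}

local notation "𝓑" => E →L[ℂ] E

/-- Bounded convergence of operators in the strong operator topology. -/
structure StrongLim (l : Filter α) (X : α → 𝓑) (Y : 𝓑) : Prop where
  bounded : ∃ M, ∀ n, ‖X n‖ ≤ M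
  tendsto : ∀ v, Tendsto (fun n => X n v) l (𝓝 (Y v))

namespace StrongLim

variable {X X' : α → E →L[ℂ] E} {Y Y' : E →L[ℂ] E}

theorem const (Y : 𝓑) : StrongLim l (fun _ => Y) Y :=
  ⟨⟨‖Y‖, fun _ => le_rfl⟩, fun _ => tendsto_const_nhds⟩

theorem add (h : StrongLim l X Y) (h' : StrongLim l X' Y') :
    StrongLim l (fun n => X n + X' n) (Y + Y') := by
  obtain ⟨M, hM⟩ := h.bounded
  obtain ⟨M', hM'⟩ := h'.bounded
  exact ⟨⟨M + M', fun n => (norm_add_le _ _).trans (add_le_add (hM n) (hM' n))⟩,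
    fun v => (h.tendsto v).add (h'.tendsto v)⟩

theorem sub (h : StrongLim l X Y) (h' : StrongLim l X' Y') :
    StrongLim l (fun n => X n - X' n) (Y - Y') := by
  obtain ⟨M, hM⟩ := h.bounded
  obtain ⟨M', hM'⟩ := h'.bounded
  exact ⟨⟨M + M', fun n => (norm_sub_le _ _).trans (add_le_add (hM n) (hM' n))⟩,
    fun v => (h.tendsto v).sub (h'.tendsto v)⟩

theorem smul (c : ℂ) (h : StrongLim l X Y) : StrongLim l (fun n => c • X n) (c • Y) := by
  obtain ⟨M, hM⟩ := h.bounded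
  exact ⟨⟨‖c‖ * M, fun n => (norm_smul_le _ _).trans
    (mul_le_mul_of_nonneg_left (hM n) (norm_nonneg _))⟩, fun v => (h.tendsto v).const_smul c⟩

theorem mul (h : StrongLim l X Y) (h' : StrongLim l X' Y') :
    StrongLim l (fun n => X n * X' n) (Y * Y') := by
  obtain ⟨M, hM⟩ := h.bounded
  obtain ⟨M', hM'⟩ := h'.bounded
  refine ⟨⟨M * M', fun n => (norm_mul_le _ _).trans (mul_le_mul (hM n) (hM' n) (norm_nonneg _)
    ((norm_nonneg _).trans (hM n)))⟩, fun v => ?_⟩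
  have h1 : Tendsto (fun n => X n (X' n v - Y' v)) l (𝓝 0) := by
    refine squeeze_zero_norm (a := fun n => M * ‖X' n v - Y' v‖) (fun n => ?_) ?_
    · exact ((X n).le_opNorm _).trans (mul_le_mul_of_nonneg_right (hM n) (norm_nonneg _))
    · have := ((h'.tendsto v).sub_const (Y' v)).norm.const_mul M
      simpa using this
  have h2 := h1.add (h.tendsto (Y' v))
  rw [zero_add] at h2
  refine h2.congr fun n => ?_
  rw [← map_add, sub_add_cancel]
  rfl

theorem pow (h : StrongLim l X Y) (k : ℕ) : StrongLim l (fun n => X n ^ k) (Y ^ k) := by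
  induction k with
  | zero => simpa using StrongLim.const (1 : 𝓑)
  | succ k ih => simpa only [pow_succ] using ih.mul h

theorem unique [l.NeBot] (h : StrongLim l X Y) (h' : StrongLim l X Y') : Y = Y' :=
  ContinuousLinearMap.ext fun v => tendsto_nhds_unique (h.tendsto v) (h'.tendsto v)

/-- Dominated convergence for strong limits. -/
theorem integral [l.IsCountablyGenerated] {Ω : Type*} [MeasurableSpace Ω] {μ : Measure Ω}
    {X : α → Ω → 𝓑} {Y : Ω → 𝓑} (bound : Ω → ℝ) (hb : Integrable bound μ)
    (hX : ∀ n, AEStronglyMeasurable (X n) μ) (hXb : ∀ n, ∀ᵐ t ∂μ, ‖X n t‖ ≤ bound t)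
    (hY : AEStronglyMeasurable Y μ) (hYb : ∀ᵐ t ∂μ, ‖Y t‖ ≤ bound t)
    (hlim : ∀ t, StrongLim l (fun n => X n t) (Y t)) :
    StrongLim l (fun n => ∫ t, X n t ∂μ) (∫ t, Y t ∂μ) := by
  refine ⟨⟨∫ t, bound t ∂μ, fun n => norm_integral_le_of_norm_le hb (hXb n)⟩, fun v => ?_⟩
  have hXi : ∀ n, Integrable (X n) μ := fun n => hb.mono' (hX n) (hXb n)
  have hYi : Integrable Y μ := hb.mono' hY hYb
  rw [ContinuousLinearMap.integral_apply hYi]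
  simp only [fun n => ContinuousLinearMap.integral_apply (hXi n) v]
  refine tendsto_integral_filter_of_dominated_convergence (fun t => bound t * ‖v‖)
    (Eventually.of_forall fun n => (hX n).apply_continuousLinearMap v)
    (Eventually.of_forall fun n => ?_) (hb.mul_const _)
    (Eventually.of_forall fun t => (hlim t).tendsto v)
  filter_upwards [hXb n] with t ht
  exact ((X n t).le_opNorm v).trans (mul_le_mul_of_nonneg_right ht (norm_nonneg _))

theorem norm_cexp_le_of_norm_le {h : 𝓑} {M : ℝ} (hM : ‖h‖ ≤ M) (z : ℂ) :
    ‖cexp z h‖ ≤ Real.exp (‖z‖ * M) := by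
  rcases subsingleton_or_nontrivial E with hE | hE
  · rw [Subsingleton.elim (WeylVariation.cexp z h) 0, norm_zero]
    exact (Real.exp_pos _).le
  refine (norm_exp_le _).trans (Real.exp_le_exp.2 ?_)
  rw [norm_smul]
  exact mul_le_mul_of_nonneg_left hM (norm_nonneg _)

theorem cexp (h : StrongLim l X Y) (z : ℂ) :
    StrongLim l (fun n => cexp z (X n)) (cexp z Y) := by
  obtain ⟨M, hM⟩ := h.bounded
  refine ⟨⟨_, fun n => norm_cexp_le_of_norm_le (hM n) z⟩, fun v => ?_⟩
  have hs : ∀ H : 𝓑, WeylVariation.cexp z H v =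
      ∑' k : ℕ, ((k.factorial : ℂ)⁻¹ * z ^ k) • (H ^ k) v := fun H =>
    (((ContinuousLinearMap.apply ℂ E v).hasSum (hasSum_cexp z H)).tsum_eq).symm
  simp only [hs]
  refine tendsto_tsum_of_dominated_convergence
    (bound := fun k : ℕ => (k.factorial : ℝ)⁻¹ * (‖z‖ * M) ^ k * ‖v‖) ?_ (fun k => ?_)
    (Eventually.of_forall fun n k => ?_)
  · have := (NormedSpace.exp_series_hasSum_exp' (𝕂 := ℝ) (‖z‖ * M)).summable
    exact this.mul_right _
  · exact ((h.pow k).tendsto v).const_smul _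
  · have hk : ‖(X n ^ k) v‖ ≤ M ^ k * ‖v‖ := by
      refine ((X n ^ k).le_opNorm v).trans (mul_le_mul_of_nonneg_right ?_ (norm_nonneg _))
      rcases k.eq_zero_or_pos with rfl | hk
      · rw [pow_zero, pow_zero]
        exact ContinuousLinearMap.norm_id_le
      · exact (norm_pow_le' _ hk).trans (pow_le_pow_left₀ (norm_nonneg _) (hM n) k)
    rw [norm_smul, norm_mul, norm_inv, Complex.norm_natCast, norm_pow, mul_pow]
    calc _ ≤ (k.factorial : ℝ)⁻¹ * ‖z‖ ^ k * (M ^ k * ‖v‖) :=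
          mul_le_mul_of_nonneg_left hk (by positivity)
      _ = _ := by ring

theorem duh [l.IsCountablyGenerated] [l.NeBot] {H : α → 𝓑} {h : 𝓑} (hH : StrongLim l H h) (p : ℂ)
    (hX : StrongLim l X Y) : StrongLim l (fun n => duh (H n) p (X n)) (duh h p Y) := by
  obtain ⟨M, hM⟩ := hH.bounded
  obtain ⟨M', hM'⟩ := hX.bounded
  -- the bounds pass to the limits once `M`, `M'` are enlarged
  obtain ⟨L, hL⟩ : ∃ L : ℝ, L = max M ‖h‖ := ⟨_, rfl⟩
  obtain ⟨L', hL'⟩ : ∃ L' : ℝ, L' = max M' ‖Y‖ := ⟨_, rfl⟩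
  have hb : ∀ (K Z : 𝓑), ‖K‖ ≤ L → ‖Z‖ ≤ L' →
      ∀ᵐ s : ℝ ∂(volume.restrict (Ioc 0 1)),
        ‖p • (WeylVariation.cexp ((1 - s) * p) K * Z * WeylVariation.cexp (s * p) K)‖ ≤
          ‖p‖ * (Real.exp (‖p‖ * L) * L' * Real.exp (‖p‖ * L)) := by
    intro K Z hK hZ
    filter_upwards [ae_restrict_mem measurableSet_Ioc] with s hs
    have hL0 : 0 ≤ L := (norm_nonneg _).trans hK
    have key : ∀ r : ℂ, ‖r‖ ≤ 1 → ‖WeylVariation.cexp (r * p) K‖ ≤ Real.exp (‖p‖ * L) := by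
      intro r hr
      refine (norm_cexp_le_of_norm_le hK _).trans (Real.exp_le_exp.2 ?_)
      rw [norm_mul]
      refine mul_le_mul_of_nonneg_right ?_ hL0
      simpa using mul_le_mul_of_nonneg_right hr (norm_nonneg p)
    have k1 := key (1 - s) (by
      rw [← Complex.ofReal_one, ← Complex.ofReal_sub, Complex.norm_real, Real.norm_eq_abs, abs_le]
      constructor <;> linarith [hs.1, hs.2])
    have k2 := key s (by
      rw [Complex.norm_real, Real.norm_eq_abs, abs_le]
      constructor <;> linarith [hs.1, hs.2])
    rw [norm_smul]
    refine mul_le_mul_of_nonneg_left ?_ (norm_nonneg _)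
    refine (norm_mul_le _ _).trans (mul_le_mul ((norm_mul_le _ _).trans
      (mul_le_mul k1 hZ (norm_nonneg _) (Real.exp_pos _).le)) k2 (norm_nonneg _) ?_)
    exact mul_nonneg (Real.exp_pos _).le ((norm_nonneg _).trans hZ)
  simp only [WeylVariation.duh, intervalIntegral.integral_of_le (zero_le_one (α := ℝ))]
  refine StrongLim.integral (μ := volume.restrict (Ioc (0 : ℝ) 1))
    (X := fun n (s : ℝ) => p • (WeylVariation.cexp ((1 - s) * p) (H n) * X n *
      WeylVariation.cexp (s * p) (H n)))
    (fun _ => ‖p‖ * (Real.exp (‖p‖ * L) * L' * Real.exp (‖p‖ * L))) (integrable_const _)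
    (fun n => ?_) (fun n => hb _ _ ((hM n).trans (hL ▸ le_max_left _ _))
      ((hM' n).trans (hL' ▸ le_max_left _ _))) ?_
    (hb _ _ (hL ▸ le_max_right _ _) (hL' ▸ le_max_right _ _)) (fun s => ?_)
  · exact Continuous.aestronglyMeasurable (by fun_prop)
  · exact Continuous.aestronglyMeasurable (by fun_prop)
  · exact (((hH.cexp _).mul hX).mul (hH.cexp _)).smul p

end StrongLim

end StrongLimits

/-! ### Approximation by operators with finitely many eigenvalues -/

section FiniteApproximation

open Filter Topology

variable {E : Type*} [NormedAddCommGroup E] [InnerProductSpace ℂ E] [CompleteSpace E]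

local notation "𝓑" => E →L[ℂ] E

/-- A finite resolution of the identity `1 = ∑ Pᵢ` by (left and right) eigenoperators of `h`, with
real eigenvalues in `[-R, R]`. -/
structure SpectralResolution (h : 𝓑) (R : ℝ) where
  ι : Type
  [fintype : Fintype ι]
  P : ι → 𝓑
  x : ι → ℝ
  sum_eq_one : ∑ i, P i = 1
  abs_le : ∀ i, |x i| ≤ R
  mul_eq : ∀ i, h * P i = (x i : ℂ) • P i
  eq_mul : ∀ i, P i * h = (x i : ℂ) • P i

attribute [instance] SpectralResolution.fintype

/-- The compression of a self-adjoint operator to a finite-dimensional subspace is diagonal in an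
orthonormal basis of eigenvectors. -/
theorem exists_resolution_compression {h : 𝓑} (hh : IsSelfAdjoint h) (U : Submodule ℂ E)
    [FiniteDimensional ℂ U] :
    Nonempty (SpectralResolution (U.starProjection * h * U.starProjection) ‖h‖) := by
  set Q : 𝓑 := U.starProjection with hQ
  have hQs : ∀ v w, inner ℂ (Q v) w = inner ℂ v (Q w) := fun v w =>
    U.inner_starProjection_left_eq_right v w
  have hhs : ∀ v w, inner ℂ (h v) w = inner ℂ v (h w) := by
    have := ContinuousLinearMap.isSelfAdjoint_iff_isSymmetric.1 hh
    exact fun v w => this v w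
  have hQU : ∀ u : U, Q u = u := fun u => U.starProjection_eq_self_iff.2 u.2
  let T : U →ₗ[ℂ] U := (U.orthogonalProjectionOnto ∘L h ∘L U.subtypeL).toLinearMap
  have hT : ∀ u : U, ((T u : U) : E) = Q (h u) := fun u => rfl
  have hTs : T.IsSymmetric := by
    intro u v
    rw [Submodule.coe_inner, Submodule.coe_inner, hT, hT, hQs, hQU, hhs, ← hQs, hQU]
  let b := hTs.eigenvectorBasis rfl
  let ev := hTs.eigenvalues rfl
  have hTb : ∀ i, Q (h (b i : U)) = (ev i : ℂ) • ((b i : U) : E) := by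
    intro i
    rw [← hT, hTs.apply_eigenvectorBasis]
    rfl
  have hb1 : ∀ i, ‖((b i : U) : E)‖ = 1 := fun i => b.orthonormal.1 i
  let B : Fin (Module.finrank ℂ U) → 𝓑 := fun i =>
    (innerSL ℂ ((b i : U) : E)).smulRight ((b i : U) : E)
  have hB : ∀ i v, B i v = inner ℂ ((b i : U) : E) v • ((b i : U) : E) := fun i v => rfl
  have hsum : ∀ v, (∑ i, B i) v = Q v := by
    intro v
    have h1 := congrArg (Subtype.val) (b.sum_repr' (U.orthogonalProjectionOnto v))
    rw [Submodule.coe_sum] at h1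
    rw [sum_apply]
    refine Eq.trans (Finset.sum_congr rfl fun i _ => ?_) h1
    rw [hB, Submodule.coe_smul, Submodule.coe_inner]
    congr 1
    change _ = inner ℂ ((b i : U) : E) (Q v)
    rw [← hQs, hQU]
  refine ⟨⟨Option (Fin (Module.finrank ℂ U)), fun o => o.elim (1 - ∑ i, B i) B,
    fun o => o.elim 0 ev, ?_, ?_, ?_, ?_⟩⟩
  · rw [Fintype.sum_option]
    exact sub_add_cancel _ _
  · rintro (_ | i)
    · simp
    · have h1 : |ev i| = ‖(ev i : ℂ) • ((b i : U) : E)‖ := by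
        rw [norm_smul, hb1, mul_one, Complex.norm_real, Real.norm_eq_abs]
      change |ev i| ≤ _
      rw [h1, ← hTb]
      refine (U.norm_starProjection_apply_le _).trans ((h.le_opNorm _).trans ?_)
      rw [hb1, mul_one]
  · rintro (_ | i)
    · ext v
      change Q (h (Q (v - (∑ i, B i) v))) = ((0 : ℝ) : ℂ) • _
      have : Q (Q v) = Q v := hQU (U.orthogonalProjectionOnto v)
      rw [hsum, map_sub, this, sub_self, map_zero, map_zero, Complex.ofReal_zero, zero_smul]
    · ext v
      change Q (h (Q (B i v))) = (ev i : ℂ) • B i v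
      rw [hB, map_smul, map_smul, map_smul, hQU, hTb, smul_comm]
  · rintro (_ | i)
    · ext v
      change Q (h (Q v)) - (∑ i, B i) (Q (h (Q v))) = ((0 : ℝ) : ℂ) • _
      have : Q (Q (h (Q v))) = Q (h (Q v)) := hQU (U.orthogonalProjectionOnto _)
      rw [hsum, this, sub_self, Complex.ofReal_zero, zero_smul]
    · ext v
      change B i (Q (h (Q v))) = (ev i : ℂ) • B i v
      rw [hB, hB, ← hQs, ← hhs, ← hQs, hQU, hTb, inner_smul_left, Complex.conj_ofReal, mul_smul]

/-- A self-adjoint operator on a separable Hilbert space is the strong limit of self-adjoint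
operators of no larger norm which are diagonal with finitely many eigenvalues. -/
theorem exists_strongLim_resolution [TopologicalSpace.SeparableSpace E] {h : 𝓑}
    (hh : IsSelfAdjoint h) :
    ∃ H : ℕ → 𝓑, StrongLim atTop H h ∧ ∀ n, IsSelfAdjoint (H n) ∧ ‖H n‖ ≤ ‖h‖ ∧
      Nonempty (SpectralResolution (H n) ‖h‖) := by
  let S : ℕ → Set E := fun n => TopologicalSpace.denseSeq E '' Iio n
  let U : ℕ → Submodule ℂ E := fun n => Submodule.span ℂ (S n)
  have hfin : ∀ n, FiniteDimensional ℂ (U n) := fun n =>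
    FiniteDimensional.span_of_finite ℂ ((finite_Iio n).image _)
  have hmono : Monotone U := fun m n hmn =>
    Submodule.span_mono (image_mono (Iio_subset_Iio hmn))
  have hdense : ⊤ ≤ (⨆ n, U n).topologicalClosure := by
    intro v _
    have hv : v ∈ closure (range (TopologicalSpace.denseSeq E)) :=
      TopologicalSpace.denseRange_denseSeq E v
    refine closure_mono ?_ hv
    rintro _ ⟨n, rfl⟩
    exact Submodule.mem_iSup_of_mem (n + 1)
      (Submodule.subset_span ⟨n, Nat.lt_succ_self n, rfl⟩)
  have hnorm : ∀ n, ‖(U n).starProjection‖ ≤ 1 := fun n => (U n).starProjection_norm_le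
  have hP : StrongLim atTop (fun n => (U n).starProjection) (1 : 𝓑) :=
    ⟨⟨1, hnorm⟩, fun v => Submodule.starProjection_tendsto_self U hmono v hdense⟩
  refine ⟨fun n => (U n).starProjection * h * (U n).starProjection, ?_, fun n => ⟨?_, ?_,
    exists_resolution_compression hh (U n)⟩⟩
  · simpa using (hP.mul (StrongLim.const h)).mul hP
  · have hs : IsSelfAdjoint (U n).starProjection := isSelfAdjoint_starProjection (U n)
    rw [IsSelfAdjoint, star_mul, star_mul, hs.star_eq, hh.star_eq]
    exact (mul_assoc _ _ _).symm
  · calc _ ≤ ‖(U n).starProjection‖ * ‖h‖ * ‖(U n).starProjection‖ :=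
          (norm_mul_le _ _).trans (mul_le_mul_of_nonneg_right (norm_mul_le _ _) (norm_nonneg _))
      _ ≤ 1 * ‖h‖ * 1 := by gcongr <;> exact hnorm n
      _ = ‖h‖ := by ring

end FiniteApproximation

/-! ### Smooth functions as Fourier transforms -/

section FourierRepresentation

open scoped FourierTransform SchwartzMap

/-- On any ball a smooth function is the Fourier transform of a Schwartz function. -/
theorem exists_schwartz_rep {V : Type*} [NormedAddCommGroup V] [InnerProductSpace ℝ V]
    [FiniteDimensional ℝ V] [MeasurableSpace V] [BorelSpace V] {f : V → ℂ} (hf : ContDiff ℝ ∞ f)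
    (R : ℝ) :
    ∃ g : 𝓢(V, ℂ), ∀ v, ‖v‖ ≤ R →
      f v = ∫ w, g w * Complex.exp (-(Complex.I * (inner ℝ w v : ℝ))) := by
  have hpi : (0 : ℝ) < 2 * Real.pi := by positivity
  let χ : ContDiffBump (0 : V) :=
    { rIn := |R| + 1, rOut := |R| + 2, rIn_pos := by positivity, rIn_lt_rOut := by linarith }
  let F : V → ℂ := fun v => ((χ v : ℝ) : ℂ) * f ((2 * Real.pi) • v)
  have hFs : ContDiff ℝ ∞ F :=
    (Complex.ofRealCLM.contDiff.comp χ.contDiff).mul (hf.comp (contDiff_const_smul _))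
  have hFc : HasCompactSupport F := by
    refine HasCompactSupport.mul_right ?_
    exact χ.hasCompactSupport.comp_left (g := fun r : ℝ => (r : ℂ)) (by simp)
  let Φ : 𝓢(V, ℂ) := hFc.toSchwartzMap hFs
  refine ⟨𝓕⁻ Φ, fun v hv => ?_⟩
  have h1 : (𝓕 (𝓕⁻ Φ) : 𝓢(V, ℂ)) ((2 * Real.pi)⁻¹ • v) = f v := by
    rw [FourierTransform.fourier_fourierInv_eq]
    change ((χ ((2 * Real.pi)⁻¹ • v) : ℝ) : ℂ) * f ((2 * Real.pi) • ((2 * Real.pi)⁻¹ • v)) = f v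
    rw [χ.one_of_mem_closedBall, smul_smul, mul_inv_cancel₀ hpi.ne', one_smul, Complex.ofReal_one,
      one_mul]
    rw [mem_closedBall_zero_iff, norm_smul, Real.norm_eq_abs, abs_inv, abs_of_pos hpi]
    have h2 : (2 * Real.pi)⁻¹ ≤ 1 := inv_le_one_of_one_le₀ (by linarith [Real.pi_gt_three])
    calc (2 * Real.pi)⁻¹ * ‖v‖ ≤ 1 * ‖v‖ := mul_le_mul_of_nonneg_right h2 (norm_nonneg _)
      _ ≤ |R| + 1 := by linarith [le_abs_self R]
  rw [← h1, SchwartzMap.fourier_coe, Real.fourier_eq']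
  refine integral_congr_ae (Filter.Eventually.of_forall fun w => ?_)
  simp only [smul_eq_mul, inner_smul_right]
  rw [mul_comm]
  congr 2
  push_cast
  field_simp

theorem exists_schwartz_rep_real {f : ℝ → ℂ} (hf : ContDiff ℝ ∞ f) (R : ℝ) :
    ∃ β : 𝓢(ℝ, ℂ), ∀ x : ℝ, |x| ≤ R →
      f x = ∫ ξ : ℝ, β ξ * Complex.exp (-(Complex.I * (x * ξ))) := by
  obtain ⟨g, hg⟩ := exists_schwartz_rep hf R
  refine ⟨g, fun x hx => ?_⟩
  rw [hg x hx]
  simp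

theorem exists_integrable_rep_prod {f : ℝ × ℝ → ℂ} (hf : ContDiff ℝ ∞ f) (R : ℝ) :
    ∃ β : ℝ × ℝ → ℂ, Integrable β ∧ ∀ x₁ x₂ : ℝ, |x₁| ≤ R → |x₂| ≤ R →
      f (x₁, x₂) = ∫ ξ : ℝ × ℝ, β ξ * Complex.exp (-(Complex.I * (x₁ * ξ.1 + x₂ * ξ.2))) := by
  have hf' : ContDiff ℝ ∞ fun v : WithLp 2 (ℝ × ℝ) => f (WithLp.ofLp v) :=
    hf.comp (WithLp.prodContinuousLinearEquiv 2 ℝ ℝ ℝ).contDiff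
  obtain ⟨g, hg⟩ := exists_schwartz_rep hf' (|R| + |R|)
  have hm := WithLp.volume_preserving_toLp ℝ ℝ
  have hme : MeasurableEmbedding (WithLp.toLp 2 : ℝ × ℝ → WithLp 2 (ℝ × ℝ)) :=
    (MeasurableEquiv.toLp 2 (ℝ × ℝ)).measurableEmbedding
  refine ⟨fun ξ => g (WithLp.toLp 2 ξ), ?_, fun x₁ x₂ h₁ h₂ => ?_⟩
  · exact (hm.integrable_comp_emb hme).2 g.integrable
  · have hn : ‖(WithLp.toLp 2 (x₁, x₂) : WithLp 2 (ℝ × ℝ))‖ ≤ |R| + |R| := by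
      have h0 : (WithLp.toLp 2 (x₁, x₂) : WithLp 2 (ℝ × ℝ)) =
        WithLp.toLp 2 (x₁, 0) + WithLp.toLp 2 (0, x₂) := by
        rw [← WithLp.toLp_add]; simp
      rw [h0]
      refine (norm_add_le _ _).trans (add_le_add ?_ ?_)
      · rw [WithLp.norm_toLp_fst]
        exact h₁.trans (le_abs_self R)
      · rw [WithLp.norm_toLp_snd]
        exact h₂.trans (le_abs_self R)
    have h1 := hg _ hn
    rw [← hm.integral_comp hme] at h1
    refine h1.trans (integral_congr_ae (Filter.Eventually.of_forall fun ξ => ?_))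
    simp [WithLp.prod_inner_apply]

end FourierRepresentation

/-! ### Smoothness of divided differences -/

section DividedDifferences

open Filter Topology

/-- Differentiation under the integral over a compact interval, by induction on the order. The
spaces live in one universe because the induction replaces `F` by `H →L[ℝ] F`. -/
theorem contDiff_integral_unitInterval_nat (n : ℕ) {H F : Type} [NormedAddCommGroup H]
    [NormedSpace ℝ H] [ProperSpace H] [NormedAddCommGroup F] [NormedSpace ℝ F] [CompleteSpace F]
    {f : H × ℝ → F} (hf : ContDiff ℝ ∞ f) :
    ContDiff ℝ n fun x => ∫ t in (0 : ℝ)..1, f (x, t) := by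
  induction n generalizing F with
  | zero =>
    rw [Nat.cast_zero, contDiff_zero]
    exact intervalIntegral.continuous_parametric_intervalIntegral_of_continuous'
      (f := fun x t => f (x, t)) hf.continuous 0 1
  | succ n ih =>
    let f' : H × ℝ → H →L[ℝ] F := fun p => (fderiv ℝ f p).comp (ContinuousLinearMap.inl ℝ H ℝ)
    have hf' : ContDiff ℝ ∞ f' :=
      (hf.fderiv_right (m := ∞) (by simp)).clm_comp contDiff_const
    have hd : ∀ x t, HasFDerivAt (fun x => f (x, t)) (f' (x, t)) x := fun x t =>
      ((hf.differentiable (by simp) (x, t)).hasFDerivAt).comp x (hasFDerivAt_prodMk_left x t)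
    rw [Nat.cast_succ, contDiff_succ_iff_hasFDerivAt]
    refine ⟨fun x => ∫ t in (0 : ℝ)..1, f' (x, t), ih hf', fun x => ?_⟩
    obtain ⟨C, hC⟩ := ((isCompact_closedBall x 1).prod (isCompact_Icc (a := (0 : ℝ)) (b := 1))
      ).exists_bound_of_continuousOn hf'.continuous.continuousOn
    refine intervalIntegral.hasFDerivAt_integral_of_dominated_of_fderiv_le (𝕜 := ℝ)
      (F := fun x t => f (x, t)) (F' := fun x t => f' (x, t)) (bound := fun _ => C)
      (Metric.ball_mem_nhds x one_pos) ?_ ?_ ?_ ?_ ?_ ?_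
    · refine Eventually.of_forall fun y => Continuous.aestronglyMeasurable ?_
      exact hf.continuous.comp (by fun_prop)
    · exact Continuous.intervalIntegrable (hf.continuous.comp (by fun_prop)) _ _
    · exact Continuous.aestronglyMeasurable (hf'.continuous.comp (by fun_prop))
    · refine Eventually.of_forall fun t ht y hy => hC (y, t) ⟨Metric.ball_subset_closedBall hy, ?_⟩
      rw [uIoc_of_le zero_le_one] at ht
      exact ⟨ht.1.le, ht.2⟩
    · exact intervalIntegrable_const
    · exact Eventually.of_forall fun t _ y _ => hd y t

/-- Hadamard's lemma: the divided difference of a smooth function is smooth in both variables. -/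
theorem contDiff_dslope {F : Type} [NormedAddCommGroup F] [NormedSpace ℝ F] [CompleteSpace F]
    {f : ℝ → F} (hf : ContDiff ℝ ∞ f) : ContDiff ℝ ∞ fun p : ℝ × ℝ => dslope f p.1 p.2 := by
  have hf' : ContDiff ℝ ∞ (deriv f) := (contDiff_infty_iff_deriv.1 hf).2
  have hrep : (fun p : ℝ × ℝ => dslope f p.1 p.2) = fun p : ℝ × ℝ =>
      ∫ t in (0 : ℝ)..1, deriv f (p.1 + t * (p.2 - p.1)) := by
    funext ⟨u, v⟩
    rcases eq_or_ne v u with rfl | hne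
    · simp
    · have hd : ∀ t ∈ uIcc (0 : ℝ) 1, HasDerivAt (fun t : ℝ => f (u + t * (v - u)))
          ((v - u) • deriv f (u + t * (v - u))) t := by
        intro t _
        have h1 : HasDerivAt (fun t : ℝ => u + t * (v - u)) (v - u) t := by
          simpa using ((hasDerivAt_id t).mul_const (v - u)).const_add u
        exact ((hf.differentiable (by simp) _).hasDerivAt).scomp t h1
      have h2 := intervalIntegral.integral_eq_sub_of_hasDerivAt hd (Continuous.intervalIntegrable
        ((hf'.continuous.comp (by fun_prop)).const_smul _) _ _)
      rw [intervalIntegral.integral_smul] at h2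
      simp only [one_mul, zero_mul, add_zero, add_sub_cancel] at h2
      rw [dslope_of_ne _ hne, slope_def_module, ← h2, smul_smul,
        inv_mul_cancel₀ (sub_ne_zero.2 hne), one_smul]
  rw [hrep, contDiff_infty]
  intro n
  exact contDiff_integral_unitInterval_nat n
    (f := fun q : (ℝ × ℝ) × ℝ => deriv f (q.1.1 + q.2 * (q.1.2 - q.1.1)))
    (hf'.comp (by fun_prop))

end DividedDifferences

/-! ### The spectral functions in logarithmic coordinates -/

section SpectralFunctions

open NCTorus

theorem dslope_exp_pos (u v : ℝ) : 0 < dslope Real.exp u v := by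
  rcases eq_or_ne v u with rfl | hne
  · simpa using Real.exp_pos v
  · rw [dslope_of_ne _ hne, slope_def_field]
    rcases hne.lt_or_gt with h | h
    · exact div_pos_of_neg_of_neg (sub_neg.2 (Real.exp_lt_exp.2 h)) (sub_neg.2 h)
    · exact div_pos (sub_pos.2 (Real.exp_lt_exp.2 h)) (sub_pos.2 h)

/-- The divided difference of `f` at `(e^u, e^v)`, in logarithmic coordinates. -/
theorem dslope_exp_exp {F : Type*} [NormedAddCommGroup F] [NormedSpace ℝ F] {f : ℝ → F} {u : ℝ}
    (hf : DifferentiableAt ℝ f (Real.exp u)) (v : ℝ) :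
    dslope f (Real.exp u) (Real.exp v) =
      (dslope Real.exp u v)⁻¹ • dslope (fun x => f (Real.exp x)) u v := by
  rcases eq_or_ne v u with rfl | hne
  · have h1 : HasDerivAt (fun x => f (Real.exp x)) (Real.exp v • deriv f (Real.exp v)) v :=
      hf.hasDerivAt.scomp v (Real.hasDerivAt_exp v)
    rw [dslope_same, dslope_same, dslope_same, h1.deriv, Real.deriv_exp, smul_smul,
      inv_mul_cancel₀ (Real.exp_pos v).ne', one_smul]
  · have hne' : Real.exp v ≠ Real.exp u := fun h => hne (Real.exp_injective h)
    have h1 : v - u ≠ 0 := sub_ne_zero.2 hne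
    have h2 : Real.exp v - Real.exp u ≠ 0 := sub_ne_zero.2 hne'
    have h3 : (Real.exp v - Real.exp u)⁻¹ =
        ((Real.exp v - Real.exp u) / (v - u))⁻¹ * (v - u)⁻¹ := by field_simp
    rw [dslope_of_ne _ hne', dslope_of_ne _ hne, dslope_of_ne _ hne, slope_def_field,
      slope_def_module, slope_def_module, smul_smul, h3]

theorem contDiff_dslope_exp {F : Type} [NormedAddCommGroup F] [NormedSpace ℝ F] [CompleteSpace F]
    {f : ℝ → F} (hf : ContDiffOn ℝ ∞ f (Ioi 0)) {X : Type*} [NormedAddCommGroup X]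
    [NormedSpace ℝ X] {u v : X → ℝ} (hu : ContDiff ℝ ∞ u) (hv : ContDiff ℝ ∞ v) :
    ContDiff ℝ ∞ fun x => dslope f (Real.exp (u x)) (Real.exp (v x)) := by
  have hd : ∀ t, 0 < t → DifferentiableAt ℝ f t := fun t ht =>
    (hf.contDiffAt (Ioi_mem_nhds ht)).differentiableAt (by simp)
  have hfe : ContDiff ℝ ∞ fun x => f (Real.exp x) :=
    contDiff_iff_contDiffAt.2 fun x =>
      (hf.contDiffAt (Ioi_mem_nhds (Real.exp_pos x))).comp x Real.contDiff_exp.contDiffAt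
  have h1 : ContDiff ℝ ∞ fun x => dslope Real.exp (u x) (v x) :=
    (contDiff_dslope Real.contDiff_exp).comp (hu.prodMk hv)
  have h2 : ContDiff ℝ ∞ fun x => dslope (fun t => f (Real.exp t)) (u x) (v x) :=
    (contDiff_dslope hfe).comp (hu.prodMk hv)
  simp only [fun x => dslope_exp_exp (hd _ (Real.exp_pos (u x))) (v x)]
  exact (h1.inv fun x => (dslope_exp_pos _ _).ne').smul h2

variable {T : ℝ → ℂ}

theorem contDiff_comp_exp (hT : ContDiffOn ℝ ∞ T (Ioi 0)) {X : Type*} [NormedAddCommGroup X]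
    [NormedSpace ℝ X] {u : X → ℝ} (hu : ContDiff ℝ ∞ u) :
    ContDiff ℝ ∞ fun x => T (Real.exp (u x)) :=
  contDiff_iff_contDiffAt.2 fun x =>
    (hT.contDiffAt (Ioi_mem_nhds (Real.exp_pos (u x)))).comp x hu.exp.contDiffAt

theorem contDiffOn_rpow (j : ℝ) : ContDiffOn ℝ ∞ (fun t : ℝ => t ^ j) (Ioi 0) :=
  fun _ ht => (Real.contDiffAt_rpow_const_of_ne (ne_of_gt ht)).contDiffWithinAt

theorem contDiff_rpow_exp (j : ℝ) {X : Type*} [NormedAddCommGroup X]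
    [NormedSpace ℝ X] {u : X → ℝ} (hu : ContDiff ℝ ∞ u) :
    ContDiff ℝ ∞ fun x => ((Real.exp (u x) ^ j : ℝ) : ℂ) := by
  simp only [← Real.exp_mul]
  exact Complex.ofRealCLM.contDiff.comp (hu.mul contDiff_const).exp

theorem contDiffOn_opInv (hT : ContDiffOn ℝ ∞ T (Ioi 0)) (j : ℝ) :
    ContDiffOn ℝ ∞ (opInv T j) (Ioi 0) := by
  refine (Complex.ofRealCLM.contDiff.comp_contDiffOn (contDiffOn_rpow j)).mul ?_
  exact hT.comp (contDiffOn_id.inv fun t ht => ne_of_gt ht) fun t ht => mem_Ioi.2 (inv_pos.2 ht)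

theorem contDiff_opD_exp (hT : ContDiffOn ℝ ∞ T (Ioi 0)) {X : Type*} [NormedAddCommGroup X]
    [NormedSpace ℝ X] {u v : X → ℝ} (hu : ContDiff ℝ ∞ u) (hv : ContDiff ℝ ∞ v) :
    ContDiff ℝ ∞ fun x => opD T (Real.exp (u x)) (Real.exp (v x)) := by
  simp only [opD, ← Real.exp_add]
  exact (Complex.ofRealCLM.contDiff.comp hu.exp).mul (contDiff_dslope_exp hT (hu.add hv) hu)

theorem contDiff_powDiff_exp (j : ℝ) {X : Type*} [NormedAddCommGroup X]
    [NormedSpace ℝ X] {u : X → ℝ} (hu : ContDiff ℝ ∞ u) :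
    ContDiff ℝ ∞ fun x => powDiff j 1 (Real.exp (u x)) := by
  simp only [powDiff, ← Real.exp_zero]
  exact Complex.ofRealCLM.contDiff.comp
    (contDiff_dslope_exp (contDiffOn_rpow j) contDiff_const hu)

theorem contDiff_opI_exp (hT : ContDiffOn ℝ ∞ T (Ioi 0)) (j : ℝ) :
    ContDiff ℝ ∞ fun x => opI T j (Real.exp x) :=
  (contDiff_comp_exp hT contDiff_id).neg.add (contDiff_comp_exp (contDiffOn_opInv hT j)
    contDiff_id).neg

theorem contDiff_opII3_exp (hT : ContDiffOn ℝ ∞ T (Ioi 0)) (j : ℝ) :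
    ContDiff ℝ ∞ fun x : ℝ × ℝ => opII3 T j (Real.exp x.1) (Real.exp x.2) := by
  simp only [opII3, ← Real.exp_neg]
  exact (((Complex.ofRealCLM.contDiff.comp (contDiff_fst.neg.exp)).neg.mul
    (contDiff_opD_exp hT contDiff_fst contDiff_snd)).add
    (contDiff_opD_exp hT contDiff_snd contDiff_fst)).sub
    ((contDiff_powDiff_exp j contDiff_fst).mul (contDiff_comp_exp hT contDiff_snd))

theorem contDiff_opII_exp (hT : ContDiffOn ℝ ∞ T (Ioi 0)) (j : ℝ) :
    ContDiff ℝ ∞ fun x : ℝ × ℝ => opII T j (Real.exp x.1) (Real.exp x.2) := by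
  have hs : ContDiff ℝ ∞ fun x : ℝ × ℝ => -x.1 + -x.2 := contDiff_fst.neg.add contDiff_snd.neg
  have h1 : ContDiff ℝ ∞ fun x : ℝ × ℝ => opII1 T j (Real.exp x.1) (Real.exp x.2) := by
    simp only [opII1, ← Real.exp_neg, ← Real.exp_add]
    exact ((contDiff_powDiff_exp j hs).mul
      (contDiff_rpow_exp (j - 1) (contDiff_fst.add contDiff_snd))).mul
      (contDiff_comp_exp hT contDiff_fst)
  have h2 : ContDiff ℝ ∞ fun x : ℝ × ℝ => opII2 T j (Real.exp x.1) (Real.exp x.2) := by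
    simp only [opII2, ← Real.exp_neg, ← Real.exp_add, Complex.ofReal_mul]
    exact (((Complex.ofRealCLM.contDiff.comp (contDiff_snd.neg.exp)).mul
      (contDiff_rpow_exp (j - 1) contDiff_fst)).mul (contDiff_opD_exp hT contDiff_snd hs)).sub
      ((contDiff_rpow_exp (j - 1) (contDiff_fst.add contDiff_snd)).mul
      (contDiff_opD_exp hT contDiff_fst hs))
  exact ((h1.add h2).add (contDiff_opII3_exp hT j)).add
    (contDiff_opII3_exp (contDiffOn_opInv hT j) j)

theorem opD_of_ne (T : ℝ → ℂ) {a b : ℝ} (ha : a ≠ 0) (hb : b ≠ 1) :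
    opD T a b = (T (a * b) - T a) / (b - 1) := by
  have h1 : a ≠ a * b := fun h => hb (by simpa [ha] using h.symm)
  have ha' : (a : ℂ) ≠ 0 := by exact_mod_cast ha
  have hb' : (b : ℂ) - 1 ≠ 0 := sub_ne_zero.2 (by exact_mod_cast hb)
  have hc : (1 : ℂ) - b ≠ 0 := sub_ne_zero.2 (by exact_mod_cast hb.symm)
  rw [opD, dslope_of_ne _ h1, slope_def_module, Complex.real_smul]
  push_cast
  rw [show (a : ℂ) - a * b = a * (1 - b) by ring]
  field_simp
  ring

theorem powDiff_of_ne (j : ℝ) {y : ℝ} (hy : y ≠ 1) :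
    powDiff j 1 y = (((y ^ j : ℝ) : ℂ) - 1) / (y - 1) := by
  rw [powDiff, dslope_of_ne _ hy, slope_def_field, Real.one_rpow]
  push_cast
  rfl

/-- The two-variable spectral function at `(t₁/t₀, t₂/t₁)`, homogenized: with
`M(a, b) = a^j T(b/a)` it is a combination of the six values `M(tᵢ, tₖ)`. -/
theorem opII_homogeneous {t₀ t₁ t₂ : ℝ} (h₀ : 0 < t₀) (h₁ : 0 < t₁) (h₂ : 0 < t₂)
    (h₀₁ : t₀ ≠ t₁) (h₁₂ : t₁ ≠ t₂) (h₀₂ : t₀ ≠ t₂) (j : ℝ) (M : ℝ → ℝ → ℂ)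
    (hM : ∀ a b, M a b = ((a ^ j : ℝ) : ℂ) * T (b / a)) :
    ((t₀ - t₁) * (t₁ - t₂) * (t₀ - t₂) : ℂ) *
        (((t₀ ^ (j - 1) : ℝ) : ℂ) * opII T j (t₁ / t₀) (t₂ / t₁)) =
      (t₀ - t₁) * (t₁ - t₂) * (M t₀ t₁ - M t₂ t₁ + (M t₁ t₀ - M t₁ t₂)) -
      (t₀ - t₂) * (t₀ - t₁) * (M t₁ t₀ - M t₂ t₀ + (M t₀ t₁ - M t₀ t₂)) -
      (t₀ - t₂) * (t₁ - t₂) * (M t₀ t₂ - M t₁ t₂ + (M t₂ t₀ - M t₂ t₁)) := by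
  have ne1 : ∀ {a b : ℝ}, 0 < a → a ≠ b → b / a ≠ 1 := fun ha hab h =>
    hab ((div_eq_one_iff_eq ha.ne').1 h).symm
  have e1 : t₀ / t₁ * (t₁ / t₂) = t₀ / t₂ := by field_simp
  have e2 : t₁ / t₀ * (t₂ / t₁) = t₂ / t₀ := by field_simp
  have e3 : t₂ / t₁ * (t₁ / t₀) = t₂ / t₀ := by field_simp
  have e4 : t₂ / t₁ * (t₀ / t₂) = t₀ / t₁ := by field_simp
  have e5 : t₁ / t₀ * (t₀ / t₂) = t₁ / t₂ := by field_simp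
  have hdiv : ∀ {a b : ℝ}, 0 < a → 0 < b → (((b / a) ^ j : ℝ) : ℂ) =
      ((b ^ j : ℝ) : ℂ) / ((a ^ j : ℝ) : ℂ) := fun ha hb => by
    rw [Real.div_rpow hb.le ha.le, Complex.ofReal_div]
  have hdiv' : ∀ {a b : ℝ}, 0 < a → 0 < b → (((b / a) ^ (j - 1) : ℝ) : ℂ) =
      ((b ^ j : ℝ) : ℂ) / ((a ^ j : ℝ) : ℂ) * (a / b) := fun ha hb => by
    rw [Real.rpow_sub_one (div_pos hb ha).ne', Complex.ofReal_div, hdiv ha hb, Complex.ofReal_div,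
      div_div_eq_mul_div, mul_div_assoc]
  have hpow : ∀ {a : ℝ}, 0 < a → ((a ^ (j - 1) : ℝ) : ℂ) = ((a ^ j : ℝ) : ℂ) / a := fun ha => by
    rw [Real.rpow_sub_one ha.ne', Complex.ofReal_div]
  have hs : ∀ {a : ℝ}, 0 < a → ((a ^ j : ℝ) : ℂ) ≠ 0 := fun ha =>
    Complex.ofReal_ne_zero.2 (Real.rpow_pos_of_pos ha j).ne'
  have hsub : ∀ {a b : ℝ}, a ≠ b → (a : ℂ) - b ≠ 0 := fun h =>
    sub_ne_zero.2 (by exact_mod_cast h)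
  have hMT : ∀ {a : ℝ} (b : ℝ), 0 < a → T (b / a) = M a b / ((a ^ j : ℝ) : ℂ) := fun b ha => by
    rw [hM, mul_div_cancel_left₀ _ (hs ha)]
  have hO : ∀ {a b : ℝ}, 0 < a → 0 < b → opInv T j (b / a) = M b a / ((a ^ j : ℝ) : ℂ) :=
    fun ha hb => by
      rw [opInv, inv_div, hMT _ hb, hdiv ha hb]
      field_simp [hs ha, hs hb]
  have k₀ : (t₀ : ℂ) ≠ 0 := by exact_mod_cast h₀.ne'
  have k₁ : (t₁ : ℂ) ≠ 0 := by exact_mod_cast h₁.ne'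
  have k₂ : (t₂ : ℂ) ≠ 0 := by exact_mod_cast h₂.ne'
  simp only [opII, opII1, opII2, opII4, opII3, e1, e2, e3, e4, e5,
    opD_of_ne T (div_pos h₁ h₀).ne' (ne1 h₂ h₀₂.symm),
    opD_of_ne T (div_pos h₂ h₁).ne' (ne1 h₂ h₀₂.symm),
    opD_of_ne T (div_pos h₁ h₀).ne' (ne1 h₁ h₁₂),
    opD_of_ne T (div_pos h₂ h₁).ne' (ne1 h₀ h₀₁),
    opD_of_ne (opInv T j) (div_pos h₁ h₀).ne' (ne1 h₁ h₁₂),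
    opD_of_ne (opInv T j) (div_pos h₂ h₁).ne' (ne1 h₀ h₀₁),
    powDiff_of_ne j (ne1 h₂ h₀₂.symm), powDiff_of_ne j (ne1 h₀ h₀₁), inv_div, Complex.ofReal_mul,
    hpow h₀, hdiv h₀ h₁, hdiv h₂ h₀, hdiv' h₀ h₁, hdiv' h₀ h₂, hMT _ h₀, hMT _ h₁, hMT _ h₂,
    hO h₀ h₁, hO h₁ h₂, hO h₀ h₂, Complex.ofReal_div]
  have s₀ := hs h₀
  have s₁ := hs h₁
  have s₂ := hs h₂
  generalize ((t₀ ^ j : ℝ) : ℂ) = r₀ at *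
  generalize ((t₁ ^ j : ℝ) : ℂ) = r₁ at *
  generalize ((t₂ ^ j : ℝ) : ℂ) = r₂ at *
  have d₀₁ := hsub h₀₁.symm
  have d₁₂ := hsub h₁₂.symm
  have d₀₂ := hsub h₀₂
  have f1 : (t₀ : ℂ) / t₂ - 1 = (t₀ - t₂) / t₂ := by field_simp
  have f2 : (t₁ : ℂ) / t₀ - 1 = (t₁ - t₀) / t₀ := by field_simp
  have f3 : (t₂ : ℂ) / t₁ - 1 = (t₂ - t₁) / t₁ := by field_simp
  rw [f1, f2, f3]
  clear hM hMT hO hpow hdiv hdiv' hs hsub ne1 f1 f2 f3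
  generalize M t₀ t₁ = m₀₁
  generalize M t₀ t₂ = m₀₂
  generalize M t₁ t₀ = m₁₀
  generalize M t₁ t₂ = m₁₂
  generalize M t₂ t₀ = m₂₀
  generalize M t₂ t₁ = m₂₁
  field_simp
  ring

end SpectralFunctions

/-! ### Strongly continuous operator expressions -/

section StrongContinuity

open Filter Topology

variable {E : Type*} [NormedAddCommGroup E] [InnerProductSpace ℂ E] [CompleteSpace E]

local notation "𝓑" => E →L[ℂ] E

/-- Sequential strong continuity at `h` of an operator-valued function, along self-adjoint operators
of norm at most `‖h‖`. -/
def StrongCont (h : 𝓑) (Θ : 𝓑 → 𝓑) : Prop :=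
  ∀ H : ℕ → 𝓑, (∀ n, IsSelfAdjoint (H n) ∧ ‖H n‖ ≤ ‖h‖) → StrongLim atTop H h →
    StrongLim atTop (fun n => Θ (H n)) (Θ h)

namespace StrongCont

variable {h : E →L[ℂ] E} {Θ Θ' : (E →L[ℂ] E) → E →L[ℂ] E}

theorem const (h c : 𝓑) : StrongCont h fun _ => c := fun _ _ _ => StrongLim.const c

theorem cexp (h : 𝓑) (z : ℂ) : StrongCont h (cexp z) := fun _ _ hH => hH.cexp z

theorem add (hΘ : StrongCont h Θ) (hΘ' : StrongCont h Θ') : StrongCont h fun k => Θ k + Θ' k :=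
  fun H h1 h2 => (hΘ H h1 h2).add (hΘ' H h1 h2)

theorem sub (hΘ : StrongCont h Θ) (hΘ' : StrongCont h Θ') : StrongCont h fun k => Θ k - Θ' k :=
  fun H h1 h2 => (hΘ H h1 h2).sub (hΘ' H h1 h2)

theorem mul (hΘ : StrongCont h Θ) (hΘ' : StrongCont h Θ') : StrongCont h fun k => Θ k * Θ' k :=
  fun H h1 h2 => (hΘ H h1 h2).mul (hΘ' H h1 h2)

theorem smul (c : ℂ) (hΘ : StrongCont h Θ) : StrongCont h fun k => c • Θ k :=
  fun H h1 h2 => (hΘ H h1 h2).smul c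

theorem duh (p : ℂ) (hΘ : StrongCont h Θ) : StrongCont h fun k => duh k p (Θ k) :=
  fun H h1 h2 => h2.duh p (hΘ H h1 h2)

theorem integral {Ω : Type*} [MeasurableSpace Ω] {μ : Measure Ω} (hh : IsSelfAdjoint h)
    {Θ : Ω → 𝓑 → 𝓑} {bound : Ω → ℝ} (hb : Integrable bound μ)
    (hm : ∀ k, AEStronglyMeasurable (fun t => Θ t k) μ)
    (hΘb : ∀ k, IsSelfAdjoint k → ‖k‖ ≤ ‖h‖ → ∀ t, ‖Θ t k‖ ≤ bound t)
    (hΘ : ∀ t, StrongCont h (Θ t)) : StrongCont h fun k => ∫ t, Θ t k ∂μ :=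
  fun H h1 h2 => StrongLim.integral bound hb (fun n => hm (H n))
    (fun n => Eventually.of_forall (hΘb _ (h1 n).1 (h1 n).2)) (hm h)
    (Eventually.of_forall (hΘb h hh le_rfl)) fun t => hΘ t H h1 h2

/-- Two strongly continuous expressions agree at `h` if they agree at the self-adjoint operators of
norm at most `‖h‖` which are diagonal with finitely many eigenvalues. -/
theorem eq_of_resolution [TopologicalSpace.SeparableSpace E] (hh : IsSelfAdjoint h)
    (hΘ : StrongCont h Θ) (hΘ' : StrongCont h Θ')
    (heq : ∀ k, IsSelfAdjoint k → ‖k‖ ≤ ‖h‖ → SpectralResolution k ‖h‖ → Θ k = Θ' k) :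
    Θ h = Θ' h := by
  obtain ⟨H, hH, hHn⟩ := exists_strongLim_resolution hh
  have h1 := hΘ H (fun n => ⟨(hHn n).1, (hHn n).2.1⟩) hH
  have h2 := hΘ' H (fun n => ⟨(hHn n).1, (hHn n).2.1⟩) hH
  have h3 : (fun n => Θ (H n)) = fun n => Θ' (H n) := funext fun n =>
    heq _ (hHn n).1 (hHn n).2.1 (hHn n).2.2.some
  rw [h3] at h1
  exact h1.unique h2

end StrongCont

end StrongContinuity

/-! ### Matrix entries with respect to a spectral resolution -/

section Compression

variable {E : Type*} [NormedAddCommGroup E] [InnerProductSpace ℂ E] [CompleteSpace E]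

local notation "𝓑" => E →L[ℂ] E

theorem mul_integral_mul {Ω : Type*} [MeasurableSpace Ω] {μ : Measure Ω} (A B : 𝓑) {f : Ω → 𝓑}
    (hf : Integrable f μ) : A * (∫ t, f t ∂μ) * B = ∫ t, A * f t * B ∂μ :=
  ((ContinuousLinearMap.mulLeftRight ℂ 𝓑 A B).integral_comp_comm hf).symm

/-- The divided difference of `x ↦ e^{px}` at `x`, `y`, as an integral. -/
noncomputable def expDiff (p : ℂ) (x y : ℝ) : ℂ :=
  ∫ s in (0 : ℝ)..1, p * Complex.exp ((1 - s) * p * x + s * p * y)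

namespace SpectralResolution

variable {k : E →L[ℂ] E} {R : ℝ} (S : SpectralResolution k R)

theorem ext_of_compress {X Y : 𝓑} (hXY : ∀ i j, S.P i * X * S.P j = S.P i * Y * S.P j) :
    X = Y := by
  have key : ∀ Z : 𝓑, Z = ∑ i, ∑ j, S.P i * Z * S.P j := fun Z => by
    simp only [← Finset.mul_sum, S.sum_eq_one, mul_one, ← Finset.sum_mul, one_mul]
  rw [key X, key Y]
  simp only [hXY]

theorem mul_eq_sum (X Y : 𝓑) : X * Y = ∑ m, X * S.P m * Y := by
  rw [← Finset.sum_mul, ← Finset.mul_sum, S.sum_eq_one, mul_one]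

theorem mul_cexp (i : S.ι) (z : ℂ) : S.P i * cexp z k = Complex.exp (z * S.x i) • S.P i :=
  eigen_mul_cexp (S.eq_mul i) z

theorem cexp_mul (i : S.ι) (z : ℂ) : cexp z k * S.P i = Complex.exp (z * S.x i) • S.P i :=
  cexp_mul_eigen (S.mul_eq i) z

theorem compress_cexp (i j : S.ι) (z w : ℂ) (X : 𝓑) :
    S.P i * (cexp z k * X * cexp w k) * S.P j =
      Complex.exp (z * S.x i + w * S.x j) • (S.P i * X * S.P j) := by
  calc _ = (S.P i * cexp z k) * X * (cexp w k * S.P j) := by noncomm_ring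
    _ = _ := by
      rw [mul_cexp, cexp_mul, smul_mul_assoc, smul_mul_assoc, mul_smul_comm, smul_smul,
        Complex.exp_add]

theorem compress_duh (i j : S.ι) (p : ℂ) (X : 𝓑) :
    S.P i * duh k p X * S.P j = expDiff p (S.x i) (S.x j) • (S.P i * X * S.P j) := by
  rw [duh, expDiff, intervalIntegral.integral_of_le zero_le_one,
    intervalIntegral.integral_of_le zero_le_one, mul_integral_mul _ _
      ((Continuous.intervalIntegrable (by fun_prop) 0 1).1), ← integral_smul_const]
  refine integral_congr_ae (Filter.Eventually.of_forall fun s => ?_)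
  simp only [mul_smul_comm, smul_mul_assoc, compress_cexp, smul_smul]

end SpectralResolution

end Compression

/-! ### The functional calculus of the modular operator -/

section ModularCalculus

open Filter Topology

variable {E : Type*} [NormedAddCommGroup E] [InnerProductSpace ℂ E] [CompleteSpace E]

local notation "𝓑" => E →L[ℂ] E

/-- The imaginary power `𝐲^{-iξ}(ρ) = e^{iξh} ρ e^{-iξh}` of the modular operator of `e^h`. -/
noncomputable def modRot (h : 𝓑) (ξ : ℝ) (ρ : 𝓑) : 𝓑 :=
  cexp (Complex.I * ξ) h * ρ * cexp (-(Complex.I * ξ)) h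

theorem norm_cexp_imag_le {h : 𝓑} (hh : IsSelfAdjoint h) {z : ℂ} (hz : z.re = 0) :
    ‖cexp z h‖ ≤ 1 := by
  simpa [hz] using norm_cexp_le hh z

theorem norm_modRot_le {h : 𝓑} (hh : IsSelfAdjoint h) (ξ : ℝ) (ρ : 𝓑) :
    ‖modRot h ξ ρ‖ ≤ ‖ρ‖ := by
  have h1 := norm_cexp_imag_le hh (z := Complex.I * ξ) (by simp)
  have h2 := norm_cexp_imag_le hh (z := -(Complex.I * ξ)) (by simp)
  calc ‖modRot h ξ ρ‖ ≤ ‖cexp (Complex.I * ξ) h‖ * ‖ρ‖ * ‖cexp (-(Complex.I * ξ)) h‖ :=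
        (norm_mul_le _ _).trans (mul_le_mul_of_nonneg_right (norm_mul_le _ _) (norm_nonneg _))
    _ ≤ 1 * ‖ρ‖ * 1 := by gcongr
    _ = ‖ρ‖ := by ring

@[fun_prop]
theorem continuous_modRot {X : Type*} [TopologicalSpace X] {f : X → 𝓑} {u : X → ℝ} {g : X → 𝓑}
    (hf : Continuous f) (hu : Continuous u) (hg : Continuous g) :
    Continuous fun x => modRot (f x) (u x) (g x) := by
  unfold modRot
  fun_prop

theorem SpectralResolution.compress_modRot {k : 𝓑} {R : ℝ} (S : SpectralResolution k R)
    (i j : S.ι) (ξ : ℝ) (ρ : 𝓑) :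
    S.P i * modRot k ξ ρ * S.P j =
      Complex.exp (-(Complex.I * ((S.x j - S.x i : ℝ) * ξ))) • (S.P i * ρ * S.P j) := by
  rw [modRot, S.compress_cexp]
  congr 2
  push_cast
  ring

/-- The value `∫ β(ξ) 𝐲^{-iξ}(ρ) dξ` of the one-variable modular calculus. -/
noncomputable def modInt₁ (β : ℝ → ℂ) (ρ h : 𝓑) : 𝓑 := ∫ ξ, β ξ • modRot h ξ ρ

/-- The value `∫ β(ξ) 𝐲^{-iξ₁}(ρ₁) 𝐲^{-iξ₂}(ρ₂) dξ` of the two-variable modular calculus. -/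
noncomputable def modInt₂ (β : ℝ × ℝ → ℂ) (ρ₁ ρ₂ h : 𝓑) : 𝓑 :=
  ∫ ξ, β ξ • (modRot h ξ.1 ρ₁ * modRot h ξ.2 ρ₂)

theorem aestronglyMeasurable_smul_modRot {β : ℝ → ℂ} (hβ : Integrable β) (ρ h : 𝓑) :
    AEStronglyMeasurable fun ξ => β ξ • modRot h ξ ρ :=
  hβ.1.smul (Continuous.aestronglyMeasurable (by fun_prop))

theorem aestronglyMeasurable_smul_modRot_mul {β : ℝ × ℝ → ℂ} (hβ : Integrable β) (ρ₁ ρ₂ h : 𝓑) :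
    AEStronglyMeasurable fun ξ => β ξ • (modRot h ξ.1 ρ₁ * modRot h ξ.2 ρ₂) :=
  hβ.1.smul (Continuous.aestronglyMeasurable (by fun_prop))

theorem norm_smul_modRot_le {h : 𝓑} (hh : IsSelfAdjoint h) (c : ℂ) (ξ : ℝ) (ρ : 𝓑) :
    ‖c • modRot h ξ ρ‖ ≤ ‖c‖ * ‖ρ‖ := by
  rw [norm_smul]
  exact mul_le_mul_of_nonneg_left (norm_modRot_le hh _ _) (norm_nonneg _)

theorem norm_smul_modRot_mul_le {h : 𝓑} (hh : IsSelfAdjoint h) (c : ℂ) (ξ : ℝ × ℝ) (ρ₁ ρ₂ : 𝓑) :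
    ‖c • (modRot h ξ.1 ρ₁ * modRot h ξ.2 ρ₂)‖ ≤ ‖c‖ * (‖ρ₁‖ * ‖ρ₂‖) := by
  rw [norm_smul]
  exact mul_le_mul_of_nonneg_left ((norm_mul_le _ _).trans (mul_le_mul (norm_modRot_le hh _ _)
    (norm_modRot_le hh _ _) (norm_nonneg _) (norm_nonneg _))) (norm_nonneg _)

theorem integrable_smul_modRot {β : ℝ → ℂ} (hβ : Integrable β) {h : 𝓑} (hh : IsSelfAdjoint h)
    (ρ : 𝓑) : Integrable fun ξ => β ξ • modRot h ξ ρ :=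
  (hβ.norm.mul_const ‖ρ‖).mono' (aestronglyMeasurable_smul_modRot hβ ρ h)
    (Eventually.of_forall fun ξ => norm_smul_modRot_le hh _ ξ ρ)

theorem integrable_smul_modRot_mul {β : ℝ × ℝ → ℂ} (hβ : Integrable β) {h : 𝓑}
    (hh : IsSelfAdjoint h) (ρ₁ ρ₂ : 𝓑) :
    Integrable fun ξ => β ξ • (modRot h ξ.1 ρ₁ * modRot h ξ.2 ρ₂) :=
  (hβ.norm.mul_const (‖ρ₁‖ * ‖ρ₂‖)).mono' (aestronglyMeasurable_smul_modRot_mul hβ ρ₁ ρ₂ h)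
    (Eventually.of_forall fun ξ => norm_smul_modRot_mul_le hh _ ξ ρ₁ ρ₂)

theorem strongCont_modRot (h : 𝓑) (ξ : ℝ) (ρ : 𝓑) : StrongCont h fun k => modRot k ξ ρ :=
  ((StrongCont.cexp h _).mul (StrongCont.const h ρ)).mul (StrongCont.cexp h _)

theorem strongCont_modInt₁ {β : ℝ → ℂ} (hβ : Integrable β) {h : 𝓑} (hh : IsSelfAdjoint h)
    (ρ : 𝓑) : StrongCont h (modInt₁ β ρ) :=
  StrongCont.integral hh (hβ.norm.mul_const ‖ρ‖) (aestronglyMeasurable_smul_modRot hβ ρ)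
    (fun _ hk _ ξ => norm_smul_modRot_le hk _ ξ ρ) fun ξ => (strongCont_modRot h ξ ρ).smul _

theorem strongCont_modInt₂ {β : ℝ × ℝ → ℂ} (hβ : Integrable β) {h : 𝓑} (hh : IsSelfAdjoint h)
    {Θ₁ Θ₂ : 𝓑 → 𝓑} {B₁ B₂ : ℝ} (hΘ₁ : StrongCont h Θ₁) (hΘ₂ : StrongCont h Θ₂)
    (hB₁ : ∀ k, IsSelfAdjoint k → ‖k‖ ≤ ‖h‖ → ‖Θ₁ k‖ ≤ B₁)
    (hB₂ : ∀ k, IsSelfAdjoint k → ‖k‖ ≤ ‖h‖ → ‖Θ₂ k‖ ≤ B₂) :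
    StrongCont h fun k => modInt₂ β (Θ₁ k) (Θ₂ k) k := by
  refine StrongCont.integral hh (hβ.norm.mul_const (B₁ * B₂))
    (fun k => aestronglyMeasurable_smul_modRot_mul hβ (Θ₁ k) (Θ₂ k) k)
    (fun k hk hkh ξ => (norm_smul_modRot_mul_le hk _ ξ _ _).trans ?_)
    fun ξ => (StrongCont.mul (((StrongCont.cexp h _).mul hΘ₁).mul (StrongCont.cexp h _))
      (((StrongCont.cexp h _).mul hΘ₂).mul (StrongCont.cexp h _))).smul _
  exact mul_le_mul_of_nonneg_left (mul_le_mul (hB₁ k hk hkh) (hB₂ k hk hkh) (norm_nonneg _)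
    ((norm_nonneg _).trans (hB₁ k hk hkh))) (norm_nonneg _)

variable {k : E →L[ℂ] E} {R : ℝ}

theorem SpectralResolution.compress_modInt₁ (S : SpectralResolution k R) (hk : IsSelfAdjoint k)
    {β : ℝ → ℂ} (hβ : Integrable β) (ρ : 𝓑) (i j : S.ι) :
    S.P i * modInt₁ β ρ k * S.P j =
      (∫ ξ : ℝ, β ξ * Complex.exp (-(Complex.I * ((S.x j - S.x i : ℝ) * ξ)))) •
        (S.P i * ρ * S.P j) := by
  rw [modInt₁, mul_integral_mul _ _ (integrable_smul_modRot hβ hk ρ), ← integral_smul_const]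
  refine integral_congr_ae (Eventually.of_forall fun ξ => ?_)
  simp only [mul_smul_comm, smul_mul_assoc, S.compress_modRot, smul_smul]

theorem SpectralResolution.compress_modInt₂ (S : SpectralResolution k R) (hk : IsSelfAdjoint k)
    {β : ℝ × ℝ → ℂ} (hβ : Integrable β) (ρ₁ ρ₂ : 𝓑) (i j : S.ι) :
    S.P i * modInt₂ β ρ₁ ρ₂ k * S.P j =
      ∑ m, (∫ ξ : ℝ × ℝ, β ξ * Complex.exp (-(Complex.I *
        ((S.x m - S.x i : ℝ) * ξ.1 + (S.x j - S.x m : ℝ) * ξ.2)))) •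
          (S.P i * ρ₁ * S.P m * ρ₂ * S.P j) := by
  have hint : ∀ m, Integrable fun ξ : ℝ × ℝ => (β ξ * Complex.exp (-(Complex.I *
        ((S.x m - S.x i : ℝ) * ξ.1 + (S.x j - S.x m : ℝ) * ξ.2)))) •
          (S.P i * ρ₁ * S.P m * ρ₂ * S.P j) := by
    intro m
    refine Integrable.smul_const ?_ _
    refine hβ.mono (hβ.1.mul (Continuous.aestronglyMeasurable (by fun_prop)))
      (Eventually.of_forall fun ξ => ?_)
    rw [norm_mul, Complex.norm_exp]
    simp
  rw [modInt₂, mul_integral_mul _ _ (integrable_smul_modRot_mul hβ hk ρ₁ ρ₂)]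
  simp only [← integral_smul_const]
  rw [← integral_finsetSum _ fun m _ => hint m]
  refine integral_congr_ae (Eventually.of_forall fun ξ => ?_)
  simp only [mul_smul_comm, smul_mul_assoc]
  rw [S.mul_eq_sum (modRot k ξ.1 ρ₁) (modRot k ξ.2 ρ₂), Finset.mul_sum, Finset.sum_mul,
    Finset.smul_sum]
  refine Finset.sum_congr rfl fun m _ => ?_
  have h1 : S.P i * (modRot k ξ.1 ρ₁ * S.P m * modRot k ξ.2 ρ₂) * S.P j =
      (S.P i * modRot k ξ.1 ρ₁ * S.P m) * modRot k ξ.2 ρ₂ * S.P j := by noncomm_ring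
  have h2 : S.P i * ρ₁ * S.P m * modRot k ξ.2 ρ₂ * S.P j =
      S.P i * ρ₁ * (S.P m * modRot k ξ.2 ρ₂ * S.P j) := by noncomm_ring
  rw [h1, S.compress_modRot, smul_mul_assoc, smul_mul_assoc, h2, S.compress_modRot, mul_smul_comm,
    smul_smul, smul_smul, mul_assoc (β ξ), ← Complex.exp_add]
  congr 1
  congr 2
  ring

variable [TopologicalSpace.SeparableSpace E] {h : E →L[ℂ] E}

theorem SpectralResolution.abs_sub_le (S : SpectralResolution k R) (i j : S.ι) :
    |S.x j - S.x i| ≤ 2 * R :=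
  (abs_sub _ _).trans (by linarith [S.abs_le i, S.abs_le j])

/-- The calculus depends on `β` only through the function it represents on `[-2‖h‖, 2‖h‖]`, which
contains all differences of eigenvalues of the approximants of `h`. -/
theorem modInt₁_congr (hh : IsSelfAdjoint h) {β β' : ℝ → ℂ} (hβ : Integrable β)
    (hβ' : Integrable β') (ρ : 𝓑) (heq : ∀ x : ℝ, |x| ≤ 2 * ‖h‖ →
      ∫ ξ : ℝ, β ξ * Complex.exp (-(Complex.I * (x * ξ))) =
        ∫ ξ : ℝ, β' ξ * Complex.exp (-(Complex.I * (x * ξ)))) :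
    modInt₁ β ρ h = modInt₁ β' ρ h := by
  refine StrongCont.eq_of_resolution hh (strongCont_modInt₁ hβ hh ρ) (strongCont_modInt₁ hβ' hh ρ)
    fun k hk _ S => S.ext_of_compress fun i j => ?_
  rw [S.compress_modInt₁ hk hβ, S.compress_modInt₁ hk hβ', heq _ (S.abs_sub_le i j)]

theorem modInt₂_congr (hh : IsSelfAdjoint h) {β β' : ℝ × ℝ → ℂ} (hβ : Integrable β)
    (hβ' : Integrable β') (ρ₁ ρ₂ : 𝓑) (heq : ∀ x₁ x₂ : ℝ, |x₁| ≤ 2 * ‖h‖ → |x₂| ≤ 2 * ‖h‖ →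
      ∫ ξ : ℝ × ℝ, β ξ * Complex.exp (-(Complex.I * (x₁ * ξ.1 + x₂ * ξ.2))) =
        ∫ ξ : ℝ × ℝ, β' ξ * Complex.exp (-(Complex.I * (x₁ * ξ.1 + x₂ * ξ.2)))) :
    modInt₂ β ρ₁ ρ₂ h = modInt₂ β' ρ₁ ρ₂ h := by
  refine StrongCont.eq_of_resolution hh
    (strongCont_modInt₂ hβ hh (StrongCont.const h ρ₁) (StrongCont.const h ρ₂)
      (fun _ _ _ => le_rfl) fun _ _ _ => le_rfl)
    (strongCont_modInt₂ hβ' hh (StrongCont.const h ρ₁) (StrongCont.const h ρ₂)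
      (fun _ _ _ => le_rfl) fun _ _ _ => le_rfl) fun k hk _ S => S.ext_of_compress fun i j => ?_
  rw [S.compress_modInt₂ hk hβ, S.compress_modInt₂ hk hβ']
  simp only [fun m => heq _ _ (S.abs_sub_le i m) (S.abs_sub_le m j)]

end ModularCalculus

/-! ### The scalar identities at the eigenvalues -/

section ScalarIdentity

open NCTorus Filter Topology

theorem sub_mul_expDiff (p : ℂ) (x y : ℝ) :
    ((x : ℂ) - y) * expDiff p x y = Complex.exp (p * x) - Complex.exp (p * y) := by
  have hd : ∀ s ∈ uIcc (0 : ℝ) 1,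
      HasDerivAt (fun s : ℝ => Complex.exp ((1 - s) * p * x + s * p * y))
        (((y : ℂ) - x) * (p * Complex.exp ((1 - s) * p * x + s * p * y))) s := by
    intro s _
    have h2 : HasDerivAt (fun s : ℝ => (s : ℂ)) 1 s := Complex.ofRealCLM.hasDerivAt (x := s)
    have h3 := ((((h2.const_sub 1).mul_const p).mul_const (x : ℂ)).add
      ((h2.mul_const p).mul_const (y : ℂ))).cexp
    refine h3.congr_deriv ?_
    simp only [Pi.add_apply]
    ring
  have h1 := intervalIntegral.integral_eq_sub_of_hasDerivAt hd
    (Continuous.intervalIntegrable (by fun_prop) _ _)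
  rw [intervalIntegral.integral_const_mul] at h1
  simp only [Complex.ofReal_one, sub_self, zero_mul, one_mul, zero_add, Complex.ofReal_zero,
    sub_zero, add_zero] at h1
  rw [expDiff, ← neg_sub (y : ℂ) x, neg_mul, h1, neg_sub]

theorem expDiff_of_ne (p : ℂ) {x y : ℝ} (hxy : x ≠ y) :
    expDiff p x y = (Complex.exp (p * x) - Complex.exp (p * y)) / (x - y) := by
  have : (x : ℂ) - y ≠ 0 := sub_ne_zero.2 (by exact_mod_cast hxy)
  rw [← sub_mul_expDiff, mul_div_cancel_left₀ _ this]

@[fun_prop]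
theorem continuous_expDiff {X : Type*} [TopologicalSpace X] {p : X → ℂ} {f g : X → ℝ}
    (hp : Continuous p) (hf : Continuous f) (hg : Continuous g) :
    Continuous fun x => expDiff (p x) (f x) (g x) := by
  refine intervalIntegral.continuous_parametric_intervalIntegral_of_continuous'
    (f := fun x s => p x * Complex.exp ((1 - (s : ℝ)) * p x * f x + s * p x * g x)) ?_ 0 1
  simp only [Function.uncurry_def]
  fun_prop

theorem norm_exp_mul_ofReal_le {p : ℂ} {x A R : ℝ} (hp : |p.re| ≤ A) (hx : |x| ≤ R) :
    ‖Complex.exp (p * x)‖ ≤ Real.exp (A * R) := by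
  rw [Complex.norm_exp, Complex.re_mul_ofReal]
  refine Real.exp_le_exp.2 ((le_abs_self _).trans ?_)
  rw [abs_mul]
  exact mul_le_mul hp hx (abs_nonneg _) ((abs_nonneg _).trans hp)

theorem norm_expDiff_le {p : ℂ} {x y A R : ℝ} (hp : |p.re| ≤ A) (hx : |x| ≤ R) (hy : |y| ≤ R) :
    ‖expDiff p x y‖ ≤ ‖p‖ * Real.exp (A * R) := by
  have hb : ∀ s ∈ uIoc (0 : ℝ) 1, ‖p * Complex.exp ((1 - s) * p * x + s * p * y)‖ ≤
      ‖p‖ * Real.exp (A * R) := by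
    intro s hs
    rw [uIoc_of_le zero_le_one] at hs
    rw [norm_mul, show (1 - s) * p * x + s * p * y = p * ((1 - s) * x + s * y : ℝ) by
      push_cast; ring]
    refine mul_le_mul_of_nonneg_left (norm_exp_mul_ofReal_le hp ?_) (norm_nonneg _)
    have h1 := abs_le.1 hx
    have h2 := abs_le.1 hy
    rw [abs_le]
    constructor <;> nlinarith [hs.1, hs.2, h1.1, h1.2, h2.1, h2.2]
  have := intervalIntegral.norm_integral_le_of_norm_le_const hb
  rwa [sub_zero, abs_one, mul_one] at this

/-- The symbol of `varOp`: its matrix entry at three eigenvalues `x`, `y`, `z` of `h`. -/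
noncomputable def varSymbol (p q : ℂ) (x y z : ℝ) : ℂ :=
  expDiff p x z * (expDiff 1 x y * Complex.exp (q * y) * expDiff 1 y z) -
    expDiff 1 x z * (Complex.exp (q * x) * expDiff 1 x y * expDiff p y z) -
    expDiff 1 x z * (expDiff p x y * expDiff 1 y z * Complex.exp (q * z))

theorem norm_varSymbol_le {p q : ℂ} {x y z A R : ℝ} (hA : 1 ≤ A) (hp : |p.re| ≤ A)
    (hq : |q.re| ≤ A) (hx : |x| ≤ R) (hy : |y| ≤ R) (hz : |z| ≤ R) :
    ‖varSymbol p q x y z‖ ≤ 3 * Real.exp (A * R) ^ 4 * ‖p‖ := by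
  have hone : |(1 : ℂ).re| ≤ A := by simpa using hA
  have e1 : ∀ {x y : ℝ}, |x| ≤ R → |y| ≤ R → ‖expDiff 1 x y‖ ≤ Real.exp (A * R) :=
    fun hx hy => by simpa using norm_expDiff_le hone hx hy
  have e0 := (Real.exp_pos (A * R)).le
  have key : ∀ {a b c d : ℂ}, ‖a‖ ≤ ‖p‖ * Real.exp (A * R) → ‖b‖ ≤ Real.exp (A * R) →
      ‖c‖ ≤ Real.exp (A * R) → ‖d‖ ≤ Real.exp (A * R) →
      ‖a‖ * (‖b‖ * ‖c‖ * ‖d‖) ≤ Real.exp (A * R) ^ 4 * ‖p‖ := fun ha hb hc hd =>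
    calc _ ≤ ‖p‖ * Real.exp (A * R) * (Real.exp (A * R) * Real.exp (A * R) * Real.exp (A * R)) := by
          gcongr
      _ = _ := by ring
  have k1 := key (norm_expDiff_le hp hx hz) (e1 hx hy) (norm_exp_mul_ofReal_le hq hy) (e1 hy hz)
  have k2 := key (norm_expDiff_le hp hy hz) (e1 hx hz) (norm_exp_mul_ofReal_le hq hx) (e1 hx hy)
  have k3 := key (norm_expDiff_le hp hx hy) (e1 hx hz) (e1 hy hz) (norm_exp_mul_ofReal_le hq hz)
  rw [varSymbol]
  refine (norm_sub_le _ _).trans ((add_le_add_left (norm_sub_le _ _) _).trans ?_)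
  simp only [norm_mul] at *
  linarith

/-- The first of the exponents `p = j + iξ`, `q = -iξ` for which `k^j 𝐲^{-iξ}(ρ) = k^p ρ k^q`. -/
noncomputable def expP (j ξ : ℝ) : ℂ := j + Complex.I * ξ

/-- The second exponent `q = -iξ`; see `expP`. -/
noncomputable def expQ (ξ : ℝ) : ℂ := -(Complex.I * ξ)

@[simp] theorem expP_re (j ξ : ℝ) : (expP j ξ).re = j := by simp [expP]

@[simp] theorem expQ_re (ξ : ℝ) : (expQ ξ).re = 0 := by simp [expQ]

theorem norm_expP_le (j ξ : ℝ) : ‖expP j ξ‖ ≤ |j| + |ξ| := by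
  refine (norm_add_le _ _).trans ?_
  simp

theorem norm_expQ (ξ : ℝ) : ‖expQ ξ‖ = |ξ| := by simp [expQ]

theorem norm_varSymbol_add_le (j ξ : ℝ) {x y z R : ℝ} (hx : |x| ≤ R) (hy : |y| ≤ R)
    (hz : |z| ≤ R) :
    ‖varSymbol (expP j ξ) (expQ ξ) x y z + varSymbol (expQ ξ) (expP j ξ) x y z‖ ≤
      3 * Real.exp (max 1 |j| * R) ^ 4 * (|j| + 2 * |ξ|) := by
  have hP : |(expP j ξ).re| ≤ max 1 |j| := by rw [expP_re]; exact le_max_right _ _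
  have hQ : |(expQ ξ).re| ≤ max 1 |j| := by
    rw [expQ_re, abs_zero]; exact zero_le_one.trans (le_max_left _ _)
  have n1 := norm_varSymbol_le (le_max_left 1 |j|) hP hQ hx hy hz
  have n2 := norm_varSymbol_le (le_max_left 1 |j|) hQ hP hx hy hz
  have n3 := norm_expP_le j ξ
  rw [norm_expQ] at n2
  calc _ ≤ 3 * Real.exp (max 1 |j| * R) ^ 4 * (|j| + |ξ|) +
        3 * Real.exp (max 1 |j| * R) ^ 4 * |ξ| := by
        refine (norm_add_le _ _).trans (add_le_add ?_ n2)
        exact n1.trans (mul_le_mul_of_nonneg_left n3 (by positivity))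
    _ = _ := by ring

@[fun_prop]
theorem continuous_expP {X : Type*} [TopologicalSpace X] (j : ℝ) {f : X → ℝ}
    (hf : Continuous f) : Continuous fun x => expP j (f x) := by
  unfold expP
  fun_prop

@[fun_prop]
theorem continuous_expQ {X : Type*} [TopologicalSpace X] {f : X → ℝ}
    (hf : Continuous f) : Continuous fun x => expQ (f x) := by
  unfold expQ
  fun_prop

theorem exp_expP_expQ (j ξ x y : ℝ) : Complex.exp (expP j ξ * x + expQ ξ * y) =
    (Real.exp (j * x) : ℂ) * Complex.exp (-(Complex.I * ((y - x : ℝ) * ξ))) := by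
  rw [Complex.ofReal_exp, ← Complex.exp_add, expP, expQ]
  congr 1
  push_cast
  ring

variable {β : ℝ → ℂ} {T : ℝ → ℂ}

theorem integrable_bound (hβ : Integrable β) (hβ' : Integrable fun ξ => |ξ| * ‖β ξ‖) (C j : ℝ) :
    Integrable fun ξ => ‖β ξ‖ * (C * (|j| + 2 * |ξ|)) := by
  have := ((hβ.norm.const_mul |j|).add (hβ'.const_mul 2)).const_mul C
  refine this.congr (Eventually.of_forall fun ξ => ?_)
  simp only [Pi.add_apply]
  ring

theorem integrable_mul_exp (hβ : Integrable β) (j x y : ℝ) :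
    Integrable fun ξ => β ξ * Complex.exp (expP j ξ * x + expQ ξ * y) := by
  refine (hβ.norm.mul_const (Real.exp (j * x))).mono'
    (hβ.1.mul (Continuous.aestronglyMeasurable (by fun_prop)))
    (Eventually.of_forall fun ξ => ?_)
  rw [norm_mul, Complex.norm_exp]
  simp

theorem integral_mul_exp {R : ℝ} (hT : ∀ x : ℝ, |x| ≤ R →
      T (Real.exp x) = ∫ ξ : ℝ, β ξ * Complex.exp (-(Complex.I * (x * ξ)))) (j : ℝ) {x y : ℝ}
    (hxy : |y - x| ≤ R) :
    ∫ ξ, β ξ * Complex.exp (expP j ξ * x + expQ ξ * y) =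
      ((Real.exp x ^ j : ℝ) : ℂ) * T (Real.exp y / Real.exp x) := by
  rw [← Real.exp_sub, hT _ hxy, ← integral_const_mul, ← Real.exp_mul, mul_comm x j]
  refine integral_congr_ae (Eventually.of_forall fun ξ => ?_)
  simp only [exp_expP_expQ]
  ring

/-- At distinct eigenvalues the symmetrized symbol is a combination of the exponentials
`e^{pa + qb}`, where `a ≠ b` are two of the eigenvalues. -/
theorem varSymbol_add_of_ne {x y z : ℝ} (hxy : x ≠ y) (hyz : y ≠ z) (hxz : x ≠ z) (p q : ℂ) :
    ((x - y) * (y - z) * (x - z) : ℂ) * (varSymbol p q x y z + varSymbol q p x y z) =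
      (Real.exp x - Real.exp y) * (Real.exp y - Real.exp z) *
          (Complex.exp (p * x + q * y) - Complex.exp (p * z + q * y) +
            (Complex.exp (p * y + q * x) - Complex.exp (p * y + q * z))) -
        (Real.exp x - Real.exp z) * (Real.exp x - Real.exp y) *
          (Complex.exp (p * y + q * x) - Complex.exp (p * z + q * x) +
            (Complex.exp (p * x + q * y) - Complex.exp (p * x + q * z))) -
        (Real.exp x - Real.exp z) * (Real.exp y - Real.exp z) *
          (Complex.exp (p * x + q * z) - Complex.exp (p * y + q * z) +
            (Complex.exp (p * z + q * x) - Complex.exp (p * z + q * y))) := by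
  have h1 : (x : ℂ) - y ≠ 0 := sub_ne_zero.2 (by exact_mod_cast hxy)
  have h2 : (y : ℂ) - z ≠ 0 := sub_ne_zero.2 (by exact_mod_cast hyz)
  have h3 : (x : ℂ) - z ≠ 0 := sub_ne_zero.2 (by exact_mod_cast hxz)
  simp only [varSymbol, expDiff_of_ne _ hxy, expDiff_of_ne _ hyz, expDiff_of_ne _ hxz,
    Complex.exp_add, one_mul, Complex.ofReal_exp]
  field_simp
  ring

theorem integrable_alternating {f₁ f₂ f₃ f₄ : ℝ → ℂ} (h₁ : Integrable f₁) (h₂ : Integrable f₂)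
    (h₃ : Integrable f₃) (h₄ : Integrable f₄) :
    Integrable fun ξ => f₁ ξ - f₂ ξ + (f₃ ξ - f₄ ξ) :=
  (h₁.sub h₂).add (h₃.sub h₄)

theorem integral_alternating {f₁ f₂ f₃ f₄ : ℝ → ℂ} (h₁ : Integrable f₁) (h₂ : Integrable f₂)
    (h₃ : Integrable f₃) (h₄ : Integrable f₄) :
    ∫ ξ, (f₁ ξ - f₂ ξ + (f₃ ξ - f₄ ξ)) = (∫ ξ, f₁ ξ) - (∫ ξ, f₂ ξ) + ((∫ ξ, f₃ ξ) - ∫ ξ, f₄ ξ) := by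
  have h := integral_add (h₁.sub h₂) (h₃.sub h₄)
  simp only [Pi.sub_apply] at h
  rw [h, integral_sub h₁ h₂, integral_sub h₃ h₄]

theorem integral_mul_sub_mul_sub_mul {f g k : ℝ → ℂ} (hf : Integrable f) (hg : Integrable g)
    (hk : Integrable k) (a b c : ℂ) :
    ∫ ξ, (a * f ξ - b * g ξ - c * k ξ) = a * (∫ ξ, f ξ) - b * (∫ ξ, g ξ) - c * ∫ ξ, k ξ := by
  have h := integral_sub ((hf.const_mul a).sub (hg.const_mul b)) (hk.const_mul c)
  simp only [Pi.sub_apply] at h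
  rw [h, integral_sub (hf.const_mul a) (hg.const_mul b), integral_const_mul, integral_const_mul,
    integral_const_mul]

theorem integral_varSymbol_of_ne (hβ : Integrable β) {R : ℝ} (hT : ∀ x : ℝ, |x| ≤ R →
      T (Real.exp x) = ∫ ξ : ℝ, β ξ * Complex.exp (-(Complex.I * (x * ξ)))) (j : ℝ) {x y z : ℝ}
    (hxy : x ≠ y) (hyz : y ≠ z) (hxz : x ≠ z) (rxy : |y - x| ≤ R) (ryz : |z - y| ≤ R)
    (rxz : |z - x| ≤ R) :
    ∫ ξ, β ξ * (varSymbol (expP j ξ) (expQ ξ) x y z + varSymbol (expQ ξ) (expP j ξ) x y z) =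
      expDiff 1 x z * (((Real.exp x ^ (j - 1) : ℝ) : ℂ) *
        (opII T j (Real.exp (y - x)) (Real.exp (z - y)) * (expDiff 1 x y * expDiff 1 y z))) := by
  have h1 : (x : ℂ) - y ≠ 0 := sub_ne_zero.2 (by exact_mod_cast hxy)
  have h2 : (y : ℂ) - z ≠ 0 := sub_ne_zero.2 (by exact_mod_cast hyz)
  have h3 : (x : ℂ) - z ≠ 0 := sub_ne_zero.2 (by exact_mod_cast hxz)
  have ne : ∀ {a b : ℝ}, a ≠ b → Real.exp a ≠ Real.exp b := fun h h' => h (Real.exp_injective h')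
  refine mul_left_cancel₀ (mul_ne_zero (mul_ne_zero h1 h2) h3) ?_
  have I := fun a b => integrable_mul_exp hβ j a b
  have hM := fun {a b : ℝ} (h : |b - a| ≤ R) => integral_mul_exp hT j h
  have hl : ∫ ξ, ((x - y) * (y - z) * (x - z) : ℂ) * (β ξ *
      (varSymbol (expP j ξ) (expQ ξ) x y z + varSymbol (expQ ξ) (expP j ξ) x y z)) =
      ∫ ξ, ((Real.exp x - Real.exp y) * (Real.exp y - Real.exp z) : ℂ) *
          (β ξ * Complex.exp (expP j ξ * x + expQ ξ * y) -
            β ξ * Complex.exp (expP j ξ * z + expQ ξ * y) +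
            (β ξ * Complex.exp (expP j ξ * y + expQ ξ * x) -
              β ξ * Complex.exp (expP j ξ * y + expQ ξ * z))) -
        (Real.exp x - Real.exp z) * (Real.exp x - Real.exp y) *
          (β ξ * Complex.exp (expP j ξ * y + expQ ξ * x) -
            β ξ * Complex.exp (expP j ξ * z + expQ ξ * x) +
            (β ξ * Complex.exp (expP j ξ * x + expQ ξ * y) -
              β ξ * Complex.exp (expP j ξ * x + expQ ξ * z))) -
        (Real.exp x - Real.exp z) * (Real.exp y - Real.exp z) *
          (β ξ * Complex.exp (expP j ξ * x + expQ ξ * z) -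
            β ξ * Complex.exp (expP j ξ * y + expQ ξ * z) +
            (β ξ * Complex.exp (expP j ξ * z + expQ ξ * x) -
              β ξ * Complex.exp (expP j ξ * z + expQ ξ * y))) := by
    refine integral_congr_ae (Eventually.of_forall fun ξ => ?_)
    simp only []
    rw [mul_left_comm, varSymbol_add_of_ne hxy hyz hxz]
    ring
  have ryx : |x - y| ≤ R := by rwa [abs_sub_comm]
  have rzy : |y - z| ≤ R := by rwa [abs_sub_comm]
  have rzx : |x - z| ≤ R := by rwa [abs_sub_comm]
  have I4 := fun a b c d e f g k : ℝ => integrable_alternating (I a b) (I c d) (I e f) (I g k)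
  rw [← integral_const_mul, hl, integral_mul_sub_mul_sub_mul (I4 _ _ _ _ _ _ _ _)
    (I4 _ _ _ _ _ _ _ _) (I4 _ _ _ _ _ _ _ _),
    integral_alternating (I _ _) (I _ _) (I _ _) (I _ _),
    integral_alternating (I _ _) (I _ _) (I _ _) (I _ _),
    integral_alternating (I _ _) (I _ _) (I _ _) (I _ _),
    hM rxy, hM ryz, hM rxz, hM ryx, hM rzy, hM rzx]
  have hom := opII_homogeneous (T := T) (Real.exp_pos x) (Real.exp_pos y) (Real.exp_pos z)
    (ne hxy) (ne hyz) (ne hxz) j (fun a b => ((a ^ j : ℝ) : ℂ) * T (b / a)) fun _ _ => rfl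
  rw [← hom, ← Real.exp_sub, ← Real.exp_sub, expDiff_of_ne _ hxy, expDiff_of_ne _ hyz,
    expDiff_of_ne _ hxz]
  simp only [one_mul, Complex.ofReal_exp]
  field_simp

/-- The symbol identity behind the variation formula. Coincident eigenvalues are reached as limits
of distinct ones, along `(x + t, y + 2t, z + 4t)`. -/
theorem integral_varSymbol (hβ : Integrable β) (hβ' : Integrable fun ξ => |ξ| * ‖β ξ‖) {R : ℝ}
    (hT : ∀ x : ℝ, |x| ≤ 2 * R + 1 →
      T (Real.exp x) = ∫ ξ : ℝ, β ξ * Complex.exp (-(Complex.I * (x * ξ))))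
    (hTs : ContDiffOn ℝ ∞ T (Ioi 0)) (j : ℝ) {x y z : ℝ}
    (hx : |x| ≤ R) (hy : |y| ≤ R) (hz : |z| ≤ R) :
    ∫ ξ, β ξ * (varSymbol (expP j ξ) (expQ ξ) x y z + varSymbol (expQ ξ) (expP j ξ) x y z) =
      expDiff 1 x z * (((Real.exp x ^ (j - 1) : ℝ) : ℂ) *
        (opII T j (Real.exp (y - x)) (Real.exp (z - y)) * (expDiff 1 x y * expDiff 1 y z))) := by
  let L : ℝ → ℂ := fun t => ∫ ξ, β ξ *
    (varSymbol (expP j ξ) (expQ ξ) (x + t) (y + 2 * t) (z + 4 * t) +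
      varSymbol (expQ ξ) (expP j ξ) (x + t) (y + 2 * t) (z + 4 * t))
  let Rt : ℝ → ℂ := fun t => expDiff 1 (x + t) (z + 4 * t) *
    (((Real.exp (x + t) ^ (j - 1) : ℝ) : ℂ) *
      (opII T j (Real.exp (y + 2 * t - (x + t))) (Real.exp (z + 4 * t - (y + 2 * t))) *
        (expDiff 1 (x + t) (y + 2 * t) * expDiff 1 (y + 2 * t) (z + 4 * t))))
  have hRt : Continuous Rt := by
    have h1 : Continuous fun t : ℝ => ((Real.exp (x + t) ^ (j - 1) : ℝ) : ℂ) :=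
      (contDiff_rpow_exp (j - 1) (contDiff_const.add contDiff_id)).continuous
    have h2 : Continuous fun t : ℝ =>
        opII T j (Real.exp (y + 2 * t - (x + t))) (Real.exp (z + 4 * t - (y + 2 * t))) :=
      (contDiff_opII_exp hTs j).continuous.comp
        (f := fun t : ℝ => (y + 2 * t - (x + t), z + 4 * t - (y + 2 * t))) (by fun_prop)
    fun_prop
  have hL : ContinuousAt L 0 := by
    refine continuousAt_of_dominated (bound := fun ξ =>
      ‖β ξ‖ * (3 * Real.exp (max 1 |j| * (R + 1)) ^ 4 * (|j| + 2 * |ξ|))) ?_ ?_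
      (integrable_bound hβ hβ' _ j) ?_
    · refine Eventually.of_forall fun t => hβ.1.mul (Continuous.aestronglyMeasurable ?_)
      simp only [varSymbol]
      fun_prop
    · have hnear : ∀ᶠ t : ℝ in 𝓝 0, |t| < 1 / 4 :=
        (continuous_abs.tendsto' (0 : ℝ) 0 abs_zero).eventually (gt_mem_nhds (by norm_num))
      filter_upwards [hnear] with t ht
      refine Eventually.of_forall fun ξ => ?_
      have b1 := (abs_le.1 hx)
      have b2 := (abs_le.1 hy)
      have b3 := (abs_le.1 hz)
      have b4 := abs_lt.1 ht
      rw [norm_mul]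
      refine mul_le_mul_of_nonneg_left (norm_varSymbol_add_le j ξ ?_ ?_ ?_) (norm_nonneg _) <;>
        rw [abs_le] <;> constructor <;> linarith
    · refine Eventually.of_forall fun ξ => Continuous.continuousAt ?_
      simp only [varSymbol]
      fun_prop
  have hev : ∀ᶠ t : ℝ in 𝓝[≠] 0, L t = Rt t := by
    have hne : ∀ a b : ℝ, ∀ m n : ℝ, m ≠ n → ∀ᶠ t : ℝ in 𝓝[≠] 0, a + m * t ≠ b + n * t := by
      intro a b m n hmn
      by_cases hab : a = b
      · filter_upwards [self_mem_nhdsWithin] with t ht h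
        have : (m - n) * t = 0 := by rw [hab] at h; linarith
        rcases mul_eq_zero.1 this with h | h
        · exact hmn (sub_eq_zero.1 h)
        · exact ht h
      · have hc : Tendsto (fun t : ℝ => a + m * t - (b + n * t)) (𝓝 0) (𝓝 (a - b)) :=
          Continuous.tendsto' (by fun_prop) _ _ (by simp)
        filter_upwards [(hc.eventually_ne (sub_ne_zero.2 hab)).filter_mono nhdsWithin_le_nhds]
          with t ht h
        exact ht (sub_eq_zero.2 h)
    have hnear : ∀ᶠ t : ℝ in 𝓝[≠] 0, |t| < 1 / 4 :=
      ((continuous_abs.tendsto' (0 : ℝ) 0 abs_zero).eventually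
        (gt_mem_nhds (by norm_num))).filter_mono nhdsWithin_le_nhds
    filter_upwards [hne x y 1 2 (by norm_num), hne y z 2 4 (by norm_num), hne x z 1 4 (by norm_num),
      hnear] with t h1 h2 h3 h4
    rw [one_mul] at h1 h3
    have b1 := (abs_le.1 hx)
    have b2 := (abs_le.1 hy)
    have b3 := (abs_le.1 hz)
    have b4 := abs_lt.1 h4
    exact integral_varSymbol_of_ne hβ hT j h1 h2 h3
      (by rw [abs_le]; constructor <;> linarith) (by rw [abs_le]; constructor <;> linarith)
      (by rw [abs_le]; constructor <;> linarith)
  have hlim := tendsto_nhds_unique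
    ((hL.tendsto.mono_left nhdsWithin_le_nhds).congr' hev)
    ((hRt.tendsto 0).mono_left nhdsWithin_le_nhds)
  simpa [L, Rt] using hlim

end ScalarIdentity

/-! ### The operator identities -/

section OperatorIdentity

open NCTorus Filter Topology

variable {E : Type*} [NormedAddCommGroup E] [InnerProductSpace ℂ E] [CompleteSpace E]

local notation "𝓑" => E →L[ℂ] E

/-- The operator dual, under the trace, to the direction `a` in the part of the variation of
`φ₀(k^p ∇k k^q ∇k)` which contains no second derivatives, once symmetrized in `p` and `q`; `c` and
`d` are the derivatives of the logarithm `h` of `k`. -/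
noncomputable def varOp (c d : 𝓑) (p q : ℂ) (h : 𝓑) : 𝓑 :=
  duh h p (duh h 1 c * cexp q h * duh h 1 d) -
    duh h 1 (cexp q h * duh h 1 c * duh h p d) -
    duh h 1 (duh h p c * duh h 1 d * cexp q h)

@[fun_prop]
theorem continuous_varOp {X : Type*} [TopologicalSpace X] {c d h : X → 𝓑} {p q : X → ℂ}
    (hc : Continuous c) (hd : Continuous d) (hp : Continuous p) (hq : Continuous q)
    (hh : Continuous h) : Continuous fun x => varOp (c x) (d x) (p x) (q x) (h x) := by
  unfold varOp
  fun_prop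

theorem strongCont_varOp (c d : 𝓑) (p q : ℂ) (h : 𝓑) : StrongCont h (varOp c d p q) := by
  have C := fun p c => StrongCont.duh (h := h) p (StrongCont.const h c)
  have K := StrongCont.cexp h q
  exact (((((C 1 c).mul K).mul (C 1 d)).duh p).sub (((K.mul (C 1 c)).mul (C p d)).duh 1)).sub
    ((((C p c).mul (C 1 d)).mul K).duh 1)

theorem norm_varOp_le {h : 𝓑} (hh : IsSelfAdjoint h) {R A : ℝ} (hR : ‖h‖ ≤ R) (hA : 1 ≤ A)
    {p q : ℂ} (hp : |p.re| ≤ A) (hq : |q.re| ≤ A) (c d : 𝓑) :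
    ‖varOp c d p q h‖ ≤ 3 * Real.exp (A * R) ^ 7 * ‖c‖ * ‖d‖ * ‖p‖ := by
  have hone : |(1 : ℂ).re| ≤ A := by simpa using hA
  set W := Real.exp (A * R) with hW
  have hW0 : 0 < W := Real.exp_pos _
  have hexp : ∀ {r : ℂ}, |r.re| ≤ A → Real.exp (|r.re| * ‖h‖) ≤ W := fun hr =>
    Real.exp_le_exp.2 (mul_le_mul hr hR (norm_nonneg _) ((abs_nonneg _).trans hr))
  have hk : ‖cexp q h‖ ≤ W := (norm_cexp_le hh q).trans (hexp hq)
  have hD : ∀ {r : ℂ} (X : 𝓑), |r.re| ≤ A → ‖duh h r X‖ ≤ ‖r‖ * (W ^ 2 * ‖X‖) := fun X hr => by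
    refine (norm_duh_le hh _ X).trans ?_
    have := hexp hr
    gcongr
  have hD1 : ∀ X : 𝓑, ‖duh h 1 X‖ ≤ W ^ 2 * ‖X‖ := fun X => by simpa using hD X hone
  have hmul : ∀ {X Y Z : 𝓑} {x y z : ℝ}, ‖X‖ ≤ x → ‖Y‖ ≤ y → ‖Z‖ ≤ z → ‖X * Y * Z‖ ≤ x * y * z :=
    fun hx hy hz => by
      have hx0 := (norm_nonneg _).trans hx
      have hy0 := (norm_nonneg _).trans hy
      exact (norm_mul_le _ _).trans (mul_le_mul ((norm_mul_le _ _).trans (mul_le_mul hx hy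
        (norm_nonneg _) hx0)) hz (norm_nonneg _) (mul_nonneg hx0 hy0))
  have k1 : ‖duh h p (duh h 1 c * cexp q h * duh h 1 d)‖ ≤ W ^ 7 * ‖c‖ * ‖d‖ * ‖p‖ := by
    calc _ ≤ ‖p‖ * (W ^ 2 * (W ^ 2 * ‖c‖ * W * (W ^ 2 * ‖d‖))) :=
          (hD _ hp).trans (by gcongr; exact hmul (hD1 c) hk (hD1 d))
      _ = _ := by ring
  have k2 : ‖duh h 1 (cexp q h * duh h 1 c * duh h p d)‖ ≤ W ^ 7 * ‖c‖ * ‖d‖ * ‖p‖ := by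
    calc _ ≤ W ^ 2 * (W * (W ^ 2 * ‖c‖) * (‖p‖ * (W ^ 2 * ‖d‖))) :=
          (hD1 _).trans (by gcongr; exact hmul hk (hD1 c) (hD d hp))
      _ = _ := by ring
  have k3 : ‖duh h 1 (duh h p c * duh h 1 d * cexp q h)‖ ≤ W ^ 7 * ‖c‖ * ‖d‖ * ‖p‖ := by
    calc _ ≤ W ^ 2 * (‖p‖ * (W ^ 2 * ‖c‖) * (W ^ 2 * ‖d‖) * W) :=
          (hD1 _).trans (by gcongr; exact hmul (hD c hp) (hD1 d) hk)
      _ = _ := by ring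
  rw [varOp]
  refine (norm_sub_le _ _).trans ((add_le_add_left (norm_sub_le _ _) _).trans ?_)
  linarith

namespace SpectralResolution

variable {k : E →L[ℂ] E} {R : ℝ} (S : SpectralResolution k R)

theorem compress_mul_of_compress {A B c d : 𝓑} {i j : S.ι} {a b : S.ι → ℂ}
    (hA : ∀ m, S.P i * A * S.P m = a m • (S.P i * c * S.P m))
    (hB : ∀ m, S.P m * B * S.P j = b m • (S.P m * d * S.P j)) :
    S.P i * (A * B) * S.P j = ∑ m, (a m * b m) • (S.P i * c * S.P m * d * S.P j) := by
  rw [S.mul_eq_sum A B, Finset.mul_sum, Finset.sum_mul]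
  refine Finset.sum_congr rfl fun m _ => ?_
  calc _ = (S.P i * A * S.P m) * B * S.P j := by noncomm_ring
    _ = a m • (S.P i * c * (S.P m * B * S.P j)) := by
      rw [hA, smul_mul_assoc, smul_mul_assoc]
      noncomm_ring
    _ = _ := by
      rw [hB, mul_smul_comm, smul_smul]
      noncomm_ring

theorem compress_mul_cexp {X Y : 𝓑} {i m : S.ι} {a : ℂ} (q : ℂ)
    (hX : S.P i * X * S.P m = a • (S.P i * Y * S.P m)) :
    S.P i * (X * cexp q k) * S.P m = (a * Complex.exp (q * S.x m)) • (S.P i * Y * S.P m) := by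
  calc _ = S.P i * X * (cexp q k * S.P m) := by noncomm_ring
    _ = _ := by rw [S.cexp_mul, mul_smul_comm, hX, smul_smul, mul_comm]

theorem compress_cexp_mul {X Y : 𝓑} {i m : S.ι} {a : ℂ} (q : ℂ)
    (hX : S.P i * X * S.P m = a • (S.P i * Y * S.P m)) :
    S.P i * (cexp q k * X) * S.P m = (Complex.exp (q * S.x i) * a) • (S.P i * Y * S.P m) := by
  calc _ = (S.P i * cexp q k) * X * S.P m := by noncomm_ring
    _ = _ := by rw [S.mul_cexp, smul_mul_assoc, smul_mul_assoc, hX, smul_smul]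

theorem compress_varOp (c d : 𝓑) (p q : ℂ) (i j : S.ι) :
    S.P i * varOp c d p q k * S.P j = ∑ m, varSymbol p q (S.x i) (S.x m) (S.x j) •
      (S.P i * c * S.P m * d * S.P j) := by
  have h1 := S.compress_mul_of_compress (i := i) (j := j)
    (fun m => S.compress_mul_cexp q (S.compress_duh i m 1 c)) fun m => S.compress_duh m j 1 d
  have h2 := S.compress_mul_of_compress (i := i) (j := j)
    (fun m => S.compress_cexp_mul q (S.compress_duh i m 1 c)) fun m => S.compress_duh m j p d
  have h3 := S.compress_mul_of_compress (i := i) (j := j)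
    (fun m => S.compress_duh i m p c) fun m =>
      S.compress_mul_cexp q (S.compress_duh m j 1 d)
  rw [← mul_assoc (duh k p c)] at h3
  rw [varOp, mul_sub, mul_sub, sub_mul, sub_mul, S.compress_duh, S.compress_duh, S.compress_duh,
    h1, h2, h3, Finset.smul_sum, Finset.smul_sum, Finset.smul_sum, ← Finset.sum_sub_distrib,
    ← Finset.sum_sub_distrib]
  refine Finset.sum_congr rfl fun m _ => ?_
  rw [smul_smul, smul_smul, smul_smul, ← sub_smul, ← sub_smul, varSymbol]
  simp only [mul_assoc]

end SpectralResolution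

variable {β : ℝ → ℂ} {T : ℝ → ℂ}

theorem norm_varOp_expP_expQ_le {h : 𝓑} (hh : IsSelfAdjoint h) {R : ℝ} (hR : ‖h‖ ≤ R) (c d : 𝓑)
    (j ξ : ℝ) :
    ‖varOp c d (expP j ξ) (expQ ξ) h + varOp c d (expQ ξ) (expP j ξ) h‖ ≤
      3 * Real.exp (max 1 |j| * R) ^ 7 * ‖c‖ * ‖d‖ * (|j| + 2 * |ξ|) := by
  have hP : |(expP j ξ).re| ≤ max 1 |j| := by rw [expP_re]; exact le_max_right _ _
  have hQ : |(expQ ξ).re| ≤ max 1 |j| := by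
    rw [expQ_re, abs_zero]; exact zero_le_one.trans (le_max_left _ _)
  have n1 := norm_varOp_le hh hR (le_max_left 1 |j|) hP hQ c d
  have n2 := norm_varOp_le hh hR (le_max_left 1 |j|) hQ hP c d
  have n3 := norm_expP_le j ξ
  rw [norm_expQ] at n2
  calc _ ≤ 3 * Real.exp (max 1 |j| * R) ^ 7 * ‖c‖ * ‖d‖ * (|j| + |ξ|) +
        3 * Real.exp (max 1 |j| * R) ^ 7 * ‖c‖ * ‖d‖ * |ξ| := by
        refine (norm_add_le _ _).trans (add_le_add ?_ n2)
        exact n1.trans (mul_le_mul_of_nonneg_left n3 (by positivity))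
    _ = _ := by ring

theorem aestronglyMeasurable_smul_varOp (hβ : Integrable β) (c d : 𝓑) (j : ℝ) (h : 𝓑) :
    AEStronglyMeasurable fun ξ =>
      β ξ • (varOp c d (expP j ξ) (expQ ξ) h + varOp c d (expQ ξ) (expP j ξ) h) :=
  hβ.1.smul (Continuous.aestronglyMeasurable (by fun_prop))

theorem integrable_smul_varOp (hβ : Integrable β) (hβ' : Integrable fun ξ => |ξ| * ‖β ξ‖) {h : 𝓑}
    (hh : IsSelfAdjoint h) (c d : 𝓑) (j : ℝ) :
    Integrable fun ξ =>
      β ξ • (varOp c d (expP j ξ) (expQ ξ) h + varOp c d (expQ ξ) (expP j ξ) h) := by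
  refine (integrable_bound hβ hβ' (3 * Real.exp (max 1 |j| * ‖h‖) ^ 7 * ‖c‖ * ‖d‖) j).mono'
    (aestronglyMeasurable_smul_varOp hβ c d j h)
    (Eventually.of_forall fun ξ => ?_)
  rw [norm_smul]
  exact mul_le_mul_of_nonneg_left (norm_varOp_expP_expQ_le hh le_rfl c d j ξ) (norm_nonneg _)

/-- The part of the variation without second derivatives is given by the two-variable calculus with
spectral function `∑ II`. -/
theorem integral_varOp [TopologicalSpace.SeparableSpace E] (hβ : Integrable β)
    (hβ' : Integrable fun ξ => |ξ| * ‖β ξ‖) {h : 𝓑} (hh : IsSelfAdjoint h)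
    (hT : ∀ x : ℝ, |x| ≤ 2 * ‖h‖ + 1 →
      T (Real.exp x) = ∫ ξ : ℝ, β ξ * Complex.exp (-(Complex.I * (x * ξ))))
    (hTs : ContDiffOn ℝ ∞ T (Ioi 0)) (j : ℝ) {γ : ℝ × ℝ → ℂ} (hγ : Integrable γ)
    (hγT : ∀ x₁ x₂ : ℝ, |x₁| ≤ 2 * ‖h‖ → |x₂| ≤ 2 * ‖h‖ →
      opII T j (Real.exp x₁) (Real.exp x₂) =
        ∫ ξ : ℝ × ℝ, γ ξ * Complex.exp (-(Complex.I * (x₁ * ξ.1 + x₂ * ξ.2)))) (c d : 𝓑) :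
    ∫ ξ, β ξ • (varOp c d (expP j ξ) (expQ ξ) h + varOp c d (expQ ξ) (expP j ξ) h) =
      duh h 1 (cexp ((j - 1 : ℝ) : ℂ) h * modInt₂ γ (duh h 1 c) (duh h 1 d) h) := by
  have hl : StrongCont h fun k =>
      ∫ ξ, β ξ • (varOp c d (expP j ξ) (expQ ξ) k + varOp c d (expQ ξ) (expP j ξ) k) := by
    refine StrongCont.integral hh
      (integrable_bound hβ hβ' (3 * Real.exp (max 1 |j| * ‖h‖) ^ 7 * ‖c‖ * ‖d‖) j)
      (aestronglyMeasurable_smul_varOp hβ c d j) (fun k hk hkh ξ => ?_)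
      fun ξ => ((strongCont_varOp c d _ _ h).add (strongCont_varOp c d _ _ h)).smul _
    rw [norm_smul]
    exact mul_le_mul_of_nonneg_left (norm_varOp_expP_expQ_le hk hkh c d j ξ) (norm_nonneg _)
  have hr : StrongCont h fun k =>
      duh k 1 (cexp ((j - 1 : ℝ) : ℂ) k * modInt₂ γ (duh k 1 c) (duh k 1 d) k) := by
    have hb : ∀ X k : 𝓑, IsSelfAdjoint k → ‖k‖ ≤ ‖h‖ →
        ‖duh k 1 X‖ ≤ Real.exp ‖h‖ ^ 2 * ‖X‖ := fun X k hk hkh => by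
      have := norm_duh_le hk 1 X
      rw [norm_one, one_mul, Complex.one_re, abs_one, one_mul] at this
      exact this.trans (by gcongr)
    exact ((StrongCont.cexp h _).mul (strongCont_modInt₂ hγ hh
      ((StrongCont.const h c).duh 1) ((StrongCont.const h d).duh 1) (hb c) (hb d))).duh 1
  refine StrongCont.eq_of_resolution hh hl hr fun k hk hkh S => S.ext_of_compress fun i m => ?_
  rw [mul_integral_mul _ _ (integrable_smul_varOp hβ hβ' hk c d j), S.compress_duh]
  have hmod : S.P i * modInt₂ γ (duh k 1 c) (duh k 1 d) k * S.P m =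
      ∑ n, (opII T j (Real.exp (S.x n - S.x i)) (Real.exp (S.x m - S.x n)) *
        (expDiff 1 (S.x i) (S.x n) * expDiff 1 (S.x n) (S.x m))) •
          (S.P i * c * S.P n * d * S.P m) := by
    rw [S.compress_modInt₂ hk hγ]
    refine Finset.sum_congr rfl fun n _ => ?_
    rw [← hγT _ _ (S.abs_sub_le i n) (S.abs_sub_le n m)]
    have h1 : S.P i * duh k 1 c * S.P n * duh k 1 d * S.P m =
        (expDiff 1 (S.x i) (S.x n) * expDiff 1 (S.x n) (S.x m)) •
          (S.P i * c * S.P n * d * S.P m) := by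
      rw [S.compress_duh, smul_mul_assoc, smul_mul_assoc, mul_smul]
      congr 1
      calc _ = S.P i * c * (S.P n * duh k 1 d * S.P m) := by noncomm_ring
        _ = _ := by
          rw [S.compress_duh, mul_smul_comm]
          noncomm_ring
    rw [h1, smul_smul]
  have hexp : S.P i * (cexp ((j - 1 : ℝ) : ℂ) k * modInt₂ γ (duh k 1 c) (duh k 1 d) k) * S.P m =
      ((Real.exp (S.x i) ^ (j - 1) : ℝ) : ℂ) •
        (S.P i * modInt₂ γ (duh k 1 c) (duh k 1 d) k * S.P m) := by
    calc _ = (S.P i * cexp ((j - 1 : ℝ) : ℂ) k) * modInt₂ γ (duh k 1 c) (duh k 1 d) k * S.P m := by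
          noncomm_ring
      _ = _ := by
        rw [S.mul_cexp, smul_mul_assoc, smul_mul_assoc, ← Real.exp_mul, mul_comm (S.x i),
          Complex.ofReal_exp, Complex.ofReal_mul]
  have hint : ∀ n, Integrable fun ξ => (β ξ *
      (varSymbol (expP j ξ) (expQ ξ) (S.x i) (S.x n) (S.x m) +
        varSymbol (expQ ξ) (expP j ξ) (S.x i) (S.x n) (S.x m))) •
          (S.P i * c * S.P n * d * S.P m) := by
    intro n
    refine Integrable.smul_const ?_ _
    refine (integrable_bound hβ hβ' (3 * Real.exp (max 1 |j| * ‖h‖) ^ 4) j).mono'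
      (hβ.1.mul (Continuous.aestronglyMeasurable ?_)) (Eventually.of_forall fun ξ => ?_)
    · simp only [varSymbol]
      fun_prop
    · rw [norm_mul]
      exact mul_le_mul_of_nonneg_left (norm_varSymbol_add_le j ξ (S.abs_le i) (S.abs_le n)
        (S.abs_le m)) (norm_nonneg _)
  rw [hexp, hmod, Finset.smul_sum, Finset.smul_sum]
  simp only [mul_smul_comm, smul_mul_assoc, mul_add, add_mul, S.compress_varOp,
    ← Finset.sum_add_distrib, Finset.smul_sum, ← add_smul, smul_smul]
  simp only [← mul_add]
  rw [integral_finsetSum _ fun n _ => hint n]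
  refine Finset.sum_congr rfl fun n _ => ?_
  rw [integral_smul_const, integral_varSymbol hβ hβ' hT hTs j (S.abs_le i) (S.abs_le n)
    (S.abs_le m)]

theorem norm_cexp_expP_le {k : 𝓑} (hk : IsSelfAdjoint k) {R : ℝ} (hR : ‖k‖ ≤ R) (j ξ : ℝ) :
    ‖cexp (expP j ξ) k‖ ≤ Real.exp (|j| * R) := by
  refine (norm_cexp_le hk _).trans ?_
  rw [expP_re]
  gcongr

theorem norm_cexp_expQ_le {k : 𝓑} (hk : IsSelfAdjoint k) (ξ : ℝ) : ‖cexp (expQ ξ) k‖ ≤ 1 :=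
  norm_cexp_imag_le hk (expQ_re ξ)

theorem norm_smul_neg_cexp_le {h k : 𝓑} (hk : IsSelfAdjoint k) (hkh : ‖k‖ ≤ ‖h‖) (ρ : 𝓑)
    (j ξ : ℝ) (c : ℂ) :
    ‖c • -(cexp (expP j ξ) k * ρ * cexp (expQ ξ) k + cexp (expQ ξ) k * ρ * cexp (expP j ξ) k)‖ ≤
      ‖c‖ * (2 * (Real.exp (|j| * ‖h‖) * ‖ρ‖)) := by
  have hP := norm_cexp_expP_le hk hkh j ξ
  have hQ := norm_cexp_expQ_le hk ξ
  rw [norm_smul, norm_neg]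
  refine mul_le_mul_of_nonneg_left ?_ (norm_nonneg _)
  calc _ ≤ ‖cexp (expP j ξ) k‖ * ‖ρ‖ * ‖cexp (expQ ξ) k‖ +
        ‖cexp (expQ ξ) k‖ * ‖ρ‖ * ‖cexp (expP j ξ) k‖ :=
        (norm_add_le _ _).trans (add_le_add norm_mul₃_le norm_mul₃_le)
    _ ≤ Real.exp (|j| * ‖h‖) * ‖ρ‖ * 1 + 1 * ‖ρ‖ * Real.exp (|j| * ‖h‖) := by gcongr
    _ = _ := by ring

theorem aestronglyMeasurable_smul_neg_cexp (hβ : Integrable β) (ρ : 𝓑) (j : ℝ) (k : 𝓑) :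
    AEStronglyMeasurable fun ξ => β ξ •
      -(cexp (expP j ξ) k * ρ * cexp (expQ ξ) k + cexp (expQ ξ) k * ρ * cexp (expP j ξ) k) :=
  hβ.1.smul (Continuous.aestronglyMeasurable (by fun_prop))

theorem integrable_smul_neg_cexp (hβ : Integrable β) {h : 𝓑} (hh : IsSelfAdjoint h) (ρ : 𝓑)
    (j : ℝ) : Integrable fun ξ => β ξ •
      -(cexp (expP j ξ) h * ρ * cexp (expQ ξ) h + cexp (expQ ξ) h * ρ * cexp (expP j ξ) h) :=
  (hβ.norm.mul_const (2 * (Real.exp (|j| * ‖h‖) * ‖ρ‖))).mono'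
    (aestronglyMeasurable_smul_neg_cexp hβ ρ j h)
    (Eventually.of_forall fun ξ => norm_smul_neg_cexp_le hh le_rfl ρ j ξ (β ξ))

/-- The part of the variation with second derivatives is given by the one-variable calculus with
spectral function `∑ I`. -/
theorem integral_cexp_mul_mul_cexp [TopologicalSpace.SeparableSpace E] (hβ : Integrable β) {h : 𝓑}
    (hh : IsSelfAdjoint h)
    (hT : ∀ x : ℝ, |x| ≤ 2 * ‖h‖ →
      T (Real.exp x) = ∫ ξ : ℝ, β ξ * Complex.exp (-(Complex.I * (x * ξ)))) (j : ℝ) {γ : ℝ → ℂ}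
    (hγ : Integrable γ) (hγT : ∀ x : ℝ, |x| ≤ 2 * ‖h‖ →
      opI T j (Real.exp x) = ∫ ξ : ℝ, γ ξ * Complex.exp (-(Complex.I * (x * ξ)))) (ρ : 𝓑) :
    ∫ ξ, β ξ •
        -(cexp (expP j ξ) h * ρ * cexp (expQ ξ) h + cexp (expQ ξ) h * ρ * cexp (expP j ξ) h) =
      cexp (j : ℂ) h * modInt₁ γ ρ h := by
  have K := fun z => StrongCont.cexp h z
  have hl := StrongCont.integral hh (hβ.norm.mul_const (2 * (Real.exp (|j| * ‖h‖) * ‖ρ‖)))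
    (aestronglyMeasurable_smul_neg_cexp hβ ρ j)
    (fun k hk hkh ξ => norm_smul_neg_cexp_le hk hkh ρ j ξ (β ξ)) fun ξ => by
    simpa only [neg_one_smul] using (((((K (expP j ξ)).mul (StrongCont.const h ρ)).mul
      (K (expQ ξ))).add (((K (expQ ξ)).mul (StrongCont.const h ρ)).mul
        (K (expP j ξ)))).smul (-1)).smul (β ξ)
  refine StrongCont.eq_of_resolution hh hl ((K j).mul (strongCont_modInt₁ hγ hh ρ))
    fun k hk hkh S => S.ext_of_compress fun i m => ?_
  have hL : ∀ ξ, S.P i * (β ξ • -(cexp (expP j ξ) k * ρ * cexp (expQ ξ) k +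
      cexp (expQ ξ) k * ρ * cexp (expP j ξ) k)) * S.P m =
      -(β ξ * Complex.exp (expP j ξ * S.x i + expQ ξ * S.x m) +
        β ξ * Complex.exp (expP j ξ * S.x m + expQ ξ * S.x i)) • (S.P i * ρ * S.P m) := fun ξ => by
    rw [mul_smul_comm, smul_mul_assoc, mul_neg, neg_mul, mul_add, add_mul, S.compress_cexp,
      S.compress_cexp, ← add_smul, smul_neg, smul_smul, neg_smul, mul_add,
      add_comm (expQ ξ * S.x i : ℂ)]
  have hR : S.P i * (cexp (j : ℂ) k * modInt₁ γ ρ k) * S.P m =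
      (((Real.exp (S.x i) ^ j : ℝ) : ℂ) * opI T j (Real.exp (S.x m - S.x i))) •
        (S.P i * ρ * S.P m) := by
    rw [← Real.exp_mul, mul_comm (S.x i), Complex.ofReal_exp, Complex.ofReal_mul]
    refine S.compress_cexp_mul (j : ℂ) ?_
    rw [S.compress_modInt₁ hk hγ, hγT _ (S.abs_sub_le i m)]
  rw [mul_integral_mul _ _ (integrable_smul_neg_cexp hβ hk ρ j), hR]
  simp only [hL]
  rw [integral_smul_const, integral_neg,
    integral_add (integrable_mul_exp hβ _ _ _) (integrable_mul_exp hβ _ _ _),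
    integral_mul_exp hT j (S.abs_sub_le i m), integral_mul_exp hT j (S.abs_sub_le m i)]
  congr 1
  simp only [opI, opI1, opI2, opInv, Real.exp_sub, inv_div]
  rw [Real.div_rpow (Real.exp_pos _).le (Real.exp_pos _).le]
  have : ((Real.exp (S.x i) ^ j : ℝ) : ℂ) ≠ 0 := by
    exact_mod_cast (Real.rpow_pos_of_pos (Real.exp_pos _) j).ne'
  push_cast
  field_simp
  ring

end OperatorIdentity

/-! ### Closed algebras of operators with a trace -/

section ClosedSubalgebra

variable {E : Type*} [NormedAddCommGroup E] [InnerProductSpace ℂ E] [CompleteSpace E]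

local notation "𝓑" => E →L[ℂ] E

variable {A : Subalgebra ℂ (E →L[ℂ] E)}

theorem integral_mem_of_isClosed (hA : IsClosed (A : Set 𝓑)) {Ω : Type*} [MeasurableSpace Ω]
    {μ : Measure Ω} {f : Ω → 𝓑} (hf : ∀ t, f t ∈ A) : ∫ t, f t ∂μ ∈ A := by
  by_cases hi : Integrable f μ
  · have : IsClosed (A.toSubmodule : Set 𝓑) := hA
    have h := A.toSubmodule.mkQL.integral_comp_comm hi
    have h0 : ∀ t, A.toSubmodule.mkQL (f t) = 0 := fun t =>
      (Submodule.Quotient.mk_eq_zero _).2 (hf t)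
    simp only [h0, integral_zero] at h
    exact (Submodule.Quotient.mk_eq_zero _).1 h.symm
  · rw [integral_undef hi]
    exact A.zero_mem

theorem cexp_mem (hA : IsClosed (A : Set 𝓑)) {h : 𝓑} (hh : h ∈ A) (z : ℂ) : cexp z h ∈ A :=
  hA.mem_of_tendsto (hasSum_cexp z h) (Filter.Eventually.of_forall fun _ =>
    A.sum_mem fun _ _ => A.smul_mem (A.pow_mem hh _) _)

theorem duh_mem (hA : IsClosed (A : Set 𝓑)) {h X : 𝓑} (hh : h ∈ A) (hX : X ∈ A) (p : ℂ) :
    duh h p X ∈ A := by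
  rw [duh, intervalIntegral.integral_of_le zero_le_one]
  exact integral_mem_of_isClosed hA fun s =>
    A.smul_mem (A.mul_mem (A.mul_mem (cexp_mem hA hh _) hX) (cexp_mem hA hh _)) _

theorem modInt₂_mem (hA : IsClosed (A : Set 𝓑)) {h ρ₁ ρ₂ : 𝓑} (hh : h ∈ A) (hρ₁ : ρ₁ ∈ A)
    (hρ₂ : ρ₂ ∈ A) (β : ℝ × ℝ → ℂ) : modInt₂ β ρ₁ ρ₂ h ∈ A :=
  integral_mem_of_isClosed hA fun _ => A.smul_mem (A.mul_mem
    (A.mul_mem (A.mul_mem (cexp_mem hA hh _) hρ₁) (cexp_mem hA hh _))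
    (A.mul_mem (A.mul_mem (cexp_mem hA hh _) hρ₂) (cexp_mem hA hh _))) _

/-- Moving `duh` across the trace: the substitution `s ↦ 1 - s` exchanges the two exponentials. -/
theorem trace_mul_duh (hA : IsClosed (A : Set 𝓑)) {φ : 𝓑 →L[ℂ] ℂ}
    (hφ : ∀ a ∈ A, ∀ b ∈ A, φ (a * b) = φ (b * a)) {h a X : 𝓑} (hh : h ∈ A) (ha : a ∈ A)
    (hX : X ∈ A) (p : ℂ) : φ (a * duh h p X) = φ (duh h p a * X) := by
  have hint : ∀ Y, IntervalIntegrable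
      (fun s : ℝ => p • (cexp ((1 - s) * p) h * Y * cexp (s * p) h)) volume 0 1 := fun Y =>
    Continuous.intervalIntegrable (by fun_prop) _ _
  have hl := ContinuousLinearMap.intervalIntegral_comp_comm
    (φ.comp ((ContinuousLinearMap.mul ℂ 𝓑) a)) (hint X)
  have hr := ContinuousLinearMap.intervalIntegral_comp_comm
    (φ.comp ((ContinuousLinearMap.mul ℂ 𝓑).flip X)) (hint a)
  have hl' : φ (a * duh h p X) = _ := hl.symm
  have hr' : φ (duh h p a * X) = _ := hr.symm
  have hsub := intervalIntegral.integral_comp_sub_left (a := 0) (b := 1)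
    (fun s : ℝ => φ (p • (cexp ((1 - s) * p) h * a * cexp (s * p) h) * X)) 1
  rw [sub_self, sub_zero] at hsub
  rw [hl', hr']
  refine Eq.trans ?_ hsub
  refine intervalIntegral.integral_congr fun s _ => ?_
  change φ (a * (p • (cexp ((1 - s) * p) h * X * cexp (s * p) h))) = _
  simp only [mul_smul_comm, smul_mul_assoc, map_smul]
  congr 1
  have h1 := hφ (a * cexp ((1 - s) * p) h * X)
    (A.mul_mem (A.mul_mem ha (cexp_mem hA hh _)) hX) _ (cexp_mem hA hh (s * p))
  calc _ = φ (a * cexp ((1 - s) * p) h * X * cexp (s * p) h) := by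
        congr 1
    _ = _ := h1
    _ = _ := by
      congr 1
      push_cast
      rw [sub_sub_cancel]
      noncomm_ring

end ClosedSubalgebra

/-! ### Trace-preserving actions and their generators -/

section SecondDerivative

theorem hasDerivAt_fderiv_apply {F : Type*} [NormedAddCommGroup F] [NormedSpace ℝ F] {f : F → F}
    (hf : ContDiff ℝ ∞ f) {γ v : ℝ → F} {γ' v' : F} {s : ℝ} (hγ : HasDerivAt γ γ' s)
    (hv : HasDerivAt v v' s) :
    HasDerivAt (fun s => fderiv ℝ f (γ s) (v s))
      (fderiv ℝ (fderiv ℝ f) (γ s) γ' (v s) + fderiv ℝ f (γ s) v') s := by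
  have hD : Differentiable ℝ (fderiv ℝ f) :=
    (hf.fderiv_right (m := ∞) (by simp)).differentiable (by simp)
  exact ((hD (γ s)).hasFDerivAt.comp_hasDerivAt s hγ).clm_apply hv

end SecondDerivative

section Rotation

variable {E : Type*} [NormedAddCommGroup E] [InnerProductSpace ℂ E] [CompleteSpace E]

local notation "𝓑" => E →L[ℂ] E

theorem hasDerivAt_add_ofReal_smul (x y : 𝓑) (s : ℝ) :
    HasDerivAt (fun ε : ℝ => x + (ε : ℂ) • y) y s := by
  have := (HasDerivAt.smul_const (Complex.ofRealCLM.hasDerivAt (x := s)) y).const_add x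
  rw [Complex.ofRealCLM_apply, Complex.ofReal_one, one_smul] at this
  exact this

/-- A group of inner automorphisms `a ↦ u_t a u_{-t}`, `t ∈ ℝ²`, of the bounded operators, which
preserves a norm closed algebra `A` and a bounded functional `φ` that is a trace on `A`. -/
structure TracialAction (E : Type*) [NormedAddCommGroup E] [InnerProductSpace ℂ E] where
  A : Subalgebra ℂ (E →L[ℂ] E)
  isClosed : IsClosed (A : Set (E →L[ℂ] E))
  φ : (E →L[ℂ] E) →L[ℂ] ℂ
  trace_comm : ∀ a ∈ A, ∀ b ∈ A, φ (a * b) = φ (b * a)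
  u : (Fin 2 → ℝ) → E →L[ℂ] E
  u_zero : u 0 = 1
  u_add : ∀ s t, u (s + t) = u s * u t
  conj_mem : ∀ t, ∀ a ∈ A, u t * a * u (-t) ∈ A
  trace_conj : ∀ t a, φ (u t * a * u (-t)) = φ a

namespace TracialAction

variable (S : TracialAction E) {h a b x y : E →L[ℂ] E}

theorem u_neg_mul (t : Fin 2 → ℝ) : S.u (-t) * S.u t = 1 := by
  rw [← S.u_add, neg_add_cancel, S.u_zero]

theorem u_mul_neg (t : Fin 2 → ℝ) : S.u t * S.u (-t) = 1 := by
  rw [← S.u_add, add_neg_cancel, S.u_zero]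

/-- The orbit `t ↦ u_t x u_{-t}`. -/
def orbit (x : 𝓑) (t : Fin 2 → ℝ) : 𝓑 := S.u t * x * S.u (-t)

/-- The infinitesimal generator of the action in the `l`-th direction. -/
noncomputable def nabla (l : Fin 2) (x : 𝓑) : 𝓑 := deriv (fun s : ℝ => S.orbit x (Pi.single l s)) 0

/-- The smooth vectors of the action. -/
def Smooth (x : 𝓑) : Prop := ContDiff ℝ ∞ (S.orbit x)

theorem orbit_zero (x : 𝓑) : S.orbit x 0 = x := by
  rw [orbit, neg_zero, S.u_zero, one_mul, mul_one]

theorem orbit_mul (x y : 𝓑) (t : Fin 2 → ℝ) : S.orbit (x * y) t = S.orbit x t * S.orbit y t := by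
  calc _ = S.u t * x * 1 * y * S.u (-t) := by rw [orbit]; noncomm_ring
    _ = _ := by rw [← S.u_neg_mul t, orbit, orbit]; noncomm_ring

theorem orbit_add (x y : 𝓑) (t : Fin 2 → ℝ) : S.orbit (x + y) t = S.orbit x t + S.orbit y t := by
  rw [orbit, orbit, orbit]; noncomm_ring

theorem orbit_smul (c : ℂ) (x : 𝓑) (t : Fin 2 → ℝ) : S.orbit (c • x) t = c • S.orbit x t := by
  rw [orbit, orbit, mul_smul_comm, smul_mul_assoc]

theorem orbit_orbit (x : 𝓑) (s t : Fin 2 → ℝ) : S.orbit (S.orbit x s) t = S.orbit x (t + s) := by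
  simp only [orbit, S.u_add, neg_add, mul_assoc]
  rw [← S.u_add, add_comm, S.u_add]

theorem orbit_cexp (z : ℂ) (x : 𝓑) (t : Fin 2 → ℝ) :
    S.orbit (cexp z x) t = cexp z (S.orbit x t) := by
  let _ : NormedAlgebra ℚ 𝓑 := NormedAlgebra.restrictScalars ℚ ℝ 𝓑
  have := NormedSpace.exp_units_conj (⟨S.u t, S.u (-t), S.u_mul_neg t, S.u_neg_mul t⟩ : 𝓑ˣ) (z • x)
  rw [cexp, cexp, ← orbit_smul]
  exact this.symm

theorem orbit_duh (h : 𝓑) (p : ℂ) (x : 𝓑) (t : Fin 2 → ℝ) :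
    S.orbit (duh h p x) t = duh (S.orbit h t) p (S.orbit x t) := by
  rw [orbit, duh, duh, intervalIntegral.integral_of_le zero_le_one,
    intervalIntegral.integral_of_le zero_le_one, mul_integral_mul _ _
      ((Continuous.intervalIntegrable (by fun_prop) 0 1).1)]
  refine integral_congr_ae (Filter.Eventually.of_forall fun s => ?_)
  change S.orbit _ t = _
  simp only [orbit_smul, orbit_mul, orbit_cexp]

namespace Smooth

variable {S}

theorem add (hx : S.Smooth x) (hy : S.Smooth y) : S.Smooth (x + y) := by
  unfold Smooth
  rw [funext (S.orbit_add x y)]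
  exact ContDiff.add hx hy

theorem smul (c : ℂ) (hx : S.Smooth x) : S.Smooth (c • x) := by
  unfold Smooth
  rw [funext (S.orbit_smul c x)]
  exact ContDiff.const_smul c hx

theorem mul (hx : S.Smooth x) (hy : S.Smooth y) : S.Smooth (x * y) := by
  unfold Smooth
  rw [funext (S.orbit_mul x y)]
  exact ContDiff.mul hx hy

theorem cexp (hx : S.Smooth x) (z : ℂ) : S.Smooth (cexp z x) := by
  unfold Smooth
  rw [funext (S.orbit_cexp z x)]
  exact contDiff_exp.comp (ContDiff.const_smul z hx)

theorem duh_one (hh : S.Smooth h) (hx : S.Smooth x) : S.Smooth (duh h 1 x) := by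
  have h1 : S.orbit (WeylVariation.duh h 1 x) =
      fun t => fderiv ℝ (NormedSpace.exp : 𝓑 → 𝓑) (S.orbit h t) (S.orbit x t) :=
    funext fun t => by rw [orbit_duh, fderiv_exp]
  unfold Smooth
  rw [h1]
  exact ((contDiff_exp.fderiv_right (m := ∞) (by simp)).comp hh).clm_apply hx

theorem hasDerivAt (hx : S.Smooth x) (l : Fin 2) :
    HasDerivAt (fun s : ℝ => S.orbit x (Pi.single l s)) (S.nabla l x) 0 := by
  have h1 : DifferentiableAt ℝ (fun s : ℝ => S.orbit x (Pi.single l s)) 0 :=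
    ((ContDiff.comp (g := S.orbit x) hx
      (contDiff_single (𝕜 := ℝ) (F' := fun _ : Fin 2 => ℝ) ∞ l)).differentiable (by simp)) 0
  exact h1.hasDerivAt

theorem orbit_nabla (hx : S.Smooth x) (l : Fin 2) (t : Fin 2 → ℝ) :
    S.orbit (S.nabla l x) t = fderiv ℝ (S.orbit x) t (Pi.single l 1) := by
  have h1 := ((ContinuousLinearMap.mulLeftRight ℂ 𝓑 (S.u t)
    (S.u (-t))).restrictScalars ℝ).hasFDerivAt.comp_hasDerivAt (0 : ℝ) (hx.hasDerivAt l)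
  have h2 : HasFDerivAt (S.orbit x) (fderiv ℝ (S.orbit x) t) (t + Pi.single l (0 : ℝ)) := by
    rw [Pi.single_zero, add_zero]
    exact (ContDiff.differentiable hx (by simp) t).hasFDerivAt
  have h3 : HasDerivAt (fun s : ℝ => t + Pi.single l s) (Pi.single l (1 : ℝ)) 0 := by
    refine HasDerivAt.const_add _ (hasDerivAt_pi.2 fun i => ?_)
    rcases eq_or_ne i l with rfl | hi
    · simp only [Pi.single_eq_same]
      exact hasDerivAt_id' (0 : ℝ)
    · simpa [Pi.single_eq_of_ne hi] using hasDerivAt_const (0 : ℝ) (0 : ℝ)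
  have h4 := h2.comp_hasDerivAt (0 : ℝ) h3
  have h5 : (S.orbit x ∘ fun s : ℝ => t + Pi.single l s) =
      fun s : ℝ => S.orbit (S.orbit x (Pi.single l s)) t := by
    funext s
    exact (S.orbit_orbit x _ t).symm
  rw [h5] at h4
  exact h1.unique h4

theorem nabla (hx : S.Smooth x) (l : Fin 2) : S.Smooth (S.nabla l x) := by
  unfold Smooth
  rw [funext (hx.orbit_nabla l)]
  exact (ContDiff.fderiv_right (m := ∞) hx (by simp)).clm_apply contDiff_const

theorem nabla_mul (hx : S.Smooth x) (hy : S.Smooth y) (l : Fin 2) :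
    S.nabla l (x * y) = S.nabla l x * y + x * S.nabla l y := by
  have h1 := (hx.hasDerivAt l).mul (hy.hasDerivAt l)
  simp only [Pi.single_zero, orbit_zero] at h1
  refine Eq.trans ?_ h1.deriv
  simp only [TracialAction.nabla, orbit_mul]
  rfl

theorem nabla_cexp (hx : S.Smooth x) (z : ℂ) (l : Fin 2) :
    S.nabla l (WeylVariation.cexp z x) = duh x z (S.nabla l x) := by
  have h1 := hasDerivAt_cexp_curve (hx.hasDerivAt l) z
  simp only [Pi.single_zero, orbit_zero] at h1
  refine Eq.trans ?_ h1.deriv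
  simp only [TracialAction.nabla, orbit_cexp]

theorem nabla_add_smul (hx : S.Smooth x) (hy : S.Smooth y) (c : ℂ) (l : Fin 2) :
    S.nabla l (x + c • y) = S.nabla l x + c • S.nabla l y := by
  have h1 := (hx.hasDerivAt l).add ((hy.hasDerivAt l).const_smul c)
  refine Eq.trans ?_ h1.deriv
  simp only [TracialAction.nabla, orbit_add, orbit_smul]
  rfl

theorem nabla_mem (hx : S.Smooth x) (hxA : x ∈ S.A) (l : Fin 2) : S.nabla l x ∈ S.A := by
  have h1 := (hx.hasDerivAt l).tendsto_slope_zero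
  refine S.isClosed.mem_of_tendsto h1 (Filter.Eventually.of_forall fun s => ?_)
  have h2 : S.orbit x (Pi.single l (0 + s)) - S.orbit x (Pi.single l 0) ∈ S.A :=
    S.A.sub_mem (S.conj_mem _ _ hxA) (S.conj_mem _ _ hxA)
  have := S.A.smul_mem h2 ((s⁻¹ : ℝ) : ℂ)
  rwa [Complex.coe_smul] at this

theorem trace_nabla (hx : S.Smooth x) (l : Fin 2) : S.φ (S.nabla l x) = 0 := by
  have h1 := (S.φ.restrictScalars ℝ).hasFDerivAt.comp_hasDerivAt (0 : ℝ) (hx.hasDerivAt l)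
  have h2 : (S.φ.restrictScalars ℝ ∘ fun s : ℝ => S.orbit x (Pi.single l s)) = fun _ => S.φ x :=
    funext fun s => S.trace_conj _ x
  rw [h2] at h1
  exact h1.unique (hasDerivAt_const _ _)

end Smooth

/-- The variation of `∇k` in a direction is the gradient of the variation of `k`, by the symmetry
of the second derivative of the exponential. -/
theorem hasDerivAt_fderiv_exp_nabla (hh : S.Smooth h) (ha : S.Smooth a) (l : Fin 2) :
    HasDerivAt (fun ε : ℝ => fderiv ℝ (NormedSpace.exp : 𝓑 → 𝓑) (h + (ε : ℂ) • a)
      (S.nabla l h + (ε : ℂ) • S.nabla l a)) (S.nabla l (duh h 1 a)) 0 := by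
  have h1 := hasDerivAt_fderiv_apply contDiff_exp (hasDerivAt_add_ofReal_smul h a 0)
    (hasDerivAt_add_ofReal_smul (S.nabla l h) (S.nabla l a) 0)
  have h2 := hasDerivAt_fderiv_apply contDiff_exp (hh.hasDerivAt l) (ha.hasDerivAt l)
  have h3 : (fun s : ℝ => fderiv ℝ (NormedSpace.exp : 𝓑 → 𝓑) (S.orbit h (Pi.single l s))
      (S.orbit a (Pi.single l s))) = fun s : ℝ => S.orbit (duh h 1 a) (Pi.single l s) :=
    funext fun s => by rw [orbit_duh, fderiv_exp]
  rw [h3] at h2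
  refine h1.congr_deriv ?_
  rw [show S.nabla l (duh h 1 a) = _ from h2.deriv, Pi.single_zero, orbit_zero, orbit_zero,
    Complex.ofReal_zero, zero_smul, zero_smul, add_zero, add_zero]
  congr 1
  exact (contDiff_exp (E := E)).contDiffAt.isSymmSndFDerivAt
    (by
      rw [minSmoothness_of_isRCLikeNormedField]
      exact WithTop.coe_le_coe.2 (le_top : (2 : ℕ∞) ≤ ⊤)) _ _

end TracialAction

end Rotation

/-! ### The variation of the functional -/

section Differentiation

open Filter Topology

variable {E : Type*} [NormedAddCommGroup E] [InnerProductSpace ℂ E] [CompleteSpace E]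

local notation "𝓑" => E →L[ℂ] E

/-- The derivative of `k^p G₁ k^q G₂` along a curve of logarithms `h` of `k` with velocity `a`. -/
noncomputable def prodDeriv (a : 𝓑) (p q : ℂ) (h G₁ G₂ G₁' G₂' : 𝓑) : 𝓑 :=
  duh h p a * G₁ * cexp q h * G₂ + cexp p h * G₁' * cexp q h * G₂ +
    cexp p h * G₁ * duh h q a * G₂ + cexp p h * G₁ * cexp q h * G₂'

theorem hasDerivAt_cexp_mul_cexp_mul {γ G₁ G₂ : ℝ → 𝓑} {a G₁' G₂' : 𝓑} {ε : ℝ}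
    (hγ : HasDerivAt γ a ε) (h₁ : HasDerivAt G₁ G₁' ε) (h₂ : HasDerivAt G₂ G₂' ε) (p q : ℂ) :
    HasDerivAt (fun ε => cexp p (γ ε) * G₁ ε * cexp q (γ ε) * G₂ ε)
      (prodDeriv a p q (γ ε) (G₁ ε) (G₂ ε) G₁' G₂') ε := by
  refine ((((hasDerivAt_cexp_curve hγ p).mul h₁).mul (hasDerivAt_cexp_curve hγ q)).mul
    h₂).congr_deriv ?_
  rw [prodDeriv]
  simp only [add_mul, Pi.mul_apply]

theorem norm_mul₄_le {X Y Z W : 𝓑} {x y z w : ℝ} (hX : ‖X‖ ≤ x) (hY : ‖Y‖ ≤ y) (hZ : ‖Z‖ ≤ z)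
    (hW : ‖W‖ ≤ w) : ‖X * Y * Z * W‖ ≤ x * y * z * w := by
  have hx0 := (norm_nonneg _).trans hX
  have hy0 := (norm_nonneg _).trans hY
  have hz0 := (norm_nonneg _).trans hZ
  refine (norm_mul_le _ _).trans (mul_le_mul (norm_mul₃_le.trans ?_) hW (norm_nonneg _)
    (by positivity))
  gcongr

theorem norm_prodDeriv_le {k : 𝓑} (hk : IsSelfAdjoint k) {R M : ℝ} (hR : ‖k‖ ≤ R)
    {G₁ G₂ G₁' G₂' : 𝓑} (h₁ : ‖G₁‖ ≤ M) (h₂ : ‖G₂‖ ≤ M) (h₁' : ‖G₁'‖ ≤ M) (h₂' : ‖G₂'‖ ≤ M)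
    (a : 𝓑) (j ξ : ℝ) :
    ‖prodDeriv a (expP j ξ) (expQ ξ) k G₁ G₂ G₁' G₂'‖ ≤
      Real.exp (|j| * R) ^ 2 * ‖a‖ * M ^ 2 * (|j| + 2 * |ξ|) + 2 * Real.exp (|j| * R) * M ^ 2 := by
  set W := Real.exp (|j| * R) with hW
  have hW1 : 1 ≤ W := Real.one_le_exp (mul_nonneg (abs_nonneg _) ((norm_nonneg _).trans hR))
  have hM := (norm_nonneg _).trans h₁
  have hP := norm_cexp_expP_le hk hR j ξ
  have hQ := norm_cexp_expQ_le hk ξ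
  have dP : ‖duh k (expP j ξ) a‖ ≤ (|j| + |ξ|) * (W ^ 2 * ‖a‖) := by
    refine (norm_duh_le hk _ a).trans ?_
    have h1 := norm_expP_le j ξ
    have h2 : Real.exp (|j| * ‖k‖) ≤ W := by rw [hW]; gcongr
    rw [expP_re]
    gcongr
  have dQ : ‖duh k (expQ ξ) a‖ ≤ |ξ| * ‖a‖ := by
    refine (norm_duh_le hk _ a).trans ?_
    rw [expQ_re, norm_expQ, abs_zero, zero_mul, Real.exp_zero, one_pow, one_mul]
  rw [prodDeriv]
  calc _ ≤ (|j| + |ξ|) * (W ^ 2 * ‖a‖) * M * 1 * M + W * M * 1 * M + W * M * (|ξ| * ‖a‖) * M +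
        W * M * 1 * M :=
        (norm_add_le _ _).trans (add_le_add ((norm_add_le _ _).trans (add_le_add
          ((norm_add_le _ _).trans (add_le_add (norm_mul₄_le dP h₁ hQ h₂)
            (norm_mul₄_le hP h₁' hQ h₂))) (norm_mul₄_le hP h₁ dQ h₂)))
              (norm_mul₄_le hP h₁ hQ h₂'))
    _ ≤ (|j| + |ξ|) * (W ^ 2 * ‖a‖) * M * 1 * M + W * M * 1 * M + W ^ 2 * M * (|ξ| * ‖a‖) * M +
        W * M * 1 * M := by
        have : W ≤ W ^ 2 := by nlinarith
        gcongr
    _ = _ := by ring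

variable {β : ℝ → ℂ}

/-- Differentiation under the integral sign; the bound grows linearly in `ξ`, so `ξ β(ξ)` has to
be integrable. -/
theorem hasDerivAt_integral_cexp_mul_cexp_mul (hβ : Integrable β)
    (hβ' : Integrable fun ξ => |ξ| * ‖β ξ‖) {h a : 𝓑} (hh : IsSelfAdjoint h)
    (ha : IsSelfAdjoint a) {G₁ G₂ : ℝ → 𝓑} (h₁ : ContDiff ℝ ∞ G₁) (h₂ : ContDiff ℝ ∞ G₂)
    (j : ℝ) :
    Integrable (fun ξ => β ξ • prodDeriv a (expP j ξ) (expQ ξ) h (G₁ 0) (G₂ 0) (deriv G₁ 0)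
      (deriv G₂ 0)) ∧
    HasDerivAt (fun ε : ℝ => ∫ ξ, β ξ • (cexp (expP j ξ) (h + (ε : ℂ) • a) * G₁ ε *
        cexp (expQ ξ) (h + (ε : ℂ) • a) * G₂ ε))
      (∫ ξ, β ξ • prodDeriv a (expP j ξ) (expQ ξ) h (G₁ 0) (G₂ 0) (deriv G₁ 0) (deriv G₂ 0)) 0 := by
  obtain ⟨M, hM⟩ : ∃ M, ∀ ε ∈ Icc (-1 : ℝ) 1, ‖G₁ ε‖ ≤ M ∧ ‖G₂ ε‖ ≤ M ∧ ‖deriv G₁ ε‖ ≤ M ∧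
      ‖deriv G₂ ε‖ ≤ M := by
    have key : ∀ f : ℝ → 𝓑, Continuous f → ∃ M, ∀ ε ∈ Icc (-1 : ℝ) 1, ‖f ε‖ ≤ M := fun f hf =>
      isCompact_Icc.exists_bound_of_continuousOn hf.continuousOn
    obtain ⟨M₁, b₁⟩ := key G₁ h₁.continuous
    obtain ⟨M₂, b₂⟩ := key G₂ h₂.continuous
    obtain ⟨M₃, b₃⟩ := key (deriv G₁) (h₁.continuous_deriv (by simp))
    obtain ⟨M₄, b₄⟩ := key (deriv G₂) (h₂.continuous_deriv (by simp))
    exact ⟨max (max M₁ M₂) (max M₃ M₄), fun ε hε =>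
      ⟨(b₁ ε hε).trans (by simp), (b₂ ε hε).trans (by simp), (b₃ ε hε).trans (by simp),
        (b₄ ε hε).trans (by simp)⟩⟩
  have hsa : ∀ ε : ℝ, IsSelfAdjoint (h + (ε : ℂ) • a) := fun ε =>
    hh.add (IsSelfAdjoint.smul (Complex.conj_ofReal ε) ha)
  have hnorm : ∀ ε ∈ Metric.ball (0 : ℝ) 1, ‖h + (ε : ℂ) • a‖ ≤ ‖h‖ + ‖a‖ := fun ε hε => by
    refine (norm_add_le _ _).trans (add_le_add_right ?_ _)
    rw [norm_smul, Complex.norm_real]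
    rw [mem_ball_zero_iff] at hε
    exact mul_le_of_le_one_left (norm_nonneg _) hε.le
  have hIcc : ∀ ε ∈ Metric.ball (0 : ℝ) 1, ε ∈ Icc (-1 : ℝ) 1 := fun ε hε =>
    abs_le.1 (mem_ball_zero_iff.1 hε).le
  have h0 : h + ((0 : ℝ) : ℂ) • a = h := by simp
  have hball : Metric.ball (0 : ℝ) 1 ∈ 𝓝 (0 : ℝ) := Metric.ball_mem_nhds 0 one_pos
  have hmain := hasDerivAt_integral_of_dominated_loc_of_deriv_le (𝕜 := ℝ) (μ := volume)
    (F := fun (ε : ℝ) ξ => β ξ • (cexp (expP j ξ) (h + (ε : ℂ) • a) * G₁ ε *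
        cexp (expQ ξ) (h + (ε : ℂ) • a) * G₂ ε))
    (F' := fun (ε : ℝ) ξ => β ξ • prodDeriv a (expP j ξ) (expQ ξ) (h + (ε : ℂ) • a) (G₁ ε) (G₂ ε)
      (deriv G₁ ε) (deriv G₂ ε))
    (bound := fun ξ => ‖β ξ‖ * (Real.exp (|j| * (‖h‖ + ‖a‖)) ^ 2 * ‖a‖ * M ^ 2 * (|j| + 2 * |ξ|)) +
      ‖β ξ‖ * (2 * Real.exp (|j| * (‖h‖ + ‖a‖)) * M ^ 2)) (x₀ := (0 : ℝ)) hball ?_ ?_ ?_ ?_ ?_ ?_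
  · simp only [h0] at hmain
    exact hmain
  · exact Eventually.of_forall fun ε => hβ.1.smul (Continuous.aestronglyMeasurable (by fun_prop))
  · have m0 := hM 0 (by norm_num)
    refine (hβ.norm.mul_const (Real.exp (|j| * ‖h‖) * M * 1 * M)).mono'
      (hβ.1.smul (Continuous.aestronglyMeasurable (by fun_prop))) (Eventually.of_forall fun ξ => ?_)
    rw [norm_smul, h0]
    exact mul_le_mul_of_nonneg_left (norm_mul₄_le (norm_cexp_expP_le hh le_rfl j ξ) m0.1
      (norm_cexp_expQ_le hh ξ) m0.2.1) (norm_nonneg _)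
  · refine hβ.1.smul (Continuous.aestronglyMeasurable ?_)
    simp only [prodDeriv]
    fun_prop
  · refine Eventually.of_forall fun ξ ε hε => ?_
    have m := hM ε (hIcc ε hε)
    rw [norm_smul, ← mul_add]
    exact mul_le_mul_of_nonneg_left (norm_prodDeriv_le (hsa ε) (hnorm ε hε) m.1 m.2.1 m.2.2.1
      m.2.2.2 a j ξ) (norm_nonneg _)
  · exact (integrable_bound hβ hβ' _ j).add (hβ.norm.mul_const _)
  · exact Eventually.of_forall fun ξ ε _ => (hasDerivAt_cexp_mul_cexp_mul
      (hasDerivAt_add_ofReal_smul h a ε) (h₁.differentiable (by simp) ε).hasDerivAt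
      (h₂.differentiable (by simp) ε).hasDerivAt _ _).const_smul (β ξ)

namespace TracialAction

variable (S : TracialAction E) {h a : E →L[ℂ] E}

/-- The trace of the derivative of `k^p ∇_l k k^q ∇_m k`, after integration by parts. -/
theorem trace_prodDeriv (hh : S.Smooth h) (ha : S.Smooth a) (hA : h ∈ S.A) (aA : a ∈ S.A)
    (p q : ℂ) (l m : Fin 2) :
    S.φ (prodDeriv a p q h (duh h 1 (S.nabla l h)) (duh h 1 (S.nabla m h))
        (S.nabla l (duh h 1 a)) (S.nabla m (duh h 1 a))) =
      S.φ (a * duh h p (duh h 1 (S.nabla l h) * cexp q h * duh h 1 (S.nabla m h))) +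
      S.φ (a * duh h q (duh h 1 (S.nabla m h) * cexp p h * duh h 1 (S.nabla l h))) -
      S.φ (a * duh h 1 (cexp q h * duh h 1 (S.nabla m h) * duh h p (S.nabla l h))) -
      S.φ (a * duh h 1 (duh h q (S.nabla l h) * duh h 1 (S.nabla m h) * cexp p h)) -
      S.φ (a * duh h 1 (duh h p (S.nabla m h) * duh h 1 (S.nabla l h) * cexp q h)) -
      S.φ (a * duh h 1 (cexp p h * duh h 1 (S.nabla l h) * duh h q (S.nabla m h))) -
      S.φ (duh h 1 a * (cexp q h * S.nabla l (duh h 1 (S.nabla m h)) * cexp p h)) -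
      S.φ (duh h 1 a * (cexp p h * S.nabla m (duh h 1 (S.nabla l h)) * cexp q h)) := by
  have hn : ∀ i, S.nabla i h ∈ S.A := hh.nabla_mem hA
  have hκ : ∀ i, duh h 1 (S.nabla i h) ∈ S.A := fun i => duh_mem S.isClosed hA (hn i) 1
  have sκ : ∀ i, S.Smooth (duh h 1 (S.nabla i h)) := fun i => hh.duh_one (hh.nabla i)
  have hK : ∀ z, cexp z h ∈ S.A := cexp_mem S.isClosed hA
  have hb : duh h 1 a ∈ S.A := duh_mem S.isClosed hA aA 1
  have sb : S.Smooth (duh h 1 a) := hh.duh_one ha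
  have hC : ∀ z i, duh h z (S.nabla i h) ∈ S.A := fun z i => duh_mem S.isClosed hA (hn i) z
  have hD : ∀ z, duh h z a ∈ S.A := fun z => duh_mem S.isClosed hA aA z
  have hN : ∀ i i', S.nabla i (duh h 1 (S.nabla i' h)) ∈ S.A := fun i i' =>
    (sκ i').nabla_mem (hκ i') i
  have mm : ∀ {x y : 𝓑}, x ∈ S.A → y ∈ S.A → x * y ∈ S.A := S.A.mul_mem
  have td := fun z {X : 𝓑} (hX : X ∈ S.A) =>
    trace_mul_duh S.isClosed S.trace_comm hA aA hX z
  -- cyclicity of the trace, moving the first or the last of four factors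
  have rot : ∀ {w x y z : 𝓑}, w ∈ S.A → x ∈ S.A → y ∈ S.A → z ∈ S.A →
      S.φ (w * x * y * z) = S.φ (x * (y * z * w)) := fun {w x y z} hw hx hy hz => by
    have := S.trace_comm w hw (x * y * z) (mm (mm hx hy) hz)
    simpa only [mul_assoc] using this
  have rot' : ∀ {w x y z : 𝓑}, w ∈ S.A → x ∈ S.A → y ∈ S.A → z ∈ S.A →
      S.φ (w * x * y * z) = S.φ (z * (w * x * y)) := fun {w x y z} hw hx hy hz =>
    S.trace_comm (w * x * y) (mm (mm hw hx) hy) z hz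
  have A1 : S.φ (duh h p a * duh h 1 (S.nabla l h) * cexp q h * duh h 1 (S.nabla m h)) =
      S.φ (a * duh h p (duh h 1 (S.nabla l h) * cexp q h * duh h 1 (S.nabla m h))) := by
    rw [td p (mm (mm (hκ l) (hK q)) (hκ m))]
    simp only [mul_assoc]
  have A3 : S.φ (cexp p h * duh h 1 (S.nabla l h) * duh h q a * duh h 1 (S.nabla m h)) =
      S.φ (a * duh h q (duh h 1 (S.nabla m h) * cexp p h * duh h 1 (S.nabla l h))) := by
    rw [td q (mm (mm (hκ m) (hK p)) (hκ l)), rot (hK p) (hκ l) (hD q) (hκ m),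
      S.trace_comm _ (hκ l) _ (mm (mm (hD q) (hκ m)) (hK p))]
    simp only [mul_assoc]
  have A2 := ((((hh.cexp p).mul sb).mul (hh.cexp q)).mul (sκ m)).trace_nabla l
  rw [(((hh.cexp p).mul sb).mul (hh.cexp q)).nabla_mul (sκ m),
    ((hh.cexp p).mul sb).nabla_mul (hh.cexp q), (hh.cexp p).nabla_mul sb, hh.nabla_cexp,
    hh.nabla_cexp, add_mul, add_mul, add_mul, map_add, map_add, map_add,
    rot (hC p l) hb (hK q) (hκ m), ← td 1 (mm (mm (hK q) (hκ m)) (hC p l)),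
    rot (hK p) hb (hC q l) (hκ m), ← td 1 (mm (mm (hC q l) (hκ m)) (hK p)),
    rot (hK p) hb (hK q) (hN l m)] at A2
  have A4 := ((((hh.cexp p).mul (sκ l)).mul (hh.cexp q)).mul sb).trace_nabla m
  rw [(((hh.cexp p).mul (sκ l)).mul (hh.cexp q)).nabla_mul sb,
    ((hh.cexp p).mul (sκ l)).nabla_mul (hh.cexp q), (hh.cexp p).nabla_mul (sκ l), hh.nabla_cexp,
    hh.nabla_cexp, add_mul, add_mul, add_mul, map_add, map_add, map_add,
    rot' (hC p m) (hκ l) (hK q) hb, ← td 1 (mm (mm (hC p m) (hκ l)) (hK q)),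
    rot' (hK p) (hN m l) (hK q) hb, rot' (hK p) (hκ l) (hC q m) hb,
    ← td 1 (mm (mm (hK p) (hκ l)) (hC q m))] at A4
  rw [prodDeriv, map_add, map_add, map_add, A1, A3]
  linear_combination A2 + A4

/-- For symmetric weights the two orderings of the indices combine to `varOp`. -/
theorem sum_trace_prodDeriv (hh : S.Smooth h) (ha : S.Smooth a) (hA : h ∈ S.A) (aA : a ∈ S.A)
    {w : Fin 2 → Fin 2 → ℂ} (hw : ∀ l m, w l m = w m l) (p q : ℂ) :
    ∑ l, ∑ m, w l m * S.φ (prodDeriv a p q h (duh h 1 (S.nabla l h)) (duh h 1 (S.nabla m h))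
        (S.nabla l (duh h 1 a)) (S.nabla m (duh h 1 a))) =
      ∑ l, ∑ m, w l m *
        (S.φ (a * (varOp (S.nabla l h) (S.nabla m h) p q h +
            varOp (S.nabla l h) (S.nabla m h) q p h)) +
          S.φ (duh h 1 a * -(cexp p h * S.nabla l (duh h 1 (S.nabla m h)) * cexp q h +
            cexp q h * S.nabla l (duh h 1 (S.nabla m h)) * cexp p h))) := by
  simp only [S.trace_prodDeriv hh ha hA aA, varOp, mul_add, mul_sub, mul_neg, map_add, map_sub,
    map_neg, Fin.sum_univ_two, hw 1 0]
  ring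

theorem sum_sum_mul_integral {f : Fin 2 → Fin 2 → ℝ → ℂ} (hf : ∀ l m, Integrable (f l m))
    (w : Fin 2 → Fin 2 → ℂ) :
    ∑ l, ∑ m, w l m * ∫ ξ, f l m ξ = ∫ ξ, ∑ l, ∑ m, w l m * f l m ξ := by
  have h1 := fun l m => (hf l m).const_mul (w l m)
  rw [integral_finsetSum _ fun l _ => integrable_finsetSum _ fun m _ => h1 l m]
  simp only [integral_finsetSum _ fun m _ => h1 _ m, integral_const_mul]

/-- The variation formula in terms of Fourier representations `β`, `γ₁`, `γ₂` of the spectral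
functions `T`, `∑ I` and `∑ II`. -/
theorem hasDerivAt_trace_sum [TopologicalSpace.SeparableSpace E] {T : ℝ → ℂ} (hβ : Integrable β)
    (hβ' : Integrable fun ξ => |ξ| * ‖β ξ‖) (hh : S.Smooth h) (ha : S.Smooth a) (hA : h ∈ S.A)
    (aA : a ∈ S.A) (hsa : IsSelfAdjoint h) (asa : IsSelfAdjoint a)
    (hT : ∀ x : ℝ, |x| ≤ 2 * ‖h‖ + 1 →
      T (Real.exp x) = ∫ ξ : ℝ, β ξ * Complex.exp (-(Complex.I * (x * ξ))))
    (hTs : ContDiffOn ℝ ∞ T (Ioi 0)) (j : ℝ) {γ₁ : ℝ → ℂ} (hγ₁ : Integrable γ₁)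
    (hγ₁T : ∀ x : ℝ, |x| ≤ 2 * ‖h‖ → NCTorus.opI T j (Real.exp x) =
      ∫ ξ : ℝ, γ₁ ξ * Complex.exp (-(Complex.I * (x * ξ))))
    {γ₂ : ℝ × ℝ → ℂ} (hγ₂ : Integrable γ₂)
    (hγ₂T : ∀ x₁ x₂ : ℝ, |x₁| ≤ 2 * ‖h‖ → |x₂| ≤ 2 * ‖h‖ →
      NCTorus.opII T j (Real.exp x₁) (Real.exp x₂) =
        ∫ ξ : ℝ × ℝ, γ₂ ξ * Complex.exp (-(Complex.I * (x₁ * ξ.1 + x₂ * ξ.2))))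
    {w : Fin 2 → Fin 2 → ℂ} (hw : ∀ l m, w l m = w m l) :
    HasDerivAt (fun ε : ℝ => S.φ (∑ l, ∑ m, w l m • ∫ ξ, β ξ •
        (cexp (expP j ξ) (h + (ε : ℂ) • a) * S.nabla l (cexp 1 (h + (ε : ℂ) • a)) *
          cexp (expQ ξ) (h + (ε : ℂ) • a) * S.nabla m (cexp 1 (h + (ε : ℂ) • a)))))
      (S.φ (duh h 1 a * cexp (j : ℂ) h *
          ∑ l, ∑ m, w l m • modInt₁ γ₁ (S.nabla l (S.nabla m (cexp 1 h))) h) +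
        S.φ (duh h 1 a * cexp ((j - 1 : ℝ) : ℂ) h *
          ∑ l, ∑ m, w l m • modInt₂ γ₂ (S.nabla l (cexp 1 h)) (S.nabla m (cexp 1 h)) h)) 0 := by
  let G : Fin 2 → ℝ → 𝓑 := fun l ε => fderiv ℝ (NormedSpace.exp : 𝓑 → 𝓑) (h + (ε : ℂ) • a)
    (S.nabla l h + (ε : ℂ) • S.nabla l a)
  have hG : ∀ l (ε : ℝ), S.nabla l (cexp 1 (h + (ε : ℂ) • a)) = G l ε := fun l ε => by
    rw [(hh.add (ha.smul _)).nabla_cexp, hh.nabla_add_smul ha, ← fderiv_exp]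
  have hline : ∀ x y : 𝓑, ContDiff ℝ ∞ fun ε : ℝ => x + (ε : ℂ) • y := fun x y =>
    contDiff_const.add (Complex.ofRealCLM.contDiff.smul contDiff_const)
  have hGs : ∀ l, ContDiff ℝ ∞ (G l) := fun l =>
    ((contDiff_exp.fderiv_right (m := ∞) (by simp)).comp (hline h a)).clm_apply
      (hline (S.nabla l h) (S.nabla l a))
  have hG0 : ∀ l, G l 0 = duh h 1 (S.nabla l h) := fun l => by
    simp only [G, Complex.ofReal_zero, zero_smul, add_zero, fderiv_exp]
  have hG' : ∀ l, deriv (G l) 0 = S.nabla l (duh h 1 a) := fun l =>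
    (S.hasDerivAt_fderiv_exp_nabla hh ha l).deriv
  have hκ : ∀ l, S.nabla l (cexp 1 h) = duh h 1 (S.nabla l h) := fun l => hh.nabla_cexp 1 l
  have hκA : ∀ l, duh h 1 (S.nabla l h) ∈ S.A := fun l =>
    duh_mem S.isClosed hA (hh.nabla_mem hA l) 1
  have hD := fun l m => hasDerivAt_integral_cexp_mul_cexp_mul hβ hβ' hsa asa (hGs l) (hGs m) j
  simp only [hG0, hG'] at hD
  simp only [hG, hκ]
  have h1 : HasDerivAt (fun ε : ℝ => ∑ l, ∑ m, w l m • ∫ ξ, β ξ •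
        (cexp (expP j ξ) (h + (ε : ℂ) • a) * G l ε * cexp (expQ ξ) (h + (ε : ℂ) • a) * G m ε))
      (∑ l, ∑ m, w l m • ∫ ξ, β ξ • prodDeriv a (expP j ξ) (expQ ξ) h (duh h 1 (S.nabla l h))
        (duh h 1 (S.nabla m h)) (S.nabla l (duh h 1 a)) (S.nabla m (duh h 1 a))) 0 :=
    HasDerivAt.fun_sum fun l _ => HasDerivAt.fun_sum fun m _ => (hD l m).2.const_smul (w l m)
  refine ((S.φ.restrictScalars ℝ).hasFDerivAt.comp_hasDerivAt (0 : ℝ) h1).congr_deriv ?_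
  change S.φ _ = _
  have hint := fun (x : 𝓑) {f : ℝ → 𝓑} (hf : Integrable f) =>
    (S.φ.comp (ContinuousLinearMap.mul ℂ 𝓑 x)).integral_comp_comm hf
  have hI := fun l m => integrable_smul_varOp hβ hβ' hsa (S.nabla l h) (S.nabla m h) j
  have hI' := fun l m => integrable_smul_neg_cexp hβ hsa (S.nabla l (duh h 1 (S.nabla m h))) j
  have hv := fun l m => integral_varOp hβ hβ' hsa hT hTs j hγ₂ hγ₂T (S.nabla l h) (S.nabla m h)
  have hv' := fun l m => integral_cexp_mul_mul_cexp hβ hsa (fun x hx => hT x (by linarith)) j hγ₁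
    hγ₁T (S.nabla l (duh h 1 (S.nabla m h)))
  have e2 : ∀ l m, S.φ (duh h 1 a * cexp ((j - 1 : ℝ) : ℂ) h *
      modInt₂ γ₂ (duh h 1 (S.nabla l h)) (duh h 1 (S.nabla m h)) h) =
      ∫ ξ, S.φ (a * (β ξ • (varOp (S.nabla l h) (S.nabla m h) (expP j ξ) (expQ ξ) h +
        varOp (S.nabla l h) (S.nabla m h) (expQ ξ) (expP j ξ) h))) := fun l m => by
    refine Eq.trans ?_ (hint a (hI l m)).symm
    change _ = S.φ (a * _)
    rw [hv, trace_mul_duh S.isClosed S.trace_comm hA aA (S.A.mul_mem (cexp_mem S.isClosed hA _)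
      (modInt₂_mem S.isClosed hA (hκA l) (hκA m) γ₂)), mul_assoc]
  have e1 : ∀ l m, S.φ (duh h 1 a * cexp (j : ℂ) h *
      modInt₁ γ₁ (S.nabla l (duh h 1 (S.nabla m h))) h) =
      ∫ ξ, S.φ (duh h 1 a * (β ξ • -(cexp (expP j ξ) h * S.nabla l (duh h 1 (S.nabla m h)) *
        cexp (expQ ξ) h + cexp (expQ ξ) h * S.nabla l (duh h 1 (S.nabla m h)) *
          cexp (expP j ξ) h))) := fun l m => by
    refine Eq.trans ?_ (hint (duh h 1 a) (hI' l m)).symm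
    change _ = S.φ (duh h 1 a * _)
    rw [hv', mul_assoc]
  have e0 := fun l m => (S.φ.integral_comp_comm (hD l m).1).symm
  simp only [map_sum, map_smul, Finset.mul_sum, mul_smul_comm, e0, e1, e2, smul_eq_mul]
  have i0 := fun l m => S.φ.integrable_comp (hD l m).1
  have i2 := fun l m => (S.φ.comp (ContinuousLinearMap.mul ℂ 𝓑 a)).integrable_comp (hI l m)
  have i1 := fun l m =>
    (S.φ.comp (ContinuousLinearMap.mul ℂ 𝓑 (duh h 1 a))).integrable_comp (hI' l m)
  simp only [ContinuousLinearMap.comp_apply, ContinuousLinearMap.mul_apply', map_smul,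
    smul_eq_mul] at i0 i1 i2
  rw [sum_sum_mul_integral i0, sum_sum_mul_integral i1, sum_sum_mul_integral i2, ← integral_add
    (integrable_finsetSum _ fun l _ => integrable_finsetSum _ fun m _ => (i1 l m).const_mul _)
    (integrable_finsetSum _ fun l _ => integrable_finsetSum _ fun m _ => (i2 l m).const_mul _)]
  refine integral_congr_ae (Eventually.of_forall fun ξ => ?_)
  have key := S.sum_trace_prodDeriv hh ha hA aA hw (expP j ξ) (expQ ξ)
  simp only [Fin.sum_univ_two] at key ⊢
  linear_combination β ξ * key

end TracialAction

end Differentiation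

/-! ### The noncommutative torus -/

section NoncommutativeTorus

open NCTorus

instance separableSpace_hil : TopologicalSpace.SeparableSpace Hil := by
  rw [← TopologicalSpace.isSeparable_univ_iff]
  have h1 : TopologicalSpace.IsSeparable
      (range fun n : ℤ × ℤ => (lp.single 2 n (1 : ℂ) : Hil)) := (countable_range _).isSeparable
  refine (h1.span (R := ℂ)).closure.mono fun f _ => ?_
  refine mem_closure_of_tendsto (lp.hasSum_single (by simp) f)
    (Filter.Eventually.of_forall fun s => Submodule.sum_mem _ fun n _ => ?_)
  have : (lp.single 2 n (f n) : Hil) = f n • lp.single 2 n (1 : ℂ) := by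
    rw [← lp.single_smul, smul_eq_mul, mul_one]
  rw [this]
  exact Submodule.smul_mem _ _ (Submodule.subset_span ⟨n, rfl⟩)

/-- A weighted permutation as a bounded operator. -/
noncomputable def permOp (σ : Equiv.Perm (ℤ × ℤ)) (c : ℤ × ℤ → Circle) : Op :=
  (weightedPerm σ c).toContinuousLinearMap

variable (σ : Equiv.Perm (ℤ × ℤ)) (c : ℤ × ℤ → Circle)

theorem permOp_apply (f : Hil) (n : ℤ × ℤ) : permOp σ c f n = (c n : ℂ) * f (σ n) := rfl

theorem op_ext {a b : Op} (hab : ∀ (f : Hil) n, a f n = b f n) : a = b :=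
  ContinuousLinearMap.ext fun f => lp.ext (funext fun n => hab f n)

theorem op_mul_apply (a b : Op) (f : Hil) : (a * b) f = a (b f) := rfl

theorem permOp_mul_inv :
    permOp σ c * permOp σ.symm (fun n => (c (σ.symm n))⁻¹) = 1 := by
  refine op_ext fun f n => ?_
  change permOp σ c (permOp σ.symm (fun n => (c (σ.symm n))⁻¹) f) n = f n
  rw [permOp_apply, permOp_apply, Equiv.symm_apply_apply, ← mul_assoc, Circle.coe_inv,
    mul_inv_cancel₀ (Circle.coe_ne_zero _), one_mul]

theorem permOp_mem_unitary : permOp σ c ∈ unitary Op := by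
  have h1 : star (permOp σ c) * permOp σ c = 1 := by
    refine ContinuousLinearMap.ext fun f => ext_inner_right ℂ fun g => ?_
    change inner ℂ (ContinuousLinearMap.adjoint (permOp σ c) (permOp σ c f)) g = inner ℂ f g
    rw [ContinuousLinearMap.adjoint_inner_left]
    exact (weightedPerm σ c).inner_map_map f g
  have h2 := permOp_mul_inv σ c
  have h3 : star (permOp σ c) = permOp σ.symm (fun n => (c (σ.symm n))⁻¹) := by
    rw [← mul_one (star _), ← h2, ← mul_assoc, h1, one_mul]
  exact ⟨h1, by rw [h3, h2]⟩

theorem commute_star_of_mem_unitary {R x : Op} (hR : R ∈ unitary Op) (h : x * R = R * x) :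
    x * star R = star R * x := by
  calc x * star R = (star R * R) * x * star R := by rw [Unitary.star_mul_self_of_mem hR, one_mul]
    _ = star R * (x * R) * star R := by rw [h]; noncomm_ring
    _ = star R * x * (R * star R) := by noncomm_ring
    _ = star R * x := by rw [Unitary.mul_star_self_of_mem hR, mul_one]

/-- The vector `e₀ = δ_{(0,0)}` implementing the trace. -/
noncomputable def vac : Hil := lp.single 2 (0 : ℤ × ℤ) (1 : ℂ)

theorem trace_eq_apply (a : Op) : trace a = a vac 0 := by
  rw [trace, lp.inner_single_left]
  simp [vac]

theorem trace_star (a : Op) : trace (star a) = star (trace a) := by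
  rw [trace, trace, ContinuousLinearMap.star_eq_adjoint, ContinuousLinearMap.adjoint_inner_right]
  exact (inner_conj_symm _ _).symm

variable (θ : ℝ)

/-- The right translation in the first direction, twisted so that it commutes with `U` and `V`. -/
noncomputable def rightU : Op :=
  permOp (Equiv.prodCongr (Equiv.subRight 1) (Equiv.refl ℤ))
    (fun p => Circle.exp (2 * Real.pi * θ * p.2))

/-- The right translation in the second direction. -/
noncomputable def rightV : Op := permOp (Equiv.prodCongr (Equiv.refl ℤ) (Equiv.subRight 1)) 1

theorem contTorus_induction {p : Op → Prop} (hU : p genU) (hV : p (genV θ))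
    (algebraMap : ∀ r, p (algebraMap ℂ Op r)) (add : ∀ x ∈ contTorus θ, ∀ y ∈ contTorus θ,
      p x → p y → p (x + y))
    (mul : ∀ x ∈ contTorus θ, ∀ y ∈ contTorus θ, p x → p y → p (x * y))
    (star : ∀ x ∈ contTorus θ, p x → p (star x)) (closed : IsClosed {x | p x}) {a : Op}
    (ha : a ∈ contTorus θ) : p a := by
  have hle := StarSubalgebra.le_topologicalClosure (StarAlgebra.adjoin ℂ {genU, genV θ})
  refine closure_minimal (s := (StarAlgebra.adjoin ℂ {genU, genV θ} : Set Op)) (t := {x | p x})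
    (fun x hx => ?_) closed ha
  refine StarAlgebra.adjoin_induction (p := fun x _ => p x) ?_ algebraMap
    (fun x y hx hy => add x (hle hx) y (hle hy)) (fun x y hx hy => mul x (hle hx) y (hle hy))
    (fun x hx => star x (hle hx)) hx
  rintro x (rfl | rfl)
  exacts [hU, hV]

theorem commute_of_mem_contTorus {R : Op} (hR : R ∈ unitary Op) (hU : genU * R = R * genU)
    (hV : genV θ * R = R * genV θ) {a : Op} (ha : a ∈ contTorus θ) : a * R = R * a := by
  refine contTorus_induction θ (p := fun a => a * R = R * a) hU hV
    (fun r => Algebra.commutes r R) (fun x _ y _ hx hy => by rw [add_mul, hx, hy, mul_add])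
    (fun x _ y _ hx hy => by rw [mul_assoc, hy, ← mul_assoc, hx, mul_assoc])
    (fun x _ hx => ?_) (isClosed_eq (by fun_prop) (by fun_prop)) ha
  have := congrArg star (commute_star_of_mem_unitary hR hx)
  rw [star_mul, star_mul, star_star] at this
  exact this.symm

theorem genU_mem : genU ∈ contTorus θ :=
  StarSubalgebra.le_topologicalClosure _ (StarAlgebra.subset_adjoin ℂ _ (by simp))

theorem genV_mem : genV θ ∈ contTorus θ :=
  StarSubalgebra.le_topologicalClosure _ (StarAlgebra.subset_adjoin ℂ _ (by simp))

theorem genU_apply (f : Hil) (p : ℤ × ℤ) : genU f p = f (p.1 - 1, p.2) :=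
  one_mul _

theorem genV_apply (f : Hil) (p : ℤ × ℤ) :
    genV θ f p = Circle.exp (2 * Real.pi * θ * p.1) * f (p.1, p.2 - 1) := rfl

theorem rightU_apply (f : Hil) (p : ℤ × ℤ) :
    rightU θ f p = Circle.exp (2 * Real.pi * θ * p.2) * f (p.1 - 1, p.2) := rfl

theorem rightV_apply (f : Hil) (p : ℤ × ℤ) : rightV f p = f (p.1, p.2 - 1) :=
  one_mul _

theorem rightU_mem_unitary : rightU θ ∈ unitary Op := permOp_mem_unitary _ _

theorem rightV_mem_unitary : rightV ∈ unitary Op := permOp_mem_unitary _ _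

theorem commute_rightU {a : Op} (ha : a ∈ contTorus θ) : a * rightU θ = rightU θ * a := by
  refine commute_of_mem_contTorus θ (rightU_mem_unitary θ) (op_ext fun f n => ?_)
    (op_ext fun f n => ?_) ha
  · rw [op_mul_apply, op_mul_apply, genU_apply, rightU_apply, rightU_apply, genU_apply]
  · rw [op_mul_apply, op_mul_apply, genV_apply, rightU_apply, rightU_apply, genV_apply,
      ← mul_assoc, ← mul_assoc, ← Circle.coe_mul, ← Circle.coe_mul, ← Circle.exp_add,
      ← Circle.exp_add]
    congr 3
    push_cast
    ring

theorem commute_rightV {a : Op} (ha : a ∈ contTorus θ) : a * rightV = rightV * a := by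
  refine commute_of_mem_contTorus θ rightV_mem_unitary (op_ext fun f n => ?_)
    (op_ext fun f n => ?_) ha
  · rw [op_mul_apply, op_mul_apply, genU_apply, rightV_apply, rightV_apply, genU_apply]
  · rw [op_mul_apply, op_mul_apply, genV_apply, rightV_apply, rightV_apply, genV_apply]

theorem genU_vac : genU vac = rightU θ vac := by
  refine lp.ext (funext fun p => ?_)
  rw [genU_apply, rightU_apply]
  by_cases hp : p.2 = 0
  · simp [hp]
  · have : ((p.1 - 1, p.2) : ℤ × ℤ) ≠ 0 := fun h => hp (congrArg Prod.snd h)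
    rw [vac, lp.single_apply_ne _ _ _ this, mul_zero]

theorem genV_vac : genV θ vac = rightV vac := by
  refine lp.ext (funext fun p => ?_)
  rw [genV_apply, rightV_apply]
  by_cases hp : p.1 = 0
  · simp [hp]
  · have : ((p.1, p.2 - 1) : ℤ × ℤ) ≠ 0 := fun h => hp (congrArg Prod.fst h)
    rw [vac, lp.single_apply_ne _ _ _ this, mul_zero]

theorem continuous_trace : Continuous trace := by
  unfold trace
  fun_prop

/-- The functional `φ₀` is a trace on `C(𝕋²_θ)`: the generators act on `e₀` as the right
translations do, and the latter commute with the algebra. -/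
theorem trace_mul_comm {a b : Op} (ha : a ∈ contTorus θ) (hb : b ∈ contTorus θ) :
    trace (a * b) = trace (b * a) := by
  have key : ∀ b ∈ contTorus θ, trace (a * b) = trace (b * a) := by
    refine contTorus_induction θ
      (p := fun a => ∀ b ∈ contTorus θ, trace (a * b) = trace (b * a)) ?_ ?_ ?_ ?_ ?_ ?_ ?_ ha
    · intro b hb
      rw [trace_eq_apply, trace_eq_apply, op_mul_apply, op_mul_apply, genU_vac θ, ← op_mul_apply b,
        commute_rightU θ hb, op_mul_apply, genU_apply, rightU_apply]
      simp
    · intro b hb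
      rw [trace_eq_apply, trace_eq_apply, op_mul_apply, op_mul_apply, genV_vac θ, ← op_mul_apply b,
        commute_rightV θ hb, op_mul_apply, genV_apply, rightV_apply]
      simp
    · intro r b _
      rw [Algebra.commutes]
    · intro x _ y _ hx hy b hb
      have hadd : ∀ u v, trace (u + v) = trace u + trace v := fun u v => by
        simp only [trace_eq_apply]; rfl
      rw [add_mul, mul_add, hadd, hadd, hx b hb, hy b hb]
    · intro x hx' y hy' hx hy b hb
      rw [mul_assoc, hx _ (mul_mem hy' hb), mul_assoc, hy _ (mul_mem hb hx'), mul_assoc]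
    · intro x _ hx b hb
      have := hx (star b) (star_mem hb)
      rw [← star_star b, ← star_mul, ← star_mul, trace_star, trace_star, this]
    · simp only [ofPred_forall]
      refine isClosed_iInter fun b => isClosed_iInter fun _ => isClosed_eq ?_ ?_
      · exact continuous_trace.comp (by fun_prop)
      · exact continuous_trace.comp (by fun_prop)
  exact key b hb

theorem modulation_apply (t : Fin 2 → ℝ) (f : Hil) (p : ℤ × ℤ) :
    modulation t f p = Circle.exp (-(t 0 * p.1 + t 1 * p.2)) * f p := rfl

theorem modulation_zero : modulation 0 = 1 := by
  refine op_ext fun f p => ?_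
  rw [modulation_apply]
  simp

theorem modulation_add (s t : Fin 2 → ℝ) : modulation (s + t) = modulation s * modulation t := by
  refine op_ext fun f p => ?_
  rw [op_mul_apply, modulation_apply, modulation_apply, modulation_apply, ← mul_assoc,
    ← Circle.coe_mul, ← Circle.exp_add]
  congr 3
  simp only [Pi.add_apply]
  ring

theorem star_modulation (t : Fin 2 → ℝ) : star (modulation t) = modulation (-t) := by
  have h : star (modulation t) * modulation t = 1 :=
    Unitary.star_mul_self_of_mem (permOp_mem_unitary _ _)
  rw [← one_mul (modulation (-t)), ← h, mul_assoc, ← modulation_add, add_neg_cancel,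
    modulation_zero, mul_one]

theorem modulation_mul_neg (t : Fin 2 → ℝ) : modulation t * modulation (-t) = 1 := by
  rw [← modulation_add, add_neg_cancel, modulation_zero]

theorem modulation_neg_mul (t : Fin 2 → ℝ) : modulation (-t) * modulation t = 1 := by
  rw [← modulation_add, neg_add_cancel, modulation_zero]

theorem translate_genU (t : Fin 2 → ℝ) :
    NCTorus.translate t genU = (Circle.exp (-t 0) : ℂ) • genU := by
  refine op_ext fun f p => ?_
  change modulation t (genU (modulation (-t) f)) p = (Circle.exp (-t 0) : ℂ) * genU f p
  rw [modulation_apply, genU_apply, genU_apply, modulation_apply, ← mul_assoc, ← Circle.coe_mul,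
    ← Circle.exp_add]
  congr 3
  simp only [Pi.neg_apply]
  push_cast
  ring

theorem translate_genV (t : Fin 2 → ℝ) :
    NCTorus.translate t (genV θ) = (Circle.exp (-t 1) : ℂ) • genV θ := by
  refine op_ext fun f p => ?_
  change modulation t (genV θ (modulation (-t) f)) p = (Circle.exp (-t 1) : ℂ) * genV θ f p
  rw [modulation_apply, genV_apply, genV_apply, modulation_apply, ← mul_assoc, ← mul_assoc,
    ← mul_assoc, ← Circle.coe_mul, ← Circle.coe_mul, ← Circle.coe_mul, ← Circle.exp_add,
    ← Circle.exp_add, ← Circle.exp_add]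
  congr 3
  simp only [Pi.neg_apply]
  push_cast
  ring

theorem translate_mul (t : Fin 2 → ℝ) (x y : Op) :
    NCTorus.translate t (x * y) = NCTorus.translate t x * NCTorus.translate t y := by
  calc _ = modulation t * x * 1 * y * modulation (-t) := by
        rw [NCTorus.translate, mul_one]
        simp only [mul_assoc]
    _ = _ := by
      rw [← modulation_neg_mul t, NCTorus.translate, NCTorus.translate]
      simp only [mul_assoc]

theorem translate_star (t : Fin 2 → ℝ) (x : Op) :
    NCTorus.translate t (star x) = star (NCTorus.translate t x) := by
  rw [NCTorus.translate, NCTorus.translate, star_mul, star_mul, star_modulation, star_modulation,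
    neg_neg, mul_assoc]

theorem translate_mem (t : Fin 2 → ℝ) {a : Op} (ha : a ∈ contTorus θ) :
    NCTorus.translate t a ∈ contTorus θ := by
  refine contTorus_induction θ (p := fun a => NCTorus.translate t a ∈ contTorus θ)
    ?_ ?_ ?_ ?_ ?_ ?_ ?_ ha
  · rw [translate_genU]
    exact (contTorus θ).smul_mem (genU_mem θ) _
  · rw [translate_genV]
    exact (contTorus θ).smul_mem (genV_mem θ) _
  · intro r
    rw [NCTorus.translate, ← Algebra.commutes, mul_assoc, modulation_mul_neg, mul_one]
    exact (contTorus θ).algebraMap_mem r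
  · intro x _ y _ hx hy
    have := add_mem hx hy
    rwa [NCTorus.translate, NCTorus.translate, ← add_mul, ← mul_add] at this
  · intro x _ y _ hx hy
    rw [translate_mul]
    exact mul_mem hx hy
  · intro x _ hx
    rw [translate_star]
    exact star_mem hx
  · exact (StarSubalgebra.isClosed_topologicalClosure _).preimage
      (f := NCTorus.translate t) (by unfold NCTorus.translate; fun_prop)

theorem trace_translate (t : Fin 2 → ℝ) (a : Op) : trace (NCTorus.translate t a) = trace a := by
  have hv : modulation (-t) vac = vac := by
    refine lp.ext (funext fun p => ?_)
    rw [modulation_apply]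
    by_cases hp : p = 0
    · simp [hp]
    · rw [vac, lp.single_apply_ne _ _ _ hp, mul_zero]
  rw [trace_eq_apply, trace_eq_apply]
  change modulation t (a (modulation (-t) vac)) 0 = _
  rw [hv, modulation_apply]
  simp

/-- The canonical trace as a bounded functional. -/
noncomputable def traceCLM : Op →L[ℂ] ℂ :=
  (innerSL ℂ vac).comp (ContinuousLinearMap.apply ℂ Hil vac)

/-- The translations of the noncommutative torus as a `TracialAction`. -/
noncomputable def torusAction : TracialAction Hil where
  A := (contTorus θ).toSubalgebra
  isClosed := StarSubalgebra.isClosed_topologicalClosure _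
  φ := traceCLM
  trace_comm _ ha _ hb := trace_mul_comm θ ha hb
  u := modulation
  u_zero := modulation_zero
  u_add := modulation_add
  conj_mem t _ ha := translate_mem θ t ha
  trace_conj := trace_translate

end NoncommutativeTorus

/-! ### The modular calculus of the torus and the variation formula -/

section Variation

open NCTorus Filter Topology

theorem deriv_exp_line {E : Type*} [NormedAddCommGroup E] [InnerProductSpace ℂ E] [CompleteSpace E]
    (h a : E →L[ℂ] E) :
    deriv (fun ε : ℝ => NormedSpace.exp (h + (ε : ℂ) • a)) 0 = duh h 1 a := by
  have := (hasDerivAt_cexp_curve (hasDerivAt_add_ofReal_smul h a 0) 1).deriv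
  simpa only [cexp, one_smul, Complex.ofReal_zero, zero_smul, add_zero] using this

theorem varWeyl_eq (h a : Op) : varWeyl h a = duh h 1 a := deriv_exp_line h a

theorem weylPow_eq (h : Op) (j : ℝ) : weylPow h j = cexp (j : ℂ) h := rfl

theorem weyl_eq (h : Op) : weyl h = cexp 1 h := by rw [weyl, cexp, one_smul]

theorem nabla_eq (θ : ℝ) (l : Fin 2) (x : Op) : NCTorus.nabla l x = (torusAction θ).nabla l x := rfl

theorem modPow_eq (h : Op) (ξ : ℝ) (ρ : Op) :
    modPow h (-(Complex.I * ξ)) ρ = modRot h ξ ρ := by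
  rw [modPow, modRot, cexp, cexp, ← neg_smul, neg_neg]

theorem isModCalc₁_iff {h ρ b : Op} {K : ℝ → ℂ} :
    IsModCalc₁ h K ρ b ↔ ∃ β : ℝ → ℂ, Integrable β ∧
      (∀ x : ℝ, |x| ≤ 2 * ‖h‖ →
        K (Real.exp x) = ∫ ξ : ℝ, β ξ * Complex.exp (-(Complex.I * (x * ξ)))) ∧
      b = modInt₁ β ρ h := by
  unfold IsModCalc₁
  simp only [modPow_eq]
  exact Iff.rfl

theorem isModCalc₂_iff {h ρ₁ ρ₂ b : Op} {K : ℝ → ℝ → ℂ} :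
    IsModCalc₂ h K ρ₁ ρ₂ b ↔ ∃ β : ℝ × ℝ → ℂ, Integrable β ∧
      (∀ x₁ x₂ : ℝ, |x₁| ≤ 2 * ‖h‖ → |x₂| ≤ 2 * ‖h‖ →
        K (Real.exp x₁) (Real.exp x₂) =
          ∫ ξ : ℝ × ℝ, β ξ * Complex.exp (-(Complex.I * (x₁ * ξ.1 + x₂ * ξ.2)))) ∧
      b = modInt₂ β ρ₁ ρ₂ h := by
  unfold IsModCalc₂
  simp only [modPow_eq]
  exact Iff.rfl

theorem isModCalc₁_unique {h ρ b b' : Op} {K : ℝ → ℂ} (hh : IsSelfAdjoint h)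
    (hb : IsModCalc₁ h K ρ b) (hb' : IsModCalc₁ h K ρ b') : b = b' := by
  obtain ⟨β, hβ, hK, rfl⟩ := isModCalc₁_iff.1 hb
  obtain ⟨β', hβ', hK', rfl⟩ := isModCalc₁_iff.1 hb'
  exact modInt₁_congr hh hβ hβ' ρ fun x hx => (hK x hx).symm.trans (hK' x hx)

theorem isModCalc₂_unique {h ρ₁ ρ₂ b b' : Op} {K : ℝ → ℝ → ℂ} (hh : IsSelfAdjoint h)
    (hb : IsModCalc₂ h K ρ₁ ρ₂ b) (hb' : IsModCalc₂ h K ρ₁ ρ₂ b') : b = b' := by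
  obtain ⟨β, hβ, hK, rfl⟩ := isModCalc₂_iff.1 hb
  obtain ⟨β', hβ', hK', rfl⟩ := isModCalc₂_iff.1 hb'
  exact modInt₂_congr hh hβ hβ' ρ₁ ρ₂ fun x₁ x₂ h₁ h₂ =>
    (hK x₁ x₂ h₁ h₂).symm.trans (hK' x₁ x₂ h₁ h₂)

theorem modCalc₁_eq {h b ρ : Op} {K : ℝ → ℂ} (hh : IsSelfAdjoint h) (hb : IsModCalc₁ h K ρ b) :
    modCalc₁ h K ρ = b :=
  isModCalc₁_unique hh (Classical.epsilon_spec ⟨b, hb⟩) hb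

theorem modCalc₂_eq {h b ρ₁ ρ₂ : Op} {K : ℝ → ℝ → ℂ} (hh : IsSelfAdjoint h)
    (hb : IsModCalc₂ h K ρ₁ ρ₂ b) : modCalc₂ h K ρ₁ ρ₂ = b :=
  isModCalc₂_unique hh (Classical.epsilon_spec ⟨b, hb⟩) hb

theorem existsUnique_isModCalc₁ {h : Op} (hh : IsSelfAdjoint h) {K : ℝ → ℂ}
    (hK : ContDiff ℝ ∞ fun x => K (Real.exp x)) (ρ : Op) : ∃! b, IsModCalc₁ h K ρ b := by
  obtain ⟨β, hβ⟩ := exists_schwartz_rep_real hK (2 * ‖h‖)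
  have hb : IsModCalc₁ h K ρ (modInt₁ β ρ h) := isModCalc₁_iff.2 ⟨β, β.integrable, hβ, rfl⟩
  exact ⟨_, hb, fun b' hb' => isModCalc₁_unique hh hb' hb⟩

theorem existsUnique_isModCalc₂ {h : Op} (hh : IsSelfAdjoint h) {K : ℝ → ℝ → ℂ}
    (hK : ContDiff ℝ ∞ fun x : ℝ × ℝ => K (Real.exp x.1) (Real.exp x.2)) (ρ₁ ρ₂ : Op) :
    ∃! b, IsModCalc₂ h K ρ₁ ρ₂ b := by
  obtain ⟨β, hβ, hK'⟩ := exists_integrable_rep_prod hK (2 * ‖h‖)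
  have hb : IsModCalc₂ h K ρ₁ ρ₂ (modInt₂ β ρ₁ ρ₂ h) := isModCalc₂_iff.2 ⟨β, hβ, hK', rfl⟩
  exact ⟨_, hb, fun b' hb' => isModCalc₂_unique hh hb' hb⟩

theorem cexp_mul_modInt₁_mul {E : Type*} [NormedAddCommGroup E] [InnerProductSpace ℂ E]
    [CompleteSpace E] {h : E →L[ℂ] E} (hh : IsSelfAdjoint h) {β : ℝ → ℂ} (hβ : Integrable β)
    (j : ℝ) (ρ X : E →L[ℂ] E) :
    cexp (j : ℂ) h * modInt₁ β ρ h * X =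
      ∫ ξ, β ξ • (cexp (expP j ξ) h * ρ * cexp (expQ ξ) h * X) := by
  rw [modInt₁, mul_integral_mul _ _ (integrable_smul_modRot hβ hh ρ)]
  refine integral_congr_ae (Eventually.of_forall fun ξ => ?_)
  simp only [modRot, expP, expQ, cexp_add, mul_smul_comm, smul_mul_assoc, mul_assoc]

theorem isSelfAdjoint_add_smul {h a : Op} (hh : IsSelfAdjoint h) (ha : IsSelfAdjoint a) (ε : ℝ) :
    IsSelfAdjoint (h + (ε : ℂ) • a) :=
  hh.add (IsSelfAdjoint.smul (Complex.conj_ofReal ε) ha)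

/-- The first moment of `β` is finite, as differentiation under the integral sign requires. -/
theorem exists_moment_rep {T : ℝ → ℂ} (hT : ContDiff ℝ ∞ T) (R : ℝ) :
    ∃ β : ℝ → ℂ, Integrable β ∧ (Integrable fun ξ => |ξ| * ‖β ξ‖) ∧ ∀ x : ℝ, |x| ≤ R →
      T x = ∫ ξ : ℝ, β ξ * Complex.exp (-(Complex.I * (x * ξ))) := by
  obtain ⟨β, hβ⟩ := exists_schwartz_rep_real hT R
  exact ⟨β, β.integrable, by simpa using β.integrable_pow_mul volume 1, hβ⟩

/-- The local functional near `h`, in terms of one Fourier representation of `T`. -/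
theorem localFunctional_eq (θ : ℝ) (g : Matrix (Fin 2) (Fin 2) ℝ) {T : ℝ → ℂ} (j : ℝ) {h : Op}
    (hsa : IsSelfAdjoint h) {β : ℝ → ℂ} (hβ : Integrable β)
    (hT : ∀ x : ℝ, |x| ≤ 2 * ‖h‖ →
      T (Real.exp x) = ∫ ξ : ℝ, β ξ * Complex.exp (-(Complex.I * (x * ξ)))) :
    localFunctional g j T h = (torusAction θ).φ (∑ l, ∑ m, ((g⁻¹ l m : ℝ) : ℂ) • ∫ ξ, β ξ •
        (cexp (expP j ξ) h * (torusAction θ).nabla l (cexp 1 h) *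
          cexp (expQ ξ) h * (torusAction θ).nabla m (cexp 1 h))) := by
  have e0 : ∀ ρ, modCalc₁ h T ρ = modInt₁ β ρ h := fun ρ =>
    modCalc₁_eq hsa (isModCalc₁_iff.2 ⟨β, hβ, hT, rfl⟩)
  simp only [localFunctional, e0, weylPow_eq, weyl_eq, nabla_eq θ]
  have e1 := fun l m => cexp_mul_modInt₁_mul hsa hβ j ((torusAction θ).nabla l (cexp 1 h))
    ((torusAction θ).nabla m (cexp 1 h))
  simp only [e1]
  rfl

/-- The variation formula, with the functional calculus on the right expressed through Fourier
representations `γ₁` and `γ₂` of `∑ I` and `∑ II`. -/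
theorem hasDerivAt_localFunctional (θ : ℝ) {g : Matrix (Fin 2) (Fin 2) ℝ} (hg : g.PosDef)
    {T : ℝ → ℂ} (hT : ContDiffOn ℝ ∞ T (Set.Ioi 0)) (j : ℝ) {h a : Op} (hh : IsSmooth θ h)
    (ha : IsSmooth θ a) (hsa : IsSelfAdjoint h) (asa : IsSelfAdjoint a) {γ₁ : ℝ → ℂ}
    (hγ₁ : Integrable γ₁) (hγ₁T : ∀ x : ℝ, |x| ≤ 2 * ‖h‖ → opI T j (Real.exp x) =
      ∫ ξ : ℝ, γ₁ ξ * Complex.exp (-(Complex.I * (x * ξ))))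
    {γ₂ : ℝ × ℝ → ℂ} (hγ₂ : Integrable γ₂)
    (hγ₂T : ∀ x₁ x₂ : ℝ, |x₁| ≤ 2 * ‖h‖ → |x₂| ≤ 2 * ‖h‖ →
      opII T j (Real.exp x₁) (Real.exp x₂) =
        ∫ ξ : ℝ × ℝ, γ₂ ξ * Complex.exp (-(Complex.I * (x₁ * ξ.1 + x₂ * ξ.2)))) :
    HasDerivAt (fun ε : ℝ => localFunctional g j T (h + (ε : ℂ) • a))
      ((torusAction θ).φ (duh h 1 a * cexp (j : ℂ) h * ∑ l, ∑ m, ((g⁻¹ l m : ℝ) : ℂ) •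
          modInt₁ γ₁ ((torusAction θ).nabla l ((torusAction θ).nabla m (cexp 1 h))) h) +
        (torusAction θ).φ (duh h 1 a * cexp ((j - 1 : ℝ) : ℂ) h *
          ∑ l, ∑ m, ((g⁻¹ l m : ℝ) : ℂ) • modInt₂ γ₂ ((torusAction θ).nabla l (cexp 1 h))
            ((torusAction θ).nabla m (cexp 1 h)) h)) 0 := by
  -- one `β` for all `|ε| < 1`, with a margin to reach coincident eigenvalues as limits
  obtain ⟨β, hβ, hβ', hβT⟩ := exists_moment_rep (contDiff_comp_exp hT contDiff_id)
    (2 * (‖h‖ + ‖a‖) + 1)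
  have hw : ∀ l m, ((g⁻¹ l m : ℝ) : ℂ) = ((g⁻¹ m l : ℝ) : ℂ) := fun l m => by
    have := hg.isHermitian.inv.apply m l
    rw [star_trivial] at this
    rw [this]
  have key := (torusAction θ).hasDerivAt_trace_sum hβ hβ' (h := h) (a := a) hh.2 ha.2
    hh.1 ha.1 hsa asa (fun x hx => hβT x (by linarith [norm_nonneg a])) hT j hγ₁ hγ₁T hγ₂
    hγ₂T (w := fun l m => ((g⁻¹ l m : ℝ) : ℂ)) hw
  refine key.congr_of_eventuallyEq ?_
  filter_upwards [Metric.ball_mem_nhds (0 : ℝ) one_pos] with ε hε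
  have hn : ‖h + (ε : ℂ) • a‖ ≤ ‖h‖ + ‖a‖ := by
    refine (norm_add_le _ _).trans (add_le_add_right ?_ _)
    rw [norm_smul, Complex.norm_real]
    exact mul_le_of_le_one_left (norm_nonneg _) (mem_ball_zero_iff.1 hε).le
  exact localFunctional_eq θ g j (isSelfAdjoint_add_smul hsa asa ε) hβ fun x hx =>
    hβT x (by linarith)

end Variation

end WeylVariation

theorem mainTheorem8 (θ : ℝ) (g : Matrix (Fin 2) (Fin 2) ℝ) (hg : g.PosDef)
    (T : ℝ → ℂ) (hT : ContDiffOn ℝ ∞ T (Set.Ioi 0)) (j : ℝ)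
    (h a : NCTorus.Op) (hh : NCTorus.IsSmooth θ h) (ha : NCTorus.IsSmooth θ a)
    (hsa : IsSelfAdjoint h) (asa : IsSelfAdjoint a) :
    -- all the expressions of the functional calculus below are well defined
    (∀ (ε : ℝ) (ρ : NCTorus.Op),
      ∃! b, NCTorus.IsModCalc₁ (h + (ε : ℂ) • a) T ρ b) ∧
    (∀ ρ : NCTorus.Op, ∃! b, NCTorus.IsModCalc₁ h (NCTorus.opI T j) ρ b) ∧
    (∀ ρ₁ ρ₂ : NCTorus.Op, ∃! b, NCTorus.IsModCalc₂ h (NCTorus.opII T j) ρ₁ ρ₂ b) ∧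
    -- the variation formula
    HasDerivAt (fun ε : ℝ => NCTorus.localFunctional g j T (h + (ε : ℂ) • a))
      (NCTorus.trace (NCTorus.varWeyl h a * NCTorus.weylPow h j *
          ∑ l, ∑ m, ((g⁻¹ l m : ℝ) : ℂ) •
            NCTorus.modCalc₁ h (NCTorus.opI T j)
              (NCTorus.nabla l (NCTorus.nabla m (NCTorus.weyl h)))) +
        NCTorus.trace (NCTorus.varWeyl h a * NCTorus.weylPow h (j - 1) *
          ∑ l, ∑ m, ((g⁻¹ l m : ℝ) : ℂ) •
            NCTorus.modCalc₂ h (NCTorus.opII T j)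
              (NCTorus.nabla l (NCTorus.weyl h)) (NCTorus.nabla m (NCTorus.weyl h)))) 0 := by
  refine ⟨fun ε ρ => WeylVariation.existsUnique_isModCalc₁
      (WeylVariation.isSelfAdjoint_add_smul hsa asa ε)
      (WeylVariation.contDiff_comp_exp hT contDiff_id) ρ,
    fun ρ => WeylVariation.existsUnique_isModCalc₁ hsa (WeylVariation.contDiff_opI_exp hT j) ρ,
    fun ρ₁ ρ₂ =>
      WeylVariation.existsUnique_isModCalc₂ hsa (WeylVariation.contDiff_opII_exp hT j) ρ₁ ρ₂, ?_⟩
  obtain ⟨γ₁, hγ₁, -, hγ₁T⟩ :=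
    WeylVariation.exists_moment_rep (WeylVariation.contDiff_opI_exp hT j) (2 * ‖h‖)
  obtain ⟨γ₂, hγ₂, hγ₂T⟩ :=
    WeylVariation.exists_integrable_rep_prod (WeylVariation.contDiff_opII_exp hT j) (2 * ‖h‖)
  have e1 := fun ρ => WeylVariation.modCalc₁_eq (ρ := ρ) hsa
    (WeylVariation.isModCalc₁_iff.2 ⟨γ₁, hγ₁, hγ₁T, rfl⟩)
  have e2 := fun ρ₁ ρ₂ => WeylVariation.modCalc₂_eq (ρ₁ := ρ₁) (ρ₂ := ρ₂) hsa
    (WeylVariation.isModCalc₂_iff.2 ⟨γ₂, hγ₂, hγ₂T, rfl⟩)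
  simp only [e1, e2, WeylVariation.varWeyl_eq, WeylVariation.weylPow_eq, WeylVariation.weyl_eq,
    WeylVariation.nabla_eq θ]
  exact WeylVariation.hasDerivAt_localFunctional θ hg hT j hh ha hsa asa hγ₁ hγ₁T hγ₂ hγ₂T
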